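/- Let $H$ be a separable complex Hilbert space, let $\Delta=[0,b\rangle$ with $0<b\le\infty$ (if $b<\infty$, the point $b$ may or may not belong to $\Delta$), let $n\ge 1$, and let $$l[y]=\sum_{k=1}^n(-1)^k\Big((p_{n-k}y^{(k)})^{(k)}-\tfrac i2\big[(q_{n-k}^*y^{(k)})^{(k-1)}+(q_{n-k}y^{(k-1)})^{(k)}\big]\Big)+p_ny$$ be a differential expression whose coefficients $p_0,\dots,p_n$, $q_0,\dots,q_{n-1}$ are norm-continuous functions on $\Delta$ with values in the bounded operators on $H$, where $p_k(t)=p_k(t)^*$ and $p_0(t)$ has a bounded inverse for all $t\in\Delta$. The expression is understood through the quasi-derivatives $y^{[k]}=y^{(k)}$ $(0\le k\le n-1)$, $y^{[n]}=p_0y^{(n)}-\tfrac i2q_0y^{(n-1)}$, $$y^{[n+j]}=p_jy^{(n-j)}+\tfrac i2\big[q_{j-1}^*y^{(n-j+1)}-q_jy^{(n-j-1)}\big]-(y^{[n+j-1]})'\quad(1\le j\le n-1),$$ $y^{[2n]}=p_ny+\tfrac i2q_{n-1}^*y'-(y^{[2n-1]})'$, and $l[y]=y^{[2n]}$; the quasi-derivatives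 of operator functions $Y:\Delta\to[\mathcal K,H]$ are given by the same formulas. (Here $[\mathcal K,H]$ is the space of bounded operators from $\mathcal K$ to $H$.) Let $\mathcal D(l)$ be the set of $y:\Delta\to H$ such that $y^{[k]}$, $0\le k\le 2n-2$, has a continuous derivative on $\Delta$ and $y^{[2n-1]}$ is absolutely continuous on compact subintervals of $\Delta$. In $\mathfrak H=L_2(\Delta;H)$ let $\mathcal D=\{y\in\mathcal D(l)\cap\mathfrak H: l[y]\in\mathfrak H\}$, and let the minimal operator $L_0$ be given by $L_0y=l[y]$ on the set of those $y\in\mathcal D$ for which $y^{[k]}(0)=0$ for $0\le k\le 2n-1$ and $\lim_{t\uparrow b}[y,z](t)=0$ for all $z\in\mathcal D$, where $[y,z]=\sum_{k=0}^{n-1}\big((y^{[k]},z^{[2n-1-k]})-(y^{[2n-1-k]},z^{[k]})\big)$. Put $\mathfrak N_\lambda(L_0)=\operatorname{Ker}(L_0^*-\lambda)$. For a Hilbert space $\mathcal K$ and $\lambda\in\mathbb C$, a function $Z:\Delta\to[\mathcal K,H]$ is called a fundamental solution of $l[y]-\lambda y=0$ if $Z^{[k]}$, $0\le k\le 2n-1$,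 has a continuous derivative on $\Delta$ and $Z^{[2n]}-\lambda Z=0$ on $\Delta$; $Z(\cdot)h\in\mathfrak H$ for all $h\in\mathcal K$; and for every $y\in\mathfrak N_\lambda(L_0)$ there is a unique $h\in\mathcal K$ with $y=Z(\cdot)h$. Theorem. Let $\widetilde A$ be a proper extension of $L_0$, that is, a closed operator in $\mathfrak H$ with $L_0\subset\widetilde A\subset L_0^*$, and let its resolvent set $\rho(\widetilde A)$ be nonempty. Then there are a Hilbert space $\mathcal K'$ and functions $Z(\cdot,\lambda):\Delta\to[\mathcal K',H]$, $\lambda\in\rho(\widetilde A)$, such that $Z(\cdot,\lambda)$ is a fundamental solution of $l[y]-\lambda y=0$ for every $\lambda\in\rho(\widetilde A)$ and, for every fixed $t\in\Delta$, all quasi-derivatives $Z^{[k]}(t,\cdot)$, $k=0,1,\dots,2n-1$, are holomorphic on $\rho(\widetilde A)$ as functions with values in $[\mathcal K',H]$. -/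

import Mathlib

open MeasureTheory Filter Topology
open scoped InnerProductSpace

universe u

noncomputable section

namespace DiffOp

/-- `Δ` is an interval `[0, b⟩` with `0 < b ≤ ∞`; for `b < ∞` the right end may or may not belong
to `Δ`. -/
def IsHalfInterval (Δ : Set ℝ) : Prop :=
  Δ = Set.Ici 0 ∨ ∃ b : ℝ, 0 < b ∧ (Δ = Set.Ico 0 b ∨ Δ = Set.Icc 0 b)

/-- The coefficients of a formally selfadjoint differential expression
`l[y] = ∑_{k=1}^n (-1)^k ((p_{n-k} y^{(k)})^{(k)}
  - (i/2) [(q_{n-k}^* y^{(k)})^{(k-1)} + (q_{n-k} y^{(k-1)})^{(k)}]) + p_n y`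
of order `2n` on `Δ`. Only `p_0, …, p_n` and `q_0, …, q_{n-1}` on `Δ` are used. -/
structure Expression (H : Type u) [NormedAddCommGroup H] [InnerProductSpace ℂ H]
    [CompleteSpace H] (Δ : Set ℝ) (n : ℕ) where
  p : ℕ → ℝ → H →L[ℂ] H
  q : ℕ → ℝ → H →L[ℂ] H
  continuousOn_p : ∀ k ≤ n, ContinuousOn (p k) Δ
  continuousOn_q : ∀ k < n, ContinuousOn (q k) Δ
  isSelfAdjoint_p : ∀ k ≤ n, ∀ t ∈ Δ, IsSelfAdjoint (p k t)
  isUnit_p_zero : ∀ t ∈ Δ, IsUnit (p 0 t)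

section QuasiDerivatives

variable {H : Type u} [NormedAddCommGroup H] [InnerProductSpace ℂ H] [CompleteSpace H]
  {Δ : Set ℝ} {n : ℕ} {E : Type*} [NormedAddCommGroup E] [NormedSpace ℂ E]

/-- `p_j y^{(n-j)} + (i/2) q_{j-1}^* y^{(n-j+1)} - (i/2) q_j y^{(n-j-1)}`, where the term with
`q_{-1}` (for `j = 0`) and the term with `q_n` (for `j = n`) are absent. The coefficients act on
the values of `y` through `act`. -/
def quasiTerm (l : Expression H Δ n) (act : (H →L[ℂ] H) →L[ℂ] E →L[ℂ] E) (y : ℝ → E) (j : ℕ)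
    (t : ℝ) : E :=
  act (l.p j t) (iteratedDerivWithin (n - j) y Δ t)
    + (if 0 < j then
        (Complex.I / 2) • act (ContinuousLinearMap.adjoint (l.q (j - 1) t))
          (iteratedDerivWithin (n - j + 1) y Δ t)
      else 0)
    - (if j < n then
        (Complex.I / 2) • act (l.q j t) (iteratedDerivWithin (n - j - 1) y Δ t)
      else 0)

/-- The quasi-derivatives `y^{[n+j]}`:
`y^{[n]} = p_0 y^{(n)} - (i/2) q_0 y^{(n-1)}` and
`y^{[n+j]} = p_j y^{(n-j)} + (i/2) q_{j-1}^* y^{(n-j+1)} - (i/2) q_j y^{(n-j-1)} - (y^{[n+j-1]})'`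
for `j ≥ 1`. -/
def upperQuasiDeriv (l : Expression H Δ n) (act : (H →L[ℂ] H) →L[ℂ] E →L[ℂ] E) (y : ℝ → E) :
    ℕ → ℝ → E
  | 0 => quasiTerm l act y 0
  | j + 1 => fun t => quasiTerm l act y (j + 1) t - derivWithin (upperQuasiDeriv l act y j) Δ t

/-- The quasi-derivative `y^{[k]}`: the ordinary derivative `y^{(k)}` for `k < n`, and
`upperQuasiDeriv` for `n ≤ k ≤ 2n`. In particular `y^{[2n]} = l[y]`. -/
def quasiDeriv (l : Expression H Δ n) (act : (H →L[ℂ] H) →L[ℂ] E →L[ℂ] E) (y : ℝ → E) (k : ℕ) :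
    ℝ → E :=
  if k < n then iteratedDerivWithin k y Δ else upperQuasiDeriv l act y (k - n)

/-- Quasi-derivatives of a vector function `y : Δ → H`. -/
def vecQuasiDeriv (l : Expression H Δ n) (y : ℝ → H) (k : ℕ) : ℝ → H :=
  quasiDeriv l (ContinuousLinearMap.id ℂ (H →L[ℂ] H)) y k

/-- Quasi-derivatives of an operator function `Y : Δ → [K, H]`; the coefficients act by
composition from the left. -/
def opQuasiDeriv {K : Type*} [NormedAddCommGroup K] [InnerProductSpace ℂ K]
    (l : Expression H Δ n) (Y : ℝ → K →L[ℂ] H) (k : ℕ) : ℝ → K →L[ℂ] H :=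
  quasiDeriv l (ContinuousLinearMap.compL ℂ K H H) Y k

/-- `f` has a continuous derivative on `Δ`. -/
def HasContDeriv (Δ : Set ℝ) (f : ℝ → E) : Prop :=
  DifferentiableOn ℝ f Δ ∧ ContinuousOn (derivWithin f Δ) Δ

/-- The set `𝒟(l)`: the functions `y` such that `y^{[k]}`, `k ≤ 2n - 2`, has a continuous
derivative on `Δ` and `y^{[2n-1]}` is absolutely continuous on (compact subintervals of) `Δ`. An
absolutely continuous function with values in a Hilbert space is differentiable almost everywhere,
so that the last field is a consequence of the one before. -/
structure InDomain (l : Expression H Δ n) (y : ℝ → H) : Prop where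
  contDeriv : ∀ k, k + 2 ≤ 2 * n → HasContDeriv Δ (vecQuasiDeriv l y k)
  absCont : ∀ t ∈ Δ, AbsolutelyContinuousOnInterval (vecQuasiDeriv l y (2 * n - 1)) 0 t
  ae_differentiable : ∀ᵐ t ∂(volume.restrict Δ),
    DifferentiableWithinAt ℝ (vecQuasiDeriv l y (2 * n - 1)) Δ t

/-- `Y` is an operator solution of `l[y] - z y = 0`: the quasi-derivatives `Y^{[k]}`,
`k ≤ 2n - 1`, have continuous derivatives on `Δ` (in the operator norm), and
`Y^{[2n]} - z Y = 0` on `Δ`. -/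
def IsOperatorSolution {K : Type*} [NormedAddCommGroup K] [InnerProductSpace ℂ K]
    (l : Expression H Δ n) (z : ℂ) (Y : ℝ → K →L[ℂ] H) : Prop :=
  (∀ k, k + 1 ≤ 2 * n → HasContDeriv Δ (opQuasiDeriv l Y k)) ∧
    ∀ t ∈ Δ, opQuasiDeriv l Y (2 * n) t - z • Y t = 0

/-! ### Linearity of the quasi-derivatives -/

theorem quasiTerm_comb (hn : 1 ≤ n) (l : Expression H Δ n)
    (act : (H →L[ℂ] H) →L[ℂ] E →L[ℂ] E) {y w : ℝ → E} {a : ℂ} {t : ℝ}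
    (h : ∀ j ≤ n, iteratedDerivWithin j (a • y + w) Δ t
      = a • iteratedDerivWithin j y Δ t + iteratedDerivWithin j w Δ t) (j : ℕ) :
    quasiTerm l act (a • y + w) j t = a • quasiTerm l act y j t + quasiTerm l act w j t := by
  unfold quasiTerm
  by_cases h0 : 0 < j
  · by_cases hj : j < n
    · simp only [if_pos h0, if_pos hj]
      rw [h (n - j) (by omega), h (n - j + 1) (by omega), h (n - j - 1) (by omega)]
      simp only [map_add, map_smul]
      module
    · simp only [if_pos h0, if_neg hj]
      rw [h (n - j) (by omega), h (n - j + 1) (by omega)]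
      simp only [map_add, map_smul]
      module
  · have hj : j < n := by omega
    simp only [if_neg h0, if_pos hj]
    rw [h (n - j) (by omega), h (n - j - 1) (by omega)]
    simp only [map_add, map_smul]
    module

theorem derivWithin_comb {f g h : ℝ → E} {a : ℂ} {t : ℝ} (ht : t ∈ Δ)
    (hf : ∀ s ∈ Δ, f s = a • g s + h s) (hg : DifferentiableWithinAt ℝ g Δ t)
    (hh : DifferentiableWithinAt ℝ h Δ t) :
    derivWithin f Δ t = a • derivWithin g Δ t + derivWithin h Δ t := by
  have h1 : derivWithin f Δ t = derivWithin (fun s => a • g s + h s) Δ t :=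
    derivWithin_congr hf (hf t ht)
  rw [h1, derivWithin_fun_add (hg.fun_const_smul a) hh, derivWithin_fun_const_smul a hg]

theorem HasContDeriv.comb {f g h : ℝ → E} {a : ℂ} (hf : ∀ s ∈ Δ, f s = a • g s + h s)
    (hg : HasContDeriv Δ g) (hh : HasContDeriv Δ h) : HasContDeriv Δ f := by
  refine ⟨fun t ht => ?_, ?_⟩
  · exact (((hg.1 t ht).fun_const_smul a).fun_add (hh.1 t ht)).congr hf (hf t ht)
  · refine ((hg.2.const_smul a).add hh.2).congr fun t ht => ?_
    exact derivWithin_comb ht hf (hg.1 t ht) (hh.1 t ht)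

theorem InDomain.iteratedDerivWithin_comb {l : Expression H Δ n} {y w : ℝ → H}
    (hy : InDomain l y) (hw : InDomain l w) (a : ℂ) (j : ℕ) (hj : j ≤ n) :
    ∀ t ∈ Δ, iteratedDerivWithin j (a • y + w) Δ t
      = a • iteratedDerivWithin j y Δ t + iteratedDerivWithin j w Δ t := by
  induction j with
  | zero => intro t _; simp
  | succ j ih =>
    intro t ht
    simp only [iteratedDerivWithin_succ]
    have hy' := hy.contDeriv j (by omega)
    have hw' := hw.contDeriv j (by omega)
    simp only [vecQuasiDeriv, quasiDeriv, if_pos (show j < n by omega)] at hy' hw'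
    exact derivWithin_comb ht (ih (by omega)) (hy'.1 t ht) (hw'.1 t ht)

theorem InDomain.vecQuasiDeriv_comb (hn : 1 ≤ n) {l : Expression H Δ n} {y w : ℝ → H}
    (hy : InDomain l y) (hw : InDomain l w) (a : ℂ) (k : ℕ) (hk : k + 1 ≤ 2 * n) :
    ∀ t ∈ Δ, vecQuasiDeriv l (a • y + w) k t
      = a • vecQuasiDeriv l y k t + vecQuasiDeriv l w k t := by
  have hD := hy.iteratedDerivWithin_comb hw a
  by_cases hkn : k < n
  · simp only [vecQuasiDeriv, quasiDeriv, if_pos hkn]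
    exact hD k hkn.le
  · obtain ⟨j, rfl⟩ := Nat.exists_eq_add_of_le (not_lt.mp hkn)
    clear hkn
    simp only [vecQuasiDeriv, quasiDeriv, if_neg (show ¬ (n + j < n) by omega),
      Nat.add_sub_cancel_left]
    induction j with
    | zero =>
      intro t ht
      exact quasiTerm_comb hn l _ (fun i hi => hD i hi t ht) 0
    | succ j ih =>
      intro t ht
      have hy' := hy.contDeriv (n + j) (by omega)
      have hw' := hw.contDeriv (n + j) (by omega)
      simp only [vecQuasiDeriv, quasiDeriv, if_neg (show ¬ (n + j < n) by omega),
        Nat.add_sub_cancel_left] at hy' hw'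
      simp only [upperQuasiDeriv]
      rw [quasiTerm_comb hn l _ (fun i hi => hD i hi t ht) (j + 1),
        derivWithin_comb ht (ih (by omega)) (hy'.1 t ht) (hw'.1 t ht)]
      module

theorem InDomain.vecQuasiDeriv_top_comb (hn : 1 ≤ n) {l : Expression H Δ n} {y w : ℝ → H}
    (hΔ : MeasurableSet Δ) (hy : InDomain l y) (hw : InDomain l w) (a : ℂ) :
    ∀ᵐ t ∂(volume.restrict Δ), vecQuasiDeriv l (a • y + w) (2 * n) t
      = a • vecQuasiDeriv l y (2 * n) t + vecQuasiDeriv l w (2 * n) t := by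
  filter_upwards [hy.ae_differentiable, hw.ae_differentiable, ae_restrict_mem hΔ]
    with t hyt hwt ht
  have hD := hy.iteratedDerivWithin_comb hw a
  have hc := hy.vecQuasiDeriv_comb hn hw a (2 * n - 1) (by omega)
  obtain ⟨m, rfl⟩ : ∃ m, n = m + 1 := ⟨n - 1, by omega⟩
  have e1 : 2 * (m + 1) - 1 - (m + 1) = m := by omega
  have e2 : 2 * (m + 1) - (m + 1) = m + 1 := by omega
  simp only [vecQuasiDeriv, quasiDeriv, if_neg (show ¬ (2 * (m + 1) - 1 < m + 1) by omega), e1]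
    at hc hyt hwt
  simp only [vecQuasiDeriv, quasiDeriv, if_neg (show ¬ (2 * (m + 1) < m + 1) by omega), e2,
    upperQuasiDeriv]
  rw [quasiTerm_comb hn l _ (fun i hi => hD i hi t ht) (m + 1), derivWithin_comb ht hc hyt hwt]
  module

theorem InDomain.comb (hn : 1 ≤ n) {l : Expression H Δ n} {y w : ℝ → H}
    (hΔ : Set.OrdConnected Δ) (h0 : 0 ∈ Δ) (hy : InDomain l y) (hw : InDomain l w) (a : ℂ) :
    InDomain l (a • y + w) := by
  have hc := hy.vecQuasiDeriv_comb hn hw a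
  refine ⟨fun k hk => ?_, fun t ht => ?_, ?_⟩
  · exact HasContDeriv.comb (hc k (by omega)) (hy.contDeriv k hk) (hw.contDeriv k hk)
  · have h1 := ((hy.absCont t ht).const_smul a).add (hw.absCont t ht)
    rw [absolutelyContinuousOnInterval_iff] at h1 ⊢
    intro ε hε
    obtain ⟨δ, hδ, h⟩ := h1 ε hε
    refine ⟨δ, hδ, fun E hE hlen => ?_⟩
    refine lt_of_eq_of_lt (Finset.sum_congr rfl fun i hi => ?_) (h E hE hlen)
    have hsub : Set.uIcc 0 t ⊆ Δ := hΔ.uIcc_subset h0 ht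
    have hm := hE.1 i hi
    rw [hc _ (by omega) _ (hsub hm.1), hc _ (by omega) _ (hsub hm.2)]
    rfl
  · filter_upwards [hy.ae_differentiable, hw.ae_differentiable, ae_restrict_mem hΔ.measurableSet]
      with t hyt hwt ht
    exact ((hyt.fun_const_smul a).fun_add hwt).congr (hc _ (by omega)) (hc _ (by omega) t ht)

theorem vecQuasiDeriv_zero (l : Expression H Δ n) (k : ℕ) :
    vecQuasiDeriv l (0 : ℝ → H) k = 0 := by
  have hD : ∀ j, iteratedDerivWithin j (0 : ℝ → H) Δ = 0 := by
    intro j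
    induction j with
    | zero => simp
    | succ j ih =>
      funext t
      rw [iteratedDerivWithin_succ, ih]
      simp
  have hT : ∀ j, quasiTerm l (ContinuousLinearMap.id ℂ (H →L[ℂ] H)) (0 : ℝ → H) j = 0 := by
    intro j
    funext t
    simp [quasiTerm]
  have hU : ∀ j, upperQuasiDeriv l (ContinuousLinearMap.id ℂ (H →L[ℂ] H)) (0 : ℝ → H) j = 0 := by
    intro j
    induction j with
    | zero => exact hT 0
    | succ j ih =>
      funext t
      simp [upperQuasiDeriv, hT, ih]
  unfold vecQuasiDeriv quasiDeriv
  split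
  · exact hD k
  · exact hU _

theorem InDomain.zero (l : Expression H Δ n) : InDomain l (0 : ℝ → H) := by
  refine ⟨fun k _ => ?_, fun t _ => ?_, ?_⟩
  · rw [vecQuasiDeriv_zero]
    refine ⟨differentiableOn_const (0 : H), ?_⟩
    have : derivWithin (0 : ℝ → H) Δ = 0 := by funext t; simp
    rw [this]
    exact continuousOn_const
  · rw [vecQuasiDeriv_zero, absolutelyContinuousOnInterval_iff]
    intro ε hε
    exact ⟨1, one_pos, fun E _ _ => by simpa using hε⟩
  · rw [vecQuasiDeriv_zero]
    exact ae_of_all _ fun t => differentiableWithinAt_const (0 : H)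

end QuasiDerivatives

theorem IsHalfInterval.zero_mem {Δ : Set ℝ} (h : IsHalfInterval Δ) : (0 : ℝ) ∈ Δ := by
  rcases h with rfl | ⟨b, hb, rfl | rfl⟩
  · simp
  · simp [hb]
  · simp [hb.le]

theorem IsHalfInterval.ordConnected {Δ : Set ℝ} (h : IsHalfInterval Δ) : Δ.OrdConnected := by
  rcases h with rfl | ⟨b, hb, rfl | rfl⟩ <;> infer_instance

section Operators

variable {H : Type u} [NormedAddCommGroup H] [InnerProductSpace ℂ H] [CompleteSpace H]
  {Δ : Set ℝ} {n : ℕ}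

/-- The Hilbert space `L₂(Δ; H)`. -/
abbrev L2 (H : Type u) [NormedAddCommGroup H] [InnerProductSpace ℂ H] (Δ : Set ℝ) : Type u :=
  Lp H 2 (volume.restrict Δ)

/-- The set `𝒟` of all `y ∈ 𝒟(l) ∩ L₂(Δ; H)` with `l[y] = y^{[2n]} ∈ L₂(Δ; H)`. -/
structure InMaximalDomain (l : Expression H Δ n) (y : ℝ → H) : Prop where
  inDomain : InDomain l y
  memLp : MemLp y 2 (volume.restrict Δ)
  memLp_top : MemLp (vecQuasiDeriv l y (2 * n)) 2 (volume.restrict Δ)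

/-- The form `[y, z](t) = (y^{(1)}(t), z^{(2)}(t)) - (y^{(2)}(t), z^{(1)}(t))`, where
`y^{(1)} = (y^{[0]}, …, y^{[n-1]})` and `y^{(2)} = (y^{[2n-1]}, …, y^{[n]})`. (Mathlib's inner
product is linear in the second argument.) -/
def lagrangeForm (l : Expression H Δ n) (y z : ℝ → H) (t : ℝ) : ℂ :=
  ∑ k ∈ Finset.range n,
    (⟪vecQuasiDeriv l z (2 * n - 1 - k) t, vecQuasiDeriv l y k t⟫_ℂ
      - ⟪vecQuasiDeriv l z k t, vecQuasiDeriv l y (2 * n - 1 - k) t⟫_ℂ)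

/-- The filter on `ℝ` of convergence in `Δ` to the right end `b` of `Δ`. -/
def rightEnd (Δ : Set ℝ) : Filter ℝ := Filter.map (Subtype.val : Δ → ℝ) atTop

/-- The boundary conditions of the minimal operator: `y^{[k]}(0) = 0` for `k < 2n`, and
`[y, z](b) = 0` for all `z ∈ 𝒟`. -/
structure MinimalConditions (l : Expression H Δ n) (y : ℝ → H) : Prop where
  left : ∀ k < 2 * n, vecQuasiDeriv l y k 0 = 0
  right : ∀ z : ℝ → H, InMaximalDomain l z →
    Tendsto (lagrangeForm l y z) (rightEnd Δ) (𝓝 0)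

theorem lagrangeForm_comb (hn : 1 ≤ n) {l : Expression H Δ n} {y w : ℝ → H}
    (hy : InDomain l y) (hw : InDomain l w) (a : ℂ) (z : ℝ → H) :
    ∀ t ∈ Δ, lagrangeForm l (a • y + w) z t = a * lagrangeForm l y z t + lagrangeForm l w z t := by
  intro t ht
  unfold lagrangeForm
  rw [Finset.mul_sum, ← Finset.sum_add_distrib]
  refine Finset.sum_congr rfl fun k hk => ?_
  have hk' := Finset.mem_range.mp hk
  rw [hy.vecQuasiDeriv_comb hn hw a k (by omega) t ht,
    hy.vecQuasiDeriv_comb hn hw a (2 * n - 1 - k) (by omega) t ht]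
  simp only [inner_add_right, inner_smul_right]
  ring

theorem MinimalConditions.comb (hΔ : IsHalfInterval Δ) (hn : 1 ≤ n) {l : Expression H Δ n}
    {y w : ℝ → H} (hy : InDomain l y) (hw : InDomain l w) (hy' : MinimalConditions l y)
    (hw' : MinimalConditions l w) (a : ℂ) : MinimalConditions l (a • y + w) := by
  refine ⟨fun k hk => ?_, fun z hz => ?_⟩
  · rw [hy.vecQuasiDeriv_comb hn hw a k (by omega) 0 hΔ.zero_mem, hy'.left k hk, hw'.left k hk]
    simp
  · have h1 := ((hy'.right z hz).const_mul a).add (hw'.right z hz)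
    simp only [mul_zero, add_zero] at h1
    refine h1.congr' ?_
    have h2 : ∀ᶠ t in rightEnd Δ, t ∈ Δ :=
      Filter.eventually_map.mpr (Filter.Eventually.of_forall fun t : Δ => t.2)
    filter_upwards [h2] with t ht
    exact (lagrangeForm_comb hn hy hw a z t ht).symm

theorem MinimalConditions.zero (l : Expression H Δ n) : MinimalConditions l (0 : ℝ → H) := by
  refine ⟨fun k _ => by simp [vecQuasiDeriv_zero], fun z _ => ?_⟩
  have : lagrangeForm l (0 : ℝ → H) z = fun _ => 0 := by
    funext t
    simp [lagrangeForm, vecQuasiDeriv_zero]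
  rw [this]
  exact tendsto_const_nhds

/-- `x = (y, l[y])` as elements of `L₂(Δ; H)`, with `y ∈ 𝒟(l)`. The pairs `x` for which there is
such a `y` form the graph of the maximal operator `L y = l[y]` with domain `𝒟`. -/
def Represents (l : Expression H Δ n) (x : L2 H Δ × L2 H Δ) (y : ℝ → H) : Prop :=
  InDomain l y ∧ x.1 =ᵐ[volume.restrict Δ] y ∧
    x.2 =ᵐ[volume.restrict Δ] vecQuasiDeriv l y (2 * n)

theorem Represents.comb (hΔ : IsHalfInterval Δ) (hn : 1 ≤ n) {l : Expression H Δ n}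
    {x x' : L2 H Δ × L2 H Δ} {y w : ℝ → H} (hy : Represents l x y) (hw : Represents l x' w)
    (a : ℂ) : Represents l (a • x + x') (a • y + w) := by
  refine ⟨hy.1.comb hn hΔ.ordConnected hΔ.zero_mem hw.1 a, ?_, ?_⟩
  · filter_upwards [Lp.coeFn_add (a • x.1) x'.1, Lp.coeFn_smul a x.1, hy.2.1, hw.2.1]
      with t h1 h2 h3 h4
    simp only [Prod.fst_add, Prod.smul_fst, h1, Pi.add_apply, h2, Pi.smul_apply, h3, h4]
  · filter_upwards [Lp.coeFn_add (a • x.2) x'.2, Lp.coeFn_smul a x.2, hy.2.2, hw.2.2,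
      hy.1.vecQuasiDeriv_top_comb hn hΔ.ordConnected.measurableSet hw.1 a] with t h1 h2 h3 h4 h5
    simp only [Prod.snd_add, Prod.smul_snd, h1, Pi.add_apply, h2, Pi.smul_apply, h3, h4, h5]

theorem Represents.zero (l : Expression H Δ n) : Represents l (0 : L2 H Δ × L2 H Δ) 0 := by
  refine ⟨InDomain.zero l, Lp.coeFn_zero _ _ _, ?_⟩
  rw [vecQuasiDeriv_zero]
  exact Lp.coeFn_zero _ _ _

/-- The graph of the minimal operator `L₀`, the restriction of the maximal operator to the
`y ∈ 𝒟` with `y^{[k]}(0) = 0` for `k < 2n` and `[y, z](b) = 0` for all `z ∈ 𝒟`. -/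
def minimalGraph (hΔ : IsHalfInterval Δ) (hn : 1 ≤ n) (l : Expression H Δ n) :
    Submodule ℂ (L2 H Δ × L2 H Δ) where
  carrier := {x | ∃ y : ℝ → H, Represents l x y ∧ MinimalConditions l y}
  zero_mem' := ⟨0, Represents.zero l, MinimalConditions.zero l⟩
  add_mem' := by
    rintro x x' ⟨y, hy, hy'⟩ ⟨w, hw, hw'⟩
    refine ⟨(1 : ℂ) • y + w, ?_, hy'.comb hΔ hn hy.1 hw.1 hw' 1⟩
    simpa only [one_smul] using hy.comb hΔ hn hw 1
  smul_mem' := by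
    rintro a x ⟨y, hy, hy'⟩
    refine ⟨a • y + 0, ?_,
      hy'.comb hΔ hn hy.1 (InDomain.zero l) (MinimalConditions.zero l) a⟩
    simpa only [add_zero] using hy.comb hΔ hn (Represents.zero l) a

end Operators

section Relations

variable {F : Type*} [NormedAddCommGroup F] [InnerProductSpace ℂ F]

/-- `A` is a proper extension of the operator with graph `T`: a closed operator with
`T ⊆ A ⊆ T^*`. -/
structure IsProperExtension (T : Submodule ℂ (F × F)) (A : F →ₗ.[ℂ] F) : Prop where
  isClosed : A.IsClosed
  le_graph : T ≤ A.graph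
  graph_le : A.graph ≤ T.adjoint

/-- The resolvent set `ρ(A)` of a closed operator: the `z ∈ ℂ` such that
`Ker (A - z) = {0}` and `A - z` is onto. -/
def opResolventSet (A : F →ₗ.[ℂ] F) : Set ℂ :=
  {z | Function.Bijective fun y : A.domain => A y - z • (y : F)}

/-- `𝔑_z(T) = Ker (T^* - z)`. -/
def defectSpace (T : Submodule ℂ (F × F)) (z : ℂ) : Set F :=
  {y | (y, z • y) ∈ T.adjoint}

end Relations

/-- `Z : Δ → [K, H]` is a fundamental solution of `l[y] - z y = 0`: it is an operator solution,
`Z(·) h ∈ L₂(Δ; H)` for all `h ∈ K`, and for every `y ∈ 𝔑_z(L₀)` there is a unique `h ∈ K`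
with `y = Z(·) h`. -/
structure IsFundamentalSolution {H : Type u} [NormedAddCommGroup H] [InnerProductSpace ℂ H]
    [CompleteSpace H] {Δ : Set ℝ} {n : ℕ} (hΔ : IsHalfInterval Δ) (hn : 1 ≤ n)
    (l : Expression H Δ n) {K : Type*} [NormedAddCommGroup K] [InnerProductSpace ℂ K] (z : ℂ)
    (Z : ℝ → K →L[ℂ] H) : Prop where
  isOperatorSolution : IsOperatorSolution l z Z
  memLp : ∀ h : K, MemLp (fun t => Z t h) 2 (volume.restrict Δ)
  existsUnique : ∀ y ∈ defectSpace (minimalGraph hΔ hn l) z,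
    ∃! h : K, y =ᵐ[volume.restrict Δ] fun t => Z t h

end DiffOp

end

/-! Fix `w` in the resolvent set and let `K = Ker (L₀^* - w)`. With `R z = (A - z)⁻¹`, the operator
`X(z) = 1 + (z - w) R z` maps `Ker (L₀^* - w)` bijectively onto `Ker (L₀^* - z)`, because the graph
of `A` lies in `L₀^*`, and it is holomorphic in `z`. The candidate is `Z(t, z) h = (X(z) h)(t)`. Two
facts about the differential expression make sense of this evaluation and show that it is bounded
and holomorphic.

The first is regularity: every `y` in `Ker (L₀^* - z)` is a classical solution of `l[y] = z y`. On
`[0, c]` the solutions form a closed subspace of `L₂`. If a continuous `f` is orthogonal to them,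
the solution of `l[d] = z̄ d + f` with zero data at `c` has, by the Lagrange identity, zero data at
`0` as well. Its extension by zero therefore lies in the domain of `L₀` (`exists_mem_minimalGraph`),
and the definition of the adjoint makes `f` orthogonal to `y`. Density of continuous functions then
puts the restriction of `y` into the solution space (`FundamentalSystem.localRestrict_mem_range`).
The Cauchy data at `0` depend boundedly on `y` (`FundamentalSystem.exists_initialValues`), so `Z(·,
z)` is the Cauchy solution operator composed with bounded operators and has norm-continuous
derivatives of its quasi-derivatives.

The second is an a priori estimate (`exists_quasiSystem_bound`): on `[0, c]` all quasi-derivatives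
of order below `2n` are bounded uniformly by the `L₁`-norms of `y` and `l[y]`. The values of
`y^{[k]}` at `t` are thus bounded linear functions of the pair `(y, l[y])` (`exists_evaluation`). On
the range of `X(z)` this pair is `(X(z) h, z X(z) h)`, which is holomorphic in `z`, so `Z^{[k]}(t,
·)` is a fixed bounded operator applied to a holomorphic function. The same estimate gives the
closedness of the solution space used in the first fact.

The estimate comes from interpolation. With `N` a common bound for the quasi-derivatives and `X` the
`L₁` data, each quasi-derivative is shown to be at most `η N + C X` with `η` arbitrarily small. One
climbs from `∫ y` to `y` and on to `y^{[2n-1]}`, one derivative at a time (`Controlled.deriv`); then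
`η = 1/2` is absorbed on the left. -/

noncomputable section

namespace DiffOp

/-! ### The quasi-differential expression as a first order system -/

section System

variable {H : Type u} [NormedAddCommGroup H] [InnerProductSpace ℂ H] [CompleteSpace H]
  {Δ : Set ℝ} {n : ℕ} {E : Type*} [NormedAddCommGroup E] [NormedSpace ℂ E]
  {E' : Type*} [NormedAddCommGroup E'] [NormedSpace ℂ E']

/-- The expression `quasiTerm` for an arbitrary sequence `D` in place of the sequence of
derivatives of a function. -/
def coeffTerm (l : Expression H Δ n) (act : (H →L[ℂ] H) →L[ℂ] E →L[ℂ] E) (D : ℕ → ℝ → E) (j : ℕ)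
    (t : ℝ) : E :=
  act (l.p j t) (D (n - j) t)
    + (if 0 < j then
        (Complex.I / 2) • act (ContinuousLinearMap.adjoint (l.q (j - 1) t)) (D (n - j + 1) t)
      else 0)
    - (if j < n then (Complex.I / 2) • act (l.q j t) (D (n - j - 1) t) else 0)

/-- The first order form of the differential expression on `S`: `D 0, …, D n` are the ordinary
derivatives and `U 0, …, U n` the quasi-derivatives of orders `n, …, 2n` of `D 0`. -/
structure QuasiSystem (l : Expression H Δ n) (act : (H →L[ℂ] H) →L[ℂ] E →L[ℂ] E) (S : Set ℝ)
    (D U : ℕ → ℝ → E) : Prop where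
  deriv_lower : ∀ m < n, ∀ t ∈ S, HasDerivWithinAt (D m) (D (m + 1) t) S t
  upper_zero : ∀ t ∈ S, U 0 t = coeffTerm l act D 0 t
  deriv_upper : ∀ j < n, ∀ t ∈ S,
    HasDerivWithinAt (U j) (coeffTerm l act D (j + 1) t - U (j + 1) t) S t
  continuousOn_lower : ContinuousOn (D n) S
  continuousOn_upper : ContinuousOn (U n) S

variable {l : Expression H Δ n} {act : (H →L[ℂ] H) →L[ℂ] E →L[ℂ] E}
  {act' : (H →L[ℂ] H) →L[ℂ] E' →L[ℂ] E'} {S : Set ℝ} {D U D' U' : ℕ → ℝ → E}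

/-- The coefficients act from the left, so every right operation commutes with them. It serves to
evaluate operator solutions at a vector and to compose them with a fixed operator. -/
theorem coeffTerm_map {Φ : E →L[ℂ] E'} (hΦ : ∀ a x, act' a (Φ x) = Φ (act a x)) (D : ℕ → ℝ → E)
    (j : ℕ) (t : ℝ) :
    coeffTerm l act' (fun m s => Φ (D m s)) j t = Φ (coeffTerm l act D j t) := by
  unfold coeffTerm
  split_ifs <;> simp [hΦ]

theorem coeffTerm_comb (a : ℂ) (D D' : ℕ → ℝ → E) (j : ℕ) (t : ℝ) :
    coeffTerm l act (fun m s => a • D m s + D' m s) j t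
      = a • coeffTerm l act D j t + coeffTerm l act D' j t := by
  unfold coeffTerm
  split_ifs <;> simp only [map_add, map_smul] <;> module

/-- No bound on `j` is needed: for `j > n` truncated subtraction leaves only the indices `0` and
`1`, which is where `1 ≤ n` enters. -/
theorem coeffTerm_congr {D D' : ℕ → ℝ → E} {j : ℕ} {s t : ℝ} (hn : 1 ≤ n) (hst : s = t)
    (h : ∀ m ≤ n, D m s = D' m t) : coeffTerm l act D j s = coeffTerm l act D' j t := by
  subst hst
  unfold coeffTerm
  rw [h (n - j) (by omega), h (n - j - 1) (by omega)]
  split_ifs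
  all_goals first | rw [h (n - j + 1) (by omega)] | rfl

theorem continuousOn_coeffTerm {T : Set ℝ} (hT : T ⊆ Δ) {D : ℕ → ℝ → E}
    (hD : ∀ m ≤ n, ContinuousOn (D m) T) {j : ℕ} (hj : j ≤ n) :
    ContinuousOn (coeffTerm l act D j) T := by
  have hp : ContinuousOn (l.p j) T := (l.continuousOn_p j hj).mono hT
  unfold coeffTerm
  refine ContinuousOn.sub (ContinuousOn.add ?_ ?_) ?_
  · exact (act.continuous.comp_continuousOn hp).clm_apply (hD _ (by omega))
  · split_ifs with h
    · have hq : ContinuousOn (l.q (j - 1)) T := (l.continuousOn_q _ (by omega)).mono hT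
      have hq' : ContinuousOn (fun t => ContinuousLinearMap.adjoint (l.q (j - 1) t)) T :=
        (ContinuousLinearMap.adjoint (𝕜 := ℂ) (E := H) (F := H)).continuous.comp_continuousOn hq
      exact ((act.continuous.comp_continuousOn hq').clm_apply (hD _ (by omega))).const_smul _
    · exact continuousOn_const
  · split_ifs with h
    · have hq : ContinuousOn (l.q j) T := (l.continuousOn_q _ (by omega)).mono hT
      exact ((act.continuous.comp_continuousOn hq).clm_apply (hD _ (by omega))).const_smul _
    · exact continuousOn_const

namespace QuasiSystem

theorem continuousOn_D (h : QuasiSystem l act S D U) {m : ℕ} (hm : m ≤ n) :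
    ContinuousOn (D m) S := by
  rcases hm.lt_or_eq with h1 | rfl
  · exact fun t ht => (h.deriv_lower m h1 t ht).continuousWithinAt
  · exact h.continuousOn_lower

theorem continuousOn_U (h : QuasiSystem l act S D U) {m : ℕ} (hm : m ≤ n) :
    ContinuousOn (U m) S := by
  rcases hm.lt_or_eq with h1 | rfl
  · exact fun t ht => (h.deriv_upper m h1 t ht).continuousWithinAt
  · exact h.continuousOn_upper

theorem mono {T : Set ℝ} (h : QuasiSystem l act S D U) (hT : T ⊆ S) : QuasiSystem l act T D U :=
  ⟨fun m hm t ht => (h.deriv_lower m hm t (hT ht)).mono hT, fun t ht => h.upper_zero t (hT ht),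
    fun j hj t ht => (h.deriv_upper j hj t (hT ht)).mono hT, h.continuousOn_lower.mono hT,
    h.continuousOn_upper.mono hT⟩

theorem map (h : QuasiSystem l act S D U) {Φ : E →L[ℂ] E'}
    (hΦ : ∀ a x, act' a (Φ x) = Φ (act a x)) :
    QuasiSystem l act' S (fun m s => Φ (D m s)) (fun m s => Φ (U m s)) where
  deriv_lower m hm t ht :=
    (Φ.restrictScalars ℝ).hasFDerivAt.comp_hasDerivWithinAt t (h.deriv_lower m hm t ht)
  upper_zero t ht := by rw [coeffTerm_map hΦ, h.upper_zero t ht]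
  deriv_upper j hj t ht := by
    rw [coeffTerm_map hΦ, ← map_sub]
    exact (Φ.restrictScalars ℝ).hasFDerivAt.comp_hasDerivWithinAt t (h.deriv_upper j hj t ht)
  continuousOn_lower := Φ.continuous.comp_continuousOn h.continuousOn_lower
  continuousOn_upper := Φ.continuous.comp_continuousOn h.continuousOn_upper

theorem comb (h : QuasiSystem l act S D U) (h' : QuasiSystem l act S D' U') (a : ℂ) :
    QuasiSystem l act S (fun m s => a • D m s + D' m s) (fun m s => a • U m s + U' m s) where
  deriv_lower m hm t ht :=
    ((h.deriv_lower m hm t ht).const_smul a).add (h'.deriv_lower m hm t ht)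
  upper_zero t ht := by rw [coeffTerm_comb, h.upper_zero t ht, h'.upper_zero t ht]
  deriv_upper j hj t ht := by
    rw [coeffTerm_comb]
    refine (((h.deriv_upper j hj t ht).const_smul a).add
      (h'.deriv_upper j hj t ht)).congr_deriv ?_
    module
  continuousOn_lower := (h.continuousOn_lower.const_smul a).add h'.continuousOn_lower
  continuousOn_upper := (h.continuousOn_upper.const_smul a).add h'.continuousOn_upper

theorem zero : QuasiSystem l act S 0 0 where
  deriv_lower m hm t ht := hasDerivWithinAt_const t S (0 : E)
  upper_zero t ht := by simp [coeffTerm]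
  deriv_upper j hj t ht := by
    have : coeffTerm l act 0 (j + 1) t - (0 : ℕ → ℝ → E) (j + 1) t = 0 := by simp [coeffTerm]
    rw [this]
    exact hasDerivWithinAt_const t S (0 : E)
  continuousOn_lower := continuousOn_const
  continuousOn_upper := continuousOn_const

end QuasiSystem

theorem iteratedDerivWithin_eq_of_hasDerivWithinAt (hΔ : UniqueDiffOn ℝ Δ) {N : ℕ}
    (hD : ∀ m < N, ∀ t ∈ Δ, HasDerivWithinAt (D m) (D (m + 1) t) Δ t) {m : ℕ} (hm : m ≤ N) :
    ∀ t ∈ Δ, iteratedDerivWithin m (D 0) Δ t = D m t := by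
  induction m with
  | zero => intro t _; simp
  | succ m ih =>
    intro t ht
    rw [iteratedDerivWithin_succ, derivWithin_congr (ih (by omega)) (ih (by omega) t ht)]
    exact (hD m (by omega) t ht).derivWithin (hΔ t ht)

/-- Functions that satisfy the first order relations below the order `2n` are the
quasi-derivatives of the first one of them. -/
theorem upperQuasiDeriv_eq (hn : 1 ≤ n) (hΔ : UniqueDiffOn ℝ Δ)
    (hD : ∀ m < n, ∀ t ∈ Δ, HasDerivWithinAt (D m) (D (m + 1) t) Δ t)
    (h0 : ∀ t ∈ Δ, U 0 t = coeffTerm l act D 0 t) {j : ℕ}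
    (hU : ∀ i < j, ∀ t ∈ Δ,
      HasDerivWithinAt (U i) (coeffTerm l act D (i + 1) t - U (i + 1) t) Δ t) :
    ∀ t ∈ Δ, upperQuasiDeriv l act (D 0) j t = U j t := by
  have hq : ∀ i, ∀ t ∈ Δ, quasiTerm l act (D 0) i t = coeffTerm l act D i t := fun i t ht =>
    coeffTerm_congr (D := fun m => iteratedDerivWithin m (D 0) Δ) hn rfl
      fun m hm => iteratedDerivWithin_eq_of_hasDerivWithinAt hΔ hD hm t ht
  induction j with
  | zero =>
    intro t ht
    rw [h0 t ht]
    exact hq 0 t ht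
  | succ j ih =>
    intro t ht
    have ih' := ih fun i hi => hU i (by omega)
    simp only [upperQuasiDeriv]
    rw [hq _ t ht, derivWithin_congr ih' (ih' t ht),
      (hU j (by omega) t ht).derivWithin (hΔ t ht), sub_sub_cancel]

theorem quasiDeriv_lower (hΔ : UniqueDiffOn ℝ Δ)
    (hD : ∀ m < n, ∀ t ∈ Δ, HasDerivWithinAt (D m) (D (m + 1) t) Δ t) {k : ℕ} (hk : k < n) :
    ∀ t ∈ Δ, quasiDeriv l act (D 0) k t = D k t := by
  intro t ht
  rw [quasiDeriv, if_pos hk, iteratedDerivWithin_eq_of_hasDerivWithinAt hΔ hD hk.le t ht]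

theorem quasiDeriv_upper (y : ℝ → E) (j : ℕ) :
    quasiDeriv l act y (n + j) = upperQuasiDeriv l act y j := by
  rw [quasiDeriv, if_neg (by omega), Nat.add_sub_cancel_left]

theorem HasContDeriv.of_hasDerivWithinAt {f g g' : ℝ → E} (hΔ : UniqueDiffOn ℝ Δ)
    (hf : ∀ t ∈ Δ, f t = g t) (hg : ∀ t ∈ Δ, HasDerivWithinAt g (g' t) Δ t)
    (hg' : ContinuousOn g' Δ) : HasContDeriv Δ f := by
  have h : ∀ t ∈ Δ, HasDerivWithinAt f (g' t) Δ t := fun t ht => (hg t ht).congr hf (hf t ht)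
  exact ⟨fun t ht => (h t ht).differentiableWithinAt,
    hg'.congr fun t ht => (h t ht).derivWithin (hΔ t ht)⟩

/-- All quasi-derivatives of order below `2n` of the solution of a first order system are
continuously differentiable. -/
theorem QuasiSystem.hasContDeriv (h : QuasiSystem l act Δ D U) (hn : 1 ≤ n)
    (hΔ : UniqueDiffOn ℝ Δ) {k : ℕ} (hk : k + 1 ≤ 2 * n) :
    HasContDeriv Δ (quasiDeriv l act (D 0) k) := by
  rcases lt_or_ge k n with hkn | hkn
  · exact .of_hasDerivWithinAt hΔ (quasiDeriv_lower hΔ h.deriv_lower hkn) (h.deriv_lower k hkn)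
      (h.continuousOn_D hkn)
  · obtain ⟨j, rfl⟩ := Nat.exists_eq_add_of_le hkn
    rw [quasiDeriv_upper]
    exact .of_hasDerivWithinAt hΔ
      (upperQuasiDeriv_eq hn hΔ h.deriv_lower h.upper_zero
        fun i hi => h.deriv_upper i (by omega)) (h.deriv_upper j (by omega))
      ((continuousOn_coeffTerm subset_rfl (fun m hm => h.continuousOn_D hm) (by omega)).sub
        (h.continuousOn_U (by omega)))

theorem IsHalfInterval.uniqueDiffOn {Δ : Set ℝ} (h : IsHalfInterval Δ) : UniqueDiffOn ℝ Δ := by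
  rcases h with rfl | ⟨b, hb, rfl | rfl⟩
  · exact uniqueDiffOn_Ici 0
  · exact uniqueDiffOn_Ico 0 b
  · exact uniqueDiffOn_Icc hb

end System

/-! ### Linear differential equations in a Banach space: Picard series -/

section LinearODE

variable {X : Type*} [NormedAddCommGroup X] [NormedSpace ℂ X]

/-- The successive terms of the Picard series of `u' = A u + F`, `u t₀ = x₀`. -/
def picardTerm (A : ℝ → X →L[ℂ] X) (F : ℝ → X) (t₀ : ℝ) (x₀ : X) : ℕ → ℝ → X
  | 0 => fun t => x₀ + ∫ s in t₀..t, F s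
  | k + 1 => fun t => ∫ s in t₀..t, A s (picardTerm A F t₀ x₀ k s)

variable {A : ℝ → X →L[ℂ] X} {F : ℝ → X} {t₀ : ℝ} {x₀ : X} {J : Set ℝ}

theorem hasDerivAt_integral_of_continuousOn [CompleteSpace X] (hJ : IsOpen J) (hJ' : J.OrdConnected) (ht₀ : t₀ ∈ J)
    (hF : ContinuousOn F J) {t : ℝ} (ht : t ∈ J) :
    HasDerivAt (fun r => ∫ s in t₀..r, F s) (F t) t :=
  intervalIntegral.integral_hasDerivAt_right
    ((hF.mono (hJ'.uIcc_subset ht₀ ht)).intervalIntegrable)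
    (hF.stronglyMeasurableAtFilter hJ t ht) (hF.continuousAt (hJ.mem_nhds ht))

theorem continuousOn_picardTerm [CompleteSpace X] (hJ : IsOpen J) (hJ' : J.OrdConnected) (ht₀ : t₀ ∈ J)
    (hA : ContinuousOn A J) (hF : ContinuousOn F J) (k : ℕ) :
    ContinuousOn (picardTerm A F t₀ x₀ k) J := by
  induction k with
  | zero =>
    exact fun t ht => ((hasDerivAt_integral_of_continuousOn hJ hJ' ht₀ hF ht).const_add
      x₀).continuousAt.continuousWithinAt
  | succ k ih =>
    exact fun t ht => (hasDerivAt_integral_of_continuousOn hJ hJ' ht₀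
      (hA.clm_apply ih) ht).continuousAt.continuousWithinAt

/-- Each integration turns `|s - t₀| ^ k / k!` into the next term of the exponential series. This
gives convergence on every compact interval, with no smallness of its length. -/
theorem norm_picardTerm_le {a b C M : ℝ} (ht₀ : t₀ ∈ Set.Icc a b) (hM : 0 ≤ M)
    (hAM : ∀ t ∈ Set.Icc a b, ‖A t‖ ≤ M)
    (hC : ∀ t ∈ Set.Icc a b, ‖picardTerm A F t₀ x₀ 0 t‖ ≤ C) (k : ℕ) :
    ∀ t ∈ Set.Icc a b,
      ‖picardTerm A F t₀ x₀ k t‖ ≤ C * (M ^ k * (|t - t₀| ^ k / k.factorial)) := by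
  induction k with
  | zero => intro t ht; simpa using hC t ht
  | succ k ih =>
    intro t ht
    calc ‖picardTerm A F t₀ x₀ (k + 1) t‖
        ≤ ∫ s in Set.uIoc t₀ t, ‖A s (picardTerm A F t₀ x₀ k s)‖ := by
          rw [picardTerm]
          exact intervalIntegral.norm_integral_le_integral_norm_uIoc
      _ ≤ ∫ s in Set.uIoc t₀ t, M * (C * (M ^ k * (|s - t₀| ^ k / k.factorial))) := by
          refine integral_mono_of_nonneg (ae_of_all _ fun _ => norm_nonneg _)
            (Continuous.integrableOn_uIoc (by fun_prop)) ?_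
          filter_upwards [ae_restrict_mem measurableSet_uIoc] with s hs
          have hs' : s ∈ Set.Icc a b :=
            Set.ordConnected_Icc.uIcc_subset ht₀ ht (Set.uIoc_subset_uIcc hs)
          exact (ContinuousLinearMap.le_opNorm _ _).trans
            (mul_le_mul (hAM s hs') (ih s hs') (norm_nonneg _) hM)
      _ = C * (M ^ (k + 1) * (|t - t₀| ^ (k + 1) / (k + 1).factorial)) := by
          have h : ∀ s : ℝ, M * (C * (M ^ k * (|s - t₀| ^ k / k.factorial)))
              = (C * M ^ (k + 1) / k.factorial) * |s - t₀| ^ k := fun s => by ring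
          simp_rw [h]
          rw [integral_const_mul, integral_pow_abs_sub_uIoc, Nat.factorial_succ]
          push_cast
          have := Nat.factorial_ne_zero k
          field_simp

/-- Global solvability of linear equations with continuous coefficients on an open interval. -/
theorem exists_linear_ode_solution_of_isOpen [CompleteSpace X] (hJ : IsOpen J) (hJ' : J.OrdConnected)
    (hA : ContinuousOn A J) (hF : ContinuousOn F J) (ht₀ : t₀ ∈ J) (x₀ : X) :
    ∃ u : ℝ → X, u t₀ = x₀ ∧ ∀ t ∈ J, HasDerivAt u (A t (u t) + F t) t := by
  set g := picardTerm A F t₀ x₀ with hg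
  have hgc : ∀ k, ContinuousOn (g k) J := continuousOn_picardTerm hJ hJ' ht₀ hA hF
  refine ⟨fun t => ∑' k, g k t, ?_, fun t ht => ?_⟩
  · change ∑' k, g k t₀ = x₀
    rw [tsum_eq_single 0]
    · simp [hg, picardTerm]
    · intro k hk
      obtain ⟨k, rfl⟩ := Nat.exists_eq_succ_of_ne_zero hk
      simp [hg, picardTerm]
  -- Termwise differentiation needs an open interval around `t₀` and `t`, while the bounds need its
  -- closure to be compact in `J`.
  obtain ⟨a, b, hab, ht0', ht'⟩ : ∃ a b, Set.Icc a b ⊆ J ∧ t₀ ∈ Set.Ioo a b ∧ t ∈ Set.Ioo a b := by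
    have h1 : min t₀ t ∈ J := by rcases min_choice t₀ t with h | h <;> rw [h] <;> assumption
    have h2 : max t₀ t ∈ J := by rcases max_choice t₀ t with h | h <;> rw [h] <;> assumption
    obtain ⟨ε, hε, hε'⟩ := Metric.isOpen_iff.mp hJ _ h1
    obtain ⟨δ, hδ, hδ'⟩ := Metric.isOpen_iff.mp hJ _ h2
    have ha : min t₀ t - ε / 2 ∈ J := hε' (by
      rw [Metric.mem_ball, Real.dist_eq, abs_lt]; constructor <;> linarith)
    have hb : max t₀ t + δ / 2 ∈ J := hδ' (by
      rw [Metric.mem_ball, Real.dist_eq, abs_lt]; constructor <;> linarith)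
    have := min_le_left t₀ t
    have := min_le_right t₀ t
    have := le_max_left t₀ t
    have := le_max_right t₀ t
    exact ⟨_, _, hJ'.out ha hb, ⟨by linarith, by linarith⟩, ⟨by linarith, by linarith⟩⟩
  have hIoo : Set.Ioo a b ⊆ J := Set.Ioo_subset_Icc_self.trans hab
  obtain ⟨M, hM⟩ := isCompact_Icc.exists_bound_of_continuousOn (hA.mono hab)
  obtain ⟨C, hC⟩ := isCompact_Icc.exists_bound_of_continuousOn ((hgc 0).mono hab)
  obtain ⟨C', hC'⟩ := isCompact_Icc.exists_bound_of_continuousOn (hF.mono hab)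
  have ht0'' := Set.Ioo_subset_Icc_self ht0'
  have hM0 : 0 ≤ M := (norm_nonneg _).trans (hM _ ht0'')
  have hC0 : 0 ≤ C := (norm_nonneg _).trans (hC _ ht0'')
  have hbound : ∀ k, ∀ s ∈ Set.Icc a b,
      ‖g k s‖ ≤ C * ((M * (b - a)) ^ k / k.factorial) := by
    intro k s hs
    refine (norm_picardTerm_le ht0'' hM0 hM hC k s hs).trans ?_
    rw [mul_pow, mul_div_assoc]
    have : |s - t₀| ≤ b - a := by
      rw [abs_le]; constructor <;> linarith [hs.1, hs.2, ht0'.1, ht0'.2]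
    gcongr
  have hsum : Summable fun k : ℕ => C * ((M * (b - a)) ^ k / k.factorial) :=
    (Real.summable_pow_div_factorial _).mul_left C
  -- The derivatives of the terms: `F` for the first one and `A g_k` for the one of index `k + 1`.
  -- They sum to `F + A ∑ g_k`, the right-hand side of the equation.
  let g' : ℕ → ℝ → X := fun k => Nat.casesOn k F fun k s => A s (g k s)
  let w : ℕ → ℝ := fun k => Nat.casesOn k C' fun k => M * (C * ((M * (b - a)) ^ k / k.factorial))
  have hw : Summable w := (summable_nat_add_iff 1).mp (hsum.mul_left M)
  have hderiv : ∀ k, ∀ s ∈ Set.Ioo a b, HasDerivAt (g k) (g' k s) s := by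
    intro k s hs
    cases k with
    | zero => exact (hasDerivAt_integral_of_continuousOn hJ hJ' ht₀ hF (hIoo hs)).const_add x₀
    | succ k =>
      exact hasDerivAt_integral_of_continuousOn hJ hJ' ht₀ (hA.clm_apply (hgc k)) (hIoo hs)
  have hw' : ∀ k, ∀ s ∈ Set.Ioo a b, ‖g' k s‖ ≤ w k := by
    intro k s hs
    have hs' := Set.Ioo_subset_Icc_self hs
    cases k with
    | zero => exact hC' s hs'
    | succ k =>
      exact (ContinuousLinearMap.le_opNorm _ _).trans
        (mul_le_mul (hM s hs') (hbound k s hs') (norm_nonneg _) hM0)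
  have hgs : ∀ s ∈ Set.Icc a b, Summable fun k => g k s := fun s hs =>
    Summable.of_norm_bounded hsum fun k => hbound k s hs
  have hmain := hasDerivAt_tsum_of_isPreconnected hw isOpen_Ioo isPreconnected_Ioo hderiv hw'
    ht0' (hgs _ ht0'') ht'
  refine hmain.congr_deriv ?_
  have hs' : Summable fun k => g' k t := Summable.of_norm_bounded hw fun k => hw' k t ht'
  rw [hs'.tsum_eq_zero_add, (A t).map_tsum (hgs t (Set.Ioo_subset_Icc_self ht'))]
  exact add_comm _ _

/-- Composition with `ρ` extends coefficients continuously beyond the ends that belong to `Δ`, which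
reduces one-sided derivatives there to two-sided ones on an open interval. -/
theorem IsHalfInterval.exists_retraction {Δ : Set ℝ} (hΔ : IsHalfInterval Δ) :
    ∃ (J : Set ℝ) (ρ : ℝ → ℝ), IsOpen J ∧ J.OrdConnected ∧ Δ ⊆ J ∧ Continuous ρ ∧
      Set.MapsTo ρ J Δ ∧ ∀ t ∈ Δ, ρ t = t := by
  rcases hΔ with rfl | ⟨b, hb, rfl | rfl⟩
  · exact ⟨Set.univ, fun t => max 0 t, isOpen_univ, Set.ordConnected_univ, Set.subset_univ _,
      by fun_prop, fun t _ => Set.mem_Ici.mpr (le_max_left _ _), fun t ht => max_eq_right ht⟩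
  · exact ⟨Set.Iio b, fun t => max 0 t, isOpen_Iio, Set.ordConnected_Iio,
      Set.Ico_subset_Iio_self, by fun_prop, fun t ht => ⟨le_max_left _ _, max_lt hb ht⟩,
      fun t ht => max_eq_right ht.1⟩
  · exact ⟨Set.univ, fun t => max 0 (min b t), isOpen_univ, Set.ordConnected_univ,
      Set.subset_univ _, by fun_prop,
      fun t _ => ⟨le_max_left _ _, max_le hb.le (min_le_left _ _)⟩,
      fun t ht => by
        change max 0 (min b t) = t
        rw [min_eq_right ht.2, max_eq_right ht.1]⟩

theorem exists_linear_ode_solution [CompleteSpace X] {Δ : Set ℝ} (hΔ : IsHalfInterval Δ) (hA : ContinuousOn A Δ)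
    (hF : ContinuousOn F Δ) (ht₀ : t₀ ∈ Δ) (x₀ : X) :
    ∃ u : ℝ → X, u t₀ = x₀ ∧ ∀ t ∈ Δ, HasDerivWithinAt u (A t (u t) + F t) Δ t := by
  obtain ⟨J, ρ, hJ, hJ', hsub, hρ, hmaps, hid⟩ := hΔ.exists_retraction
  obtain ⟨u, hu, hu'⟩ := exists_linear_ode_solution_of_isOpen (A := A ∘ ρ) (F := F ∘ ρ) hJ hJ'
    (hA.comp hρ.continuousOn hmaps) (hF.comp hρ.continuousOn hmaps) (hsub ht₀) x₀
  refine ⟨u, hu, fun t ht => ?_⟩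
  have := (hu' t (hsub ht)).hasDerivWithinAt (s := Δ)
  simpa only [Function.comp_apply, hid t ht] using this

end LinearODE

/-! ### Solvability of the Cauchy problem for the expression -/

section Existence

variable {H : Type u} [NormedAddCommGroup H] [InnerProductSpace ℂ H] {Δ : Set ℝ} {n : ℕ}

/-- The space of the values of `(y^{[0]}, …, y^{[n-1]})` and `(y^{[n]}, …, y^{[2n-1]})`. -/
abbrev StateSpace (H : Type u) (n : ℕ) : Type u := (Fin n → H) × (Fin n → H)

/-- The component `y^{[m]}`, `m < n`, of a state. -/
def lowerProj (H : Type u) [NormedAddCommGroup H] [InnerProductSpace ℂ H] (n m : ℕ) :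
    StateSpace H n →L[ℂ] H :=
  if h : m < n then
    (ContinuousLinearMap.proj (R := ℂ) (φ := fun _ : Fin n => H) ⟨m, h⟩).comp
      (ContinuousLinearMap.fst ℂ _ _)
  else 0

/-- The component `y^{[n+j]}`, `j < n`, of a state. -/
def upperProj (H : Type u) [NormedAddCommGroup H] [InnerProductSpace ℂ H] (n j : ℕ) :
    StateSpace H n →L[ℂ] H :=
  if h : j < n then
    (ContinuousLinearMap.proj (R := ℂ) (φ := fun _ : Fin n => H) ⟨j, h⟩).comp
      (ContinuousLinearMap.snd ℂ _ _)
  else 0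

theorem lowerProj_apply {m : ℕ} (h : m < n) (x : StateSpace H n) :
    lowerProj H n m x = x.1 ⟨m, h⟩ := by
  simp [lowerProj, h]

theorem upperProj_apply {m : ℕ} (h : m < n) (x : StateSpace H n) :
    upperProj H n m x = x.2 ⟨m, h⟩ := by
  simp [upperProj, h]

theorem sum_single_comp_apply {K : Type*} [NormedAddCommGroup K] [NormedSpace ℂ K]
    (T : Fin n → K →L[ℂ] H) (x : K) (m : Fin n) :
    (∑ i, (ContinuousLinearMap.single ℂ (fun _ : Fin n => H) i).comp (T i)) x m = T m x := by
  simp [sum_apply, Pi.single_apply]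

/-- The embedding of a forcing term into the state space. -/
def forcingOp (H : Type u) [NormedAddCommGroup H] [InnerProductSpace ℂ H] (n : ℕ) :
    H →L[ℂ] StateSpace H n :=
  (ContinuousLinearMap.inr ℂ (Fin n → H) (Fin n → H)).comp
    (∑ j : Fin n, (ContinuousLinearMap.single ℂ (fun _ : Fin n => H) j).comp
      (if (j : ℕ) + 1 < n then 0 else -ContinuousLinearMap.id ℂ H))

theorem lowerProj_forcingOp {m : ℕ} (hm : m < n) :
    (lowerProj H n m).comp (forcingOp H n) = 0 := by
  refine ContinuousLinearMap.ext fun x => ?_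
  rw [ContinuousLinearMap.comp_apply, lowerProj_apply hm]
  simp only [forcingOp, ContinuousLinearMap.comp_apply, ContinuousLinearMap.inr_apply,
    Pi.zero_apply, zero_apply]

theorem upperProj_forcingOp {j : ℕ} (hj : j < n) :
    (upperProj H n j).comp (forcingOp H n)
      = if j + 1 < n then 0 else -ContinuousLinearMap.id ℂ H := by
  refine ContinuousLinearMap.ext fun x => ?_
  rw [ContinuousLinearMap.comp_apply, upperProj_apply hj]
  simp only [forcingOp, ContinuousLinearMap.comp_apply, ContinuousLinearMap.inr_apply,
    sum_single_comp_apply]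

variable [CompleteSpace H]

/-- The derivative `y^{(m)}(t)`, `m ≤ n`, as a function of the state at `t`. -/
def lowerOp (l : Expression H Δ n) (m : ℕ) (t : ℝ) : StateSpace H n →L[ℂ] H :=
  if m < n then lowerProj H n m
  else (Ring.inverse (l.p 0 t)).comp
    (upperProj H n 0 + (Complex.I / 2) • (l.q 0 t).comp (lowerProj H n (n - 1)))

/-- The right-hand side of the first order system of `l[y] = z y`. -/
def systemOp (l : Expression H Δ n) (z : ℂ) (t : ℝ) : StateSpace H n →L[ℂ] StateSpace H n :=
  (ContinuousLinearMap.inl ℂ (Fin n → H) (Fin n → H)).comp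
      (∑ m : Fin n, (ContinuousLinearMap.single ℂ (fun _ : Fin n => H) m).comp
        (lowerOp l (m + 1) t))
    + (ContinuousLinearMap.inr ℂ (Fin n → H) (Fin n → H)).comp
      (∑ j : Fin n, (ContinuousLinearMap.single ℂ (fun _ : Fin n => H) j).comp
        (coeffTerm l (ContinuousLinearMap.compL ℂ (StateSpace H n) H H) (lowerOp l) (j + 1) t
          - if (j : ℕ) + 1 < n then upperProj H n (j + 1) else z • lowerProj H n 0))

theorem lowerProj_systemOp (l : Expression H Δ n) (z : ℂ) (t : ℝ) {m : ℕ} (hm : m < n) :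
    (lowerProj H n m).comp (systemOp l z t) = lowerOp l (m + 1) t := by
  refine ContinuousLinearMap.ext fun x => ?_
  rw [ContinuousLinearMap.comp_apply, lowerProj_apply hm]
  simp only [systemOp, add_apply, ContinuousLinearMap.comp_apply,
    ContinuousLinearMap.inl_apply, ContinuousLinearMap.inr_apply, Prod.fst_add,
    Pi.add_apply, Pi.zero_apply, sum_single_comp_apply, add_zero]

theorem upperProj_systemOp (l : Expression H Δ n) (z : ℂ) (t : ℝ) {j : ℕ} (hj : j < n) :
    (upperProj H n j).comp (systemOp l z t)
      = coeffTerm l (ContinuousLinearMap.compL ℂ (StateSpace H n) H H) (lowerOp l) (j + 1) t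
          - if j + 1 < n then upperProj H n (j + 1) else z • lowerProj H n 0 := by
  refine ContinuousLinearMap.ext fun x => ?_
  rw [ContinuousLinearMap.comp_apply, upperProj_apply hj]
  simp only [systemOp, add_apply, ContinuousLinearMap.comp_apply,
    ContinuousLinearMap.inl_apply, ContinuousLinearMap.inr_apply, Prod.snd_add,
    Pi.add_apply, Pi.zero_apply, sum_single_comp_apply, zero_add]

theorem continuousOn_inverse_p_zero (l : Expression H Δ n) :
    ContinuousOn (fun t => Ring.inverse (l.p 0 t)) Δ := by
  intro t ht
  obtain ⟨w, hw⟩ := l.isUnit_p_zero t ht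
  have h1 : ContinuousAt Ring.inverse (l.p 0 t) := by
    rw [← hw]
    exact NormedRing.inverse_continuousAt w
  exact h1.comp_continuousWithinAt (l.continuousOn_p 0 (Nat.zero_le n) t ht)

theorem continuousOn_lowerOp (hn : 1 ≤ n) (l : Expression H Δ n) (m : ℕ) :
    ContinuousOn (lowerOp l m) Δ := by
  unfold lowerOp
  split_ifs
  · exact continuousOn_const
  · exact (continuousOn_inverse_p_zero l).clm_comp
      (continuousOn_const.add (((l.continuousOn_q 0 hn).clm_comp
        continuousOn_const).const_smul (Complex.I / 2)))

theorem continuousOn_systemOp (hn : 1 ≤ n) (l : Expression H Δ n) (z : ℂ) :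
    ContinuousOn (systemOp l z) Δ := by
  unfold systemOp
  refine (continuousOn_const.clm_comp (continuousOn_finsetSum _ fun m _ =>
    continuousOn_const.clm_comp (continuousOn_lowerOp hn l _))).add
    (continuousOn_const.clm_comp (continuousOn_finsetSum _ fun j _ =>
    continuousOn_const.clm_comp ((continuousOn_coeffTerm subset_rfl
      (fun m _ => continuousOn_lowerOp hn l m) j.2).sub continuousOn_const)))

/-- `lowerOp l n` was obtained by solving the formula for `y^{[n]}` for `y^{(n)}`, which the
invertibility of `p_0` permits. -/
theorem coeffTerm_lowerOp_zero (hn : 1 ≤ n) (l : Expression H Δ n) {t : ℝ} (ht : t ∈ Δ) :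
    coeffTerm l (ContinuousLinearMap.compL ℂ (StateSpace H n) H H) (lowerOp l) 0 t
      = upperProj H n 0 := by
  have h1 : ∀ x, l.p 0 t (Ring.inverse (l.p 0 t) x) = x := fun x => by
    rw [← mul_apply_eq_comp, Ring.mul_inverse_cancel _ (l.isUnit_p_zero t ht),
      one_apply_eq_self]
  refine ContinuousLinearMap.ext fun x => ?_
  simp [coeffTerm, lowerOp, show 0 < n by omega, h1]

/-- Global solvability of the initial value problem of `l[Y] = z Y + G` for operator functions. -/
theorem exists_quasiSystem (hΔ : IsHalfInterval Δ) (hn : 1 ≤ n) (l : Expression H Δ n) (z : ℂ)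
    {K : Type*} [NormedAddCommGroup K] [NormedSpace ℂ K] {G : ℝ → K →L[ℂ] H}
    (hG : ContinuousOn G Δ) {t₀ : ℝ} (ht₀ : t₀ ∈ Δ) (x₀ : K →L[ℂ] StateSpace H n) :
    ∃ D U : ℕ → ℝ → K →L[ℂ] H,
      QuasiSystem l (ContinuousLinearMap.compL ℂ K H H) Δ D U ∧
      (∀ t ∈ Δ, U n t = z • D 0 t + G t) ∧
      (∀ m < n, D m t₀ = (lowerProj H n m).comp x₀) ∧
      ∀ j < n, U j t₀ = (upperProj H n j).comp x₀ := by
  -- The equation is solved in the Banach space of operators from `K` to the state space, so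
  -- derivatives exist in the operator norm and not only strongly.
  have hAc : ContinuousOn (fun t =>
      ContinuousLinearMap.compL ℂ K (StateSpace H n) (StateSpace H n) (systemOp l z t)) Δ :=
    (ContinuousLinearMap.continuous _).comp_continuousOn (continuousOn_systemOp hn l z)
  have hFc : ContinuousOn (fun t => (forcingOp H n).comp (G t)) Δ :=
    continuousOn_const.clm_comp hG
  obtain ⟨Y, hY0, hY⟩ := exists_linear_ode_solution hΔ hAc hFc ht₀ x₀
  have hYc : ContinuousOn Y Δ := fun t ht => (hY t ht).continuousWithinAt
  have hproj : ∀ P : StateSpace H n →L[ℂ] H, ∀ t ∈ Δ, HasDerivWithinAt (fun s => P.comp (Y s))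
      ((P.comp (systemOp l z t)).comp (Y t) + (P.comp (forcingOp H n)).comp (G t)) Δ t := by
    intro P t ht
    refine (((ContinuousLinearMap.compL ℂ K (StateSpace H n) H P).restrictScalars
      ℝ).hasFDerivAt.comp_hasDerivWithinAt t (hY t ht)).congr_deriv ?_
    refine ContinuousLinearMap.ext fun x => ?_
    simp
  have hterm : ∀ j, ∀ t, coeffTerm l (ContinuousLinearMap.compL ℂ K H H)
      (fun m s => (lowerOp l m s).comp (Y s)) j t
      = (coeffTerm l (ContinuousLinearMap.compL ℂ (StateSpace H n) H H) (lowerOp l) j t).comp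
        (Y t) := by
    intro j t
    exact coeffTerm_map (l := l) (Φ := (ContinuousLinearMap.compL ℂ K (StateSpace H n) H).flip
      (Y t)) (act' := ContinuousLinearMap.compL ℂ K H H)
      (act := ContinuousLinearMap.compL ℂ (StateSpace H n) H H) (fun a x => rfl) (lowerOp l) j t
  have hlow : ∀ m < n, ∀ s, lowerOp l m s = lowerProj H n m := fun m hm s => by
    rw [lowerOp, if_pos hm]
  -- The state stops at order `2n - 1`; the entry `U n` is set to the prescribed value `z D 0 + G`
  -- of the quasi-derivative of order `2n`.
  refine ⟨fun m t => (lowerOp l m t).comp (Y t), fun j t => if j < n then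
    (upperProj H n j).comp (Y t) else z • (lowerOp l 0 t).comp (Y t) + G t,
    ⟨fun m hm t ht => ?_, fun t ht => ?_, fun j hj t ht => ?_, ?_, ?_⟩, fun t ht => ?_,
    fun m hm => ?_, fun j hj => ?_⟩
  · have := hproj (lowerProj H n m) t ht
    simp only [lowerProj_systemOp l z t hm, lowerProj_forcingOp hm,
      ContinuousLinearMap.zero_comp, add_zero] at this
    simpa only [hlow m hm] using this
  · rw [hterm, coeffTerm_lowerOp_zero hn l ht, if_pos (by omega)]
  · have := hproj (upperProj H n j) t ht
    rw [upperProj_systemOp l z t hj, upperProj_forcingOp hj] at this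
    simp only [if_pos hj]
    refine this.congr_deriv ?_
    rw [hterm, hlow 0 (by omega)]
    split_ifs
    · simp
    · refine ContinuousLinearMap.ext fun x => ?_
      simp
      abel
  · exact (continuousOn_lowerOp hn l n).clm_comp hYc
  · simp only [lt_irrefl, if_false]
    exact (((continuousOn_lowerOp hn l 0).clm_comp hYc).const_smul z).add hG
  · simp
  · simp only [hlow m hm, hY0]
  · simp only [if_pos hj, hY0]

end Existence

/-! ### Interpolation between a function and its derivatives -/

section Coercivity

/-! A family of functions is controlled by `X` relative to `N` if it is bounded by
`η N + C X` for arbitrarily small `η`. -/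

variable {ι : Type*} {N X : ι → ℝ} {c : ℝ} {V : Type*} [NormedAddCommGroup V]

/-- The functions `v i` on `[0, c]` are bounded by `η N + C X` for every `η > 0`. -/
def Controlled (c : ℝ) (N X : ι → ℝ) (v : ι → ℝ → V) : Prop :=
  ∀ η > 0, ∃ C : ℝ, 0 ≤ C ∧ ∀ i, ∀ t ∈ Set.Icc 0 c, ‖v i t‖ ≤ η * N i + C * X i

/-- The oscillation of the functions `v i` on small intervals is bounded by `η N + C X` for every
`η > 0`. -/
def EquiControlled (c : ℝ) (N X : ι → ℝ) (v : ι → ℝ → V) : Prop :=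
  ∀ η > 0, ∃ δ : ℝ, 0 < δ ∧ ∃ C : ℝ, 0 ≤ C ∧ ∀ i, ∀ s ∈ Set.Icc 0 c, ∀ t ∈ Set.Icc 0 c,
    |t - s| ≤ δ → ‖v i t - v i s‖ ≤ η * N i + C * X i

/-- The functions `v i` are bounded by a multiple of `N`. -/
def NormBounded (c : ℝ) (N : ι → ℝ) (v : ι → ℝ → V) : Prop :=
  ∃ M : ℝ, 0 ≤ M ∧ ∀ i, ∀ t ∈ Set.Icc 0 c, ‖v i t‖ ≤ M * N i

variable {v w : ι → ℝ → V}

theorem Controlled.congr (hv : Controlled c N X v) (h : ∀ i, ∀ t ∈ Set.Icc 0 c, w i t = v i t) :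
    Controlled c N X w := by
  intro η hη
  obtain ⟨C, hC, h1⟩ := hv η hη
  exact ⟨C, hC, fun i t ht => by rw [h i t ht]; exact h1 i t ht⟩

theorem Controlled.add (hv : Controlled c N X v) (hw : Controlled c N X w) :
    Controlled c N X (fun i t => v i t + w i t) := by
  intro η hη
  obtain ⟨C, hC, h1⟩ := hv (η / 2) (half_pos hη)
  obtain ⟨C', hC', h2⟩ := hw (η / 2) (half_pos hη)
  refine ⟨C + C', add_nonneg hC hC', fun i t ht => (norm_add_le _ _).trans ?_⟩
  linarith [h1 i t ht, h2 i t ht]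

theorem Controlled.neg (hv : Controlled c N X v) : Controlled c N X (fun i t => -v i t) := by
  simpa only [Controlled, norm_neg] using hv

theorem Controlled.sub (hv : Controlled c N X v) (hw : Controlled c N X w) :
    Controlled c N X (fun i t => v i t - w i t) := by
  simpa only [sub_eq_add_neg] using hv.add hw.neg

theorem EquiControlled.congr (hv : EquiControlled c N X v)
    (h : ∀ i, ∀ t ∈ Set.Icc 0 c, w i t = v i t) : EquiControlled c N X w := by
  intro η hη
  obtain ⟨δ, hδ, C, hC, h1⟩ := hv η hη
  exact ⟨δ, hδ, C, hC, fun i s hs t ht => by rw [h i t ht, h i s hs]; exact h1 i s hs t ht⟩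

theorem EquiControlled.add (hv : EquiControlled c N X v) (hw : EquiControlled c N X w) :
    EquiControlled c N X (fun i t => v i t + w i t) := by
  intro η hη
  obtain ⟨δ, hδ, C, hC, h1⟩ := hv (η / 2) (half_pos hη)
  obtain ⟨δ', hδ', C', hC', h2⟩ := hw (η / 2) (half_pos hη)
  refine ⟨min δ δ', lt_min hδ hδ', C + C', add_nonneg hC hC', fun i s hs t ht hst => ?_⟩
  have h3 := h1 i s hs t ht (hst.trans (min_le_left _ _))
  have h4 := h2 i s hs t ht (hst.trans (min_le_right _ _))
  rw [add_sub_add_comm]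
  refine (norm_add_le _ _).trans ?_
  linarith

theorem EquiControlled.neg (hv : EquiControlled c N X v) :
    EquiControlled c N X (fun i t => -v i t) := by
  intro η hη
  obtain ⟨δ, hδ, C, hC, h1⟩ := hv η hη
  refine ⟨δ, hδ, C, hC, fun i s hs t ht hst => ?_⟩
  rw [neg_sub_neg, norm_sub_rev]
  exact h1 i s hs t ht hst

theorem EquiControlled.sub (hv : EquiControlled c N X v) (hw : EquiControlled c N X w) :
    EquiControlled c N X (fun i t => v i t - w i t) := by
  simpa only [sub_eq_add_neg] using hv.add hw.neg

theorem NormBounded.add (hv : NormBounded c N v) (hw : NormBounded c N w) :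
    NormBounded c N (fun i t => v i t + w i t) := by
  obtain ⟨M, hM, h1⟩ := hv
  obtain ⟨M', hM', h2⟩ := hw
  refine ⟨M + M', add_nonneg hM hM', fun i t ht => (norm_add_le _ _).trans ?_⟩
  linarith [h1 i t ht, h2 i t ht]

theorem NormBounded.neg (hv : NormBounded c N v) : NormBounded c N (fun i t => -v i t) := by
  simpa only [NormBounded, norm_neg] using hv

theorem NormBounded.sub (hv : NormBounded c N v) (hw : NormBounded c N w) :
    NormBounded c N (fun i t => v i t - w i t) := by
  simpa only [sub_eq_add_neg] using hv.add hw.neg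

theorem NormBounded.congr (hv : NormBounded c N v) (h : ∀ i, ∀ t ∈ Set.Icc 0 c, w i t = v i t) :
    NormBounded c N w := by
  obtain ⟨M, hM, h1⟩ := hv
  exact ⟨M, hM, fun i t ht => by rw [h i t ht]; exact h1 i t ht⟩

theorem Controlled.zero (hN : ∀ i, 0 ≤ N i) :
    Controlled c N X (fun _ _ => (0 : V)) := fun η hη =>
  ⟨0, le_rfl, fun i t _ => by
    rw [norm_zero, zero_mul, add_zero]; exact mul_nonneg hη.le (hN i)⟩

theorem EquiControlled.zero (hN : ∀ i, 0 ≤ N i) :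
    EquiControlled c N X (fun _ _ => (0 : V)) := fun η hη =>
  ⟨1, one_pos, 0, le_rfl, fun i s _ t _ _ => by
    rw [sub_zero, norm_zero, zero_mul, add_zero]; exact mul_nonneg hη.le (hN i)⟩

theorem NormBounded.zero : NormBounded c N (fun _ _ => (0 : V)) :=
  ⟨0, le_rfl, fun i t _ => by simp⟩

variable {H : Type*} [NormedAddCommGroup H] [NormedSpace ℂ H] {B : ℝ → H →L[ℂ] H}
  {v w : ι → ℝ → H}

theorem NormBounded.clm_apply (hB : ContinuousOn B (Set.Icc 0 c)) (hv : NormBounded c N v) :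
    NormBounded c N (fun i t => B t (v i t)) := by
  obtain ⟨M, hM, h1⟩ := hv
  obtain ⟨b, hb⟩ := isCompact_Icc.exists_bound_of_continuousOn hB
  refine ⟨max b 0 * M, by positivity, fun i t ht => (ContinuousLinearMap.le_opNorm _ _).trans ?_⟩
  rw [mul_assoc]
  exact mul_le_mul ((hb t ht).trans (le_max_left _ _)) (h1 i t ht) (norm_nonneg _)
    (le_max_right _ _)

theorem Controlled.clm_apply (hB : ContinuousOn B (Set.Icc 0 c)) (hv : Controlled c N X v) :
    Controlled c N X (fun i t => B t (v i t)) := by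
  obtain ⟨b, hb⟩ := isCompact_Icc.exists_bound_of_continuousOn hB
  intro η hη
  have hb1 : 0 < max b 0 + 1 := by positivity
  obtain ⟨C, hC, h1⟩ := hv (η / (max b 0 + 1)) (by positivity)
  refine ⟨(max b 0 + 1) * C, by positivity,
    fun i t ht => (ContinuousLinearMap.le_opNorm _ _).trans ?_⟩
  calc ‖B t‖ * ‖v i t‖ ≤ (max b 0 + 1) * (η / (max b 0 + 1) * N i + C * X i) :=
        mul_le_mul ((hb t ht).trans (by linarith [le_max_left b 0])) (h1 i t ht) (norm_nonneg _)
          hb1.le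
    _ = η * N i + (max b 0 + 1) * C * X i := by field_simp

/-- Split the increment as `B t (v t - v s) + (B t - B s) (v s)`. The second term is small by
uniform continuity of `B`, but only relative to the size of `v`; this is why `NormBounded` is
carried along. -/
theorem EquiControlled.clm_apply (hB : ContinuousOn B (Set.Icc 0 c)) (hN : ∀ i, 0 ≤ N i)
    (hv : EquiControlled c N X v) (hv' : NormBounded c N v) :
    EquiControlled c N X (fun i t => B t (v i t)) := by
  obtain ⟨b, hb⟩ := isCompact_Icc.exists_bound_of_continuousOn hB
  obtain ⟨M, hM, hM'⟩ := hv'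
  have hu := isCompact_Icc.uniformContinuousOn_of_continuous hB
  intro η hη
  have hb1 : 0 < max b 0 + 1 := by positivity
  obtain ⟨δ, hδ, C, hC, h1⟩ := hv (η / 2 / (max b 0 + 1)) (by positivity)
  obtain ⟨ε, hε, h2⟩ := Metric.uniformContinuousOn_iff_le.mp hu (η / 2 / (M + 1)) (by positivity)
  refine ⟨min δ ε, lt_min hδ hε, (max b 0 + 1) * C, by positivity, fun i s hs t ht hst => ?_⟩
  have h3 := h1 i s hs t ht (hst.trans (min_le_left _ _))
  have h4 : ‖B t - B s‖ ≤ η / 2 / (M + 1) := by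
    rw [← dist_eq_norm]
    exact h2 t ht s hs (by rw [Real.dist_eq]; exact hst.trans (min_le_right _ _))
  have h5 : B t (v i t) - B s (v i s) = B t (v i t - v i s) + (B t - B s) (v i s) := by
    simp
  have h6 : ‖B t (v i t - v i s)‖ ≤ (max b 0 + 1) * (η / 2 / (max b 0 + 1) * N i + C * X i) :=
    (ContinuousLinearMap.le_opNorm _ _).trans
      (mul_le_mul ((hb t ht).trans (by linarith [le_max_left b 0])) h3 (norm_nonneg _) hb1.le)
  have h7 : ‖(B t - B s) (v i s)‖ ≤ η / 2 / (M + 1) * (M * N i) :=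
    (ContinuousLinearMap.le_opNorm _ _).trans
      (mul_le_mul h4 (hM' i s hs) (norm_nonneg _) (by positivity))
  have h8 : η / 2 / (M + 1) * (M * N i) ≤ η / 2 * N i := by
    rw [div_mul_eq_mul_div, div_le_iff₀ (by positivity)]
    nlinarith [mul_nonneg hη.le (hN i)]
  have h9 : (max b 0 + 1) * (η / 2 / (max b 0 + 1) * N i + C * X i)
      = η / 2 * N i + (max b 0 + 1) * C * X i := by field_simp
  rw [h5]
  refine (norm_add_le _ _).trans ?_
  linarith

/-- If a family is controlled and its derivatives are equicontrolled, then the derivatives are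
controlled. -/
theorem Controlled.deriv (hc : 0 < c) (hv : Controlled c N X v) (hw : EquiControlled c N X w)
    (hd : ∀ i, ∀ t ∈ Set.Icc 0 c, HasDerivWithinAt (v i) (w i t) (Set.Icc 0 c) t) :
    Controlled c N X w := by
  intro η hη
  obtain ⟨δ, hδ, C, hC, h1⟩ := hw (η / 2) (half_pos hη)
  -- A step short enough for the oscillation bound and at most `c / 2`, so that from any `t` one can
  -- move by `h` to the left or to the right inside `[0, c]`.
  set h := min δ c / 2 with hh
  have hmin : 0 < min δ c := lt_min hδ hc
  have hh0 : 0 < h := by positivity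
  -- The difference quotient of `v` over length `h` involves two values, so this choice contributes
  -- `η / 2`. The oscillation of `w` contributes the other half.
  obtain ⟨C', hC', h2⟩ := hv (η * h / 4) (by positivity)
  refine ⟨C + 2 * C' / h, by positivity, fun i t ht => ?_⟩
  have hhδ : h ≤ δ := by linarith [min_le_left δ c]
  have hhc : h ≤ c / 2 := by linarith [min_le_right δ c]
  obtain ⟨s, hs, hst, hsh⟩ : ∃ s ∈ Set.Icc 0 c, |s - t| = h ∧ 0 < h := by
    rcases le_total t (c / 2) with h' | h'
    · exact ⟨t + h, ⟨by linarith [ht.1], by linarith⟩, by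
        rw [add_sub_cancel_left, abs_of_pos hh0], hh0⟩
    · exact ⟨t - h, ⟨by linarith, by linarith [ht.2]⟩, by
        rw [sub_sub_cancel_left, abs_neg, abs_of_pos hh0], hh0⟩
  have hsub : Set.uIcc t s ⊆ Set.Icc 0 c := Set.ordConnected_Icc.uIcc_subset ht hs
  have h3 : ‖(v i s - s • w i t) - (v i t - t • w i t)‖
      ≤ (η / 2 * N i + C * X i) * ‖s - t‖ := by
    refine (convex_uIcc t s).norm_image_sub_le_of_norm_hasDerivWithin_le
      (f := fun r => v i r - r • w i t) (f' := fun r => w i r - (1 : ℝ) • w i t)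
      (fun r hr => ((hd i r (hsub hr)).mono hsub).sub
        ((hasDerivWithinAt_id r _).smul_const (w i t))) (fun r hr => ?_)
      Set.left_mem_uIcc Set.right_mem_uIcc
    rw [one_smul]
    refine h1 i t ht r (hsub hr) (le_trans ?_ hhδ)
    rw [← hst]
    exact Set.abs_sub_left_of_mem_uIcc hr
  -- First order Taylor formula solved for the derivative at `t`; `h3` bounds the remainder.
  have h4 : (s - t) • w i t = (v i s - v i t)
      - ((v i s - s • w i t) - (v i t - t • w i t)) := by
    rw [sub_smul]; abel
  have h5 : h * ‖w i t‖ ≤ 2 * (η * h / 4 * N i + C' * X i)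
      + (η / 2 * N i + C * X i) * h := by
    calc h * ‖w i t‖ = ‖(s - t) • w i t‖ := by rw [norm_smul, Real.norm_eq_abs, hst]
      _ ≤ ‖v i s - v i t‖ + ‖(v i s - s • w i t) - (v i t - t • w i t)‖ := by
          rw [h4]; exact norm_sub_le _ _
      _ ≤ _ := by
          rw [Real.norm_eq_abs, hst] at h3
          have := norm_sub_le (v i s) (v i t)
          linarith [h2 i s hs, h2 i t ht]
  have h6 : h * ‖w i t‖ ≤ h * (η * N i + (C + 2 * C' / h) * X i) := by
    refine h5.trans (le_of_eq ?_)
    field_simp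
    ring
  exact le_of_mul_le_mul_left h6 hh0

variable [CompleteSpace H]

/-- The increments of a function on `[0, c]` with derivative `w - f`. -/
theorem norm_sub_le_of_deriv_sub {u w f : ℝ → H} {M Y s t : ℝ}
    (hs : s ∈ Set.Icc 0 c) (ht : t ∈ Set.Icc 0 c)
    (hw : ContinuousOn w (Set.Icc 0 c)) (hf : ContinuousOn f (Set.Icc 0 c))
    (hd : ∀ r ∈ Set.Icc 0 c, HasDerivWithinAt u (w r - f r) (Set.Icc 0 c) r)
    (hM : ∀ r ∈ Set.Icc 0 c, ‖w r‖ ≤ M) (hY : ∫ r in (0 : ℝ)..c, ‖f r‖ ≤ Y) (hst : s ≤ t) :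
    ‖u t - u s‖ ≤ M * (t - s) + Y := by
  have hsub : Set.Icc s t ⊆ Set.Icc 0 c := Set.Icc_subset_Icc hs.1 ht.2
  have hsub' : Set.uIcc s t ⊆ Set.Icc 0 c := by rwa [Set.uIcc_of_le hst]
  have hint := intervalIntegral.integral_eq_sub_of_hasDerivAt_of_le hst
    (f := u) (f' := fun r => w r - f r)
    (fun r hr => (hd r (hsub hr)).continuousWithinAt.mono hsub)
    (fun r hr => (hd r (hsub (Set.Ioo_subset_Icc_self hr))).hasDerivAt
      (Icc_mem_nhds (hs.1.trans_lt hr.1) (hr.2.trans_le ht.2)))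
    (((hw.mono hsub').sub (hf.mono hsub')).intervalIntegrable)
  rw [← hint, intervalIntegral.integral_sub (hw.mono hsub').intervalIntegrable
    (hf.mono hsub').intervalIntegrable]
  have h1 : ‖∫ r in s..t, w r‖ ≤ M * (t - s) := by
    have := intervalIntegral.norm_integral_le_of_norm_le_const (a := s) (b := t) (f := w) (C := M)
      fun r hr => hM r (hsub' (Set.uIoc_subset_uIcc hr))
    rwa [abs_of_nonneg (sub_nonneg.mpr hst)] at this
  have h2 : ‖∫ r in s..t, f r‖ ≤ Y := by
    refine (intervalIntegral.norm_integral_le_integral_norm hst).trans (le_trans ?_ hY)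
    refine intervalIntegral.integral_mono_interval hs.1 hst ht.2
      (ae_of_all _ fun _ => norm_nonneg _) ?_
    refine (ContinuousOn.norm ?_).intervalIntegrable
    rwa [Set.uIcc_of_le (hs.1.trans hs.2)]
  exact (norm_sub_le _ _).trans (add_le_add h1 h2)

/-- The part `w` of the derivative contributes at most a multiple of `N |t - s|`, which is small for
short intervals. The part `f` is known only in `L₁` and goes entirely into `X`; it will be `l[y]` at
the top of the ladder. -/
theorem EquiControlled.of_deriv {f : ι → ℝ → H}
    (hw : ∀ i, ContinuousOn (w i) (Set.Icc 0 c)) (hf : ∀ i, ContinuousOn (f i) (Set.Icc 0 c))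
    (hd : ∀ i, ∀ t ∈ Set.Icc 0 c, HasDerivWithinAt (v i) (w i t - f i t) (Set.Icc 0 c) t)
    (hM : NormBounded c N w) (hX : ∀ i, ∫ r in (0 : ℝ)..c, ‖f i r‖ ≤ X i) (hN : ∀ i, 0 ≤ N i) :
    EquiControlled c N X v := by
  obtain ⟨M, hM, hM'⟩ := hM
  intro η hη
  refine ⟨η / (M + 1), by positivity, 1, zero_le_one, fun i s hs t ht hst => ?_⟩
  have key : ∀ s ∈ Set.Icc 0 c, ∀ t ∈ Set.Icc 0 c, s ≤ t → |t - s| ≤ η / (M + 1) →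
      ‖v i t - v i s‖ ≤ η * N i + 1 * X i := by
    intro s hs t ht hle hst
    rw [abs_of_nonneg (sub_nonneg.mpr hle), le_div_iff₀ (by positivity)] at hst
    have h1 := norm_sub_le_of_deriv_sub hs ht (hw i) (hf i) (hd i) (hM' i) (hX i) hle
    have h2 : M * N i * (t - s) ≤ η * N i := by
      have : (t - s) * M ≤ η := by nlinarith
      nlinarith [hN i]
    linarith
  rcases le_total s t with h | h
  · exact key s hs t ht h hst
  · rw [norm_sub_rev]
    exact key t ht s hs h (by rwa [abs_sub_comm])

end Coercivity

/-! ### A priori estimate for the quasi-derivatives -/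

section SystemCoercivity

theorem Controlled.pi {ι : Type*} {N X : ι → ℝ} {c : ℝ} {V : Type*} [NormedAddCommGroup V] {k : ℕ}
    {v : Fin k → ι → ℝ → V} (hN : ∀ i, 0 ≤ N i) (hX : ∀ i, 0 ≤ X i)
    (hv : ∀ m, Controlled c N X (v m)) : Controlled c N X (fun i t m => v m i t) := by
  intro η hη
  choose C hC h using fun m => hv m η hη
  refine ⟨∑ m, C m, Finset.sum_nonneg fun m _ => hC m, fun i t ht => ?_⟩
  have h0 : ∀ m, C m ≤ ∑ m, C m := fun m =>
    Finset.single_le_sum (fun m _ => hC m) (Finset.mem_univ m)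
  refine (pi_norm_le_iff_of_nonneg ?_).mpr fun m => (h m i t ht).trans ?_
  · exact add_nonneg (mul_nonneg hη.le (hN i))
      (mul_nonneg (Finset.sum_nonneg fun m _ => hC m) (hX i))
  · have := mul_le_mul_of_nonneg_right (h0 m) (hX i)
    linarith

theorem Controlled.prodMk {ι : Type*} {N X : ι → ℝ} {c : ℝ} {V W : Type*} [NormedAddCommGroup V]
    [NormedAddCommGroup W] {v : ι → ℝ → V} {w : ι → ℝ → W} (hX : ∀ i, 0 ≤ X i)
    (hv : Controlled c N X v) (hw : Controlled c N X w) :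
    Controlled c N X (fun i t => (v i t, w i t)) := by
  intro η hη
  obtain ⟨C, hC, h1⟩ := hv η hη
  obtain ⟨C', hC', h2⟩ := hw η hη
  refine ⟨max C C', hC.trans (le_max_left _ _), fun i t ht => ?_⟩
  rw [Prod.norm_def]
  have h3 := mul_le_mul_of_nonneg_right (le_max_left C C') (hX i)
  have h4 := mul_le_mul_of_nonneg_right (le_max_right C C') (hX i)
  exact max_le ((h1 i t ht).trans (by linarith)) ((h2 i t ht).trans (by linarith))

variable {H : Type u} [NormedAddCommGroup H] [InnerProductSpace ℂ H] [CompleteSpace H]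
  {Δ : Set ℝ} {n : ℕ} {l : Expression H Δ n} {c : ℝ}

/-- A property of families of functions that is stable under sums and under multiplication by
continuous operator functions passes to `coeffTerm`. -/
theorem coeffTerm_induction {ι : Type*} {P : (ι → ℝ → H) → Prop}
    (hsub : Set.Icc 0 c ⊆ Δ) (hP0 : P fun _ _ => 0)
    (hPadd : ∀ v w, P v → P w → P fun i t => v i t + w i t)
    (hPsub : ∀ v w, P v → P w → P fun i t => v i t - w i t)
    (hPclm : ∀ (B : ℝ → H →L[ℂ] H) (v), ContinuousOn B (Set.Icc 0 c) → P v →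
      P fun i t => B t (v i t))
    {D : ι → ℕ → ℝ → H} (hD : ∀ m ≤ n, P fun i => D i m) {j : ℕ} (hj : j ≤ n) :
    P fun i => coeffTerm l (ContinuousLinearMap.id ℂ (H →L[ℂ] H)) (D i) j := by
  unfold coeffTerm
  refine hPsub _ _ (hPadd _ _ ?_ ?_) ?_
  · exact hPclm (l.p j) _ ((l.continuousOn_p j hj).mono hsub) (hD _ (by omega))
  · split_ifs with h
    · exact hPclm (fun t => (Complex.I / 2) • ContinuousLinearMap.adjoint (l.q (j - 1) t)) _
        ((((ContinuousLinearMap.adjoint (𝕜 := ℂ) (E := H) (F := H)).continuous.comp_continuousOn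
          ((l.continuousOn_q _ (by omega)).mono hsub))).const_smul (Complex.I / 2))
        (hD (n - j + 1) (by omega))
    · exact hP0
  · split_ifs with h
    · exact hPclm (fun t => (Complex.I / 2) • l.q j t) _
        (((l.continuousOn_q _ (by omega)).mono hsub).const_smul (Complex.I / 2))
        (hD (n - j - 1) (by omega))
    · exact hP0

/-- The derivative `y^{(n)}` is not a component of the state. Invertibility of `p_0` recovers it,
and with it all bounds, from `y^{[n]}` and `y^{(n-1)}`. -/
theorem QuasiSystem.top_lower_eq {S : Set ℝ} (hS : S ⊆ Δ) (hn : 1 ≤ n) {D U : ℕ → ℝ → H}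
    (h : QuasiSystem l (ContinuousLinearMap.id ℂ (H →L[ℂ] H)) S D U) :
    ∀ t ∈ S, D n t
      = Ring.inverse (l.p 0 t) (U 0 t + ((Complex.I / 2) • l.q 0 t) (D (n - 1) t)) := by
  intro t ht
  have h1 : ∀ x, Ring.inverse (l.p 0 t) (l.p 0 t x) = x := fun x => by
    rw [← mul_apply_eq_comp, Ring.inverse_mul_cancel _ (l.isUnit_p_zero t (hS ht)),
      one_apply_eq_self]
  rw [h.upper_zero t ht]
  simp [coeffTerm, show 0 < n by omega, h1]

theorem hasDerivWithinAt_integral_Icc {F : ℝ → H} (hF : ContinuousOn F (Set.Icc 0 c)) {t : ℝ}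
    (ht : t ∈ Set.Icc 0 c) :
    HasDerivWithinAt (fun r => ∫ s in (0 : ℝ)..r, F s) (F t) (Set.Icc 0 c) t := by
  have : Fact (t ∈ Set.Icc 0 c) := ⟨ht⟩
  refine intervalIntegral.integral_hasDerivWithinAt_right ?_
    (hF.stronglyMeasurableAtFilter_nhdsWithin measurableSet_Icc t) (hF t ht)
  exact (hF.mono (Set.ordConnected_Icc.uIcc_subset ⟨le_rfl, ht.1.trans ht.2⟩
    ht)).intervalIntegrable

/-- Solutions on `[0, c]` with a common bound `N` for their quasi-derivatives. -/
def BoundedSolution (l : Expression H Δ n) (c : ℝ) : Type u :=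
  {p : (ℕ → ℝ → H) × (ℕ → ℝ → H) × ℝ //
    QuasiSystem l (ContinuousLinearMap.id ℂ (H →L[ℂ] H)) (Set.Icc 0 c) p.1 p.2.1 ∧ 0 ≤ p.2.2 ∧
      ∀ t ∈ Set.Icc 0 c, (∀ m < n, ‖p.1 m t‖ ≤ p.2.2) ∧ ∀ j < n, ‖p.2.1 j t‖ ≤ p.2.2}

namespace BoundedSolution

/-- The functions `y, …, y^{(n)}`. -/
def lower (i : BoundedSolution l c) : ℕ → ℝ → H := i.1.1

/-- The functions `y^{[n]}, …, y^{[2n]}`. -/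
def upper (i : BoundedSolution l c) : ℕ → ℝ → H := i.1.2.1

/-- The bound for the quasi-derivatives. -/
def bound (i : BoundedSolution l c) : ℝ := i.1.2.2

/-- The `L₁`-norms of `y` and `l[y]`. -/
def data (i : BoundedSolution l c) : ℝ :=
  (∫ t in (0 : ℝ)..c, ‖i.lower 0 t‖) + ∫ t in (0 : ℝ)..c, ‖i.upper n t‖

theorem quasiSystem (i : BoundedSolution l c) :
    QuasiSystem l (ContinuousLinearMap.id ℂ (H →L[ℂ] H)) (Set.Icc 0 c) i.lower i.upper := i.2.1

theorem bound_nonneg (i : BoundedSolution l c) : 0 ≤ i.bound := i.2.2.1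

theorem integral_upper_le (hc : 0 < c) (i : BoundedSolution l c) :
    ∫ t in (0 : ℝ)..c, ‖i.upper n t‖ ≤ i.data :=
  le_add_of_nonneg_left (intervalIntegral.integral_nonneg hc.le fun _ _ => norm_nonneg _)

theorem integral_lower_le (hc : 0 < c) (i : BoundedSolution l c) :
    ∫ t in (0 : ℝ)..c, ‖i.lower 0 t‖ ≤ i.data :=
  le_add_of_nonneg_right (intervalIntegral.integral_nonneg hc.le fun _ _ => norm_nonneg _)

theorem data_nonneg (hc : 0 < c) (i : BoundedSolution l c) : 0 ≤ i.data :=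
  add_nonneg (intervalIntegral.integral_nonneg hc.le fun _ _ => norm_nonneg _)
    (intervalIntegral.integral_nonneg hc.le fun _ _ => norm_nonneg _)

theorem normBounded_upper {j : ℕ} (hj : j < n) :
    NormBounded c bound (fun i : BoundedSolution l c => i.upper j) :=
  ⟨1, zero_le_one, fun i t ht => by rw [one_mul]; exact (i.2.2.2 t ht).2 j hj⟩

theorem normBounded_lower (hn : 1 ≤ n) (hsub : Set.Icc 0 c ⊆ Δ) {m : ℕ} (hm : m ≤ n) :
    NormBounded c bound (fun i : BoundedSolution l c => i.lower m) := by
  have h : ∀ m < n, NormBounded c bound (fun i : BoundedSolution l c => i.lower m) :=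
    fun m hm => ⟨1, zero_le_one, fun i t ht => by rw [one_mul]; exact (i.2.2.2 t ht).1 m hm⟩
  rcases hm.lt_or_eq with h1 | rfl
  · exact h m h1
  · exact (((normBounded_upper (by omega)).add ((h (m - 1) (by omega)).clm_apply
      (((l.continuousOn_q 0 hn).mono hsub).const_smul (Complex.I / 2)))).clm_apply
        ((continuousOn_inverse_p_zero l).mono hsub)).congr
        fun i => i.quasiSystem.top_lower_eq hsub hn

theorem normBounded_coeffTerm (hn : 1 ≤ n) (hsub : Set.Icc 0 c ⊆ Δ) {j : ℕ} (hj : j ≤ n) :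
    NormBounded c bound (fun i : BoundedSolution l c =>
      coeffTerm l (ContinuousLinearMap.id ℂ (H →L[ℂ] H)) i.lower j) :=
  coeffTerm_induction hsub .zero (fun _ _ hv hw => hv.add hw) (fun _ _ hv hw => hv.sub hw)
    (fun _ _ hB hv => hv.clm_apply hB) (fun _ hm => normBounded_lower hn hsub hm) hj

theorem continuousOn_coeffTerm (hsub : Set.Icc 0 c ⊆ Δ) {j : ℕ} (hj : j ≤ n)
    (i : BoundedSolution l c) :
    ContinuousOn (coeffTerm l (ContinuousLinearMap.id ℂ (H →L[ℂ] H)) i.lower j) (Set.Icc 0 c) :=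
  DiffOp.continuousOn_coeffTerm hsub (fun _ hm => i.quasiSystem.continuousOn_D hm) hj

/-- Below the top the derivative is bounded by a multiple of `bound`. The derivative of `y^{[2n-1]}`
contains `l[y]`, which only the `L₁` part of `data` bounds. -/
theorem equiControlled_upper (hc : 0 < c) (hn : 1 ≤ n) (hsub : Set.Icc 0 c ⊆ Δ) {j : ℕ}
    (hj : j < n) :
    EquiControlled c bound data (fun i : BoundedSolution l c => i.upper j) := by
  rcases (show j + 1 ≤ n by omega).lt_or_eq with h | rfl
  · refine .of_deriv (w := fun i t => coeffTerm l (ContinuousLinearMap.id ℂ (H →L[ℂ] H)) i.lower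
        (j + 1) t - i.upper (j + 1) t) (f := fun _ _ => 0)
      (fun i => (i.continuousOn_coeffTerm hsub hj).sub (i.quasiSystem.continuousOn_U hj))
      (fun i => continuousOn_const) (fun i t ht => ?_)
      ((normBounded_coeffTerm hn hsub hj).sub (normBounded_upper h))
      (fun i => by simpa using i.data_nonneg hc) bound_nonneg
    rw [sub_zero]
    exact i.quasiSystem.deriv_upper j hj t ht
  · exact .of_deriv (fun i => i.continuousOn_coeffTerm hsub hj)
      (fun i => i.quasiSystem.continuousOn_upper)
      (fun i t ht => i.quasiSystem.deriv_upper j hj t ht) (normBounded_coeffTerm hn hsub hj)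
      (integral_upper_le hc) bound_nonneg

theorem equiControlled_lower (hc : 0 < c) (hn : 1 ≤ n) (hsub : Set.Icc 0 c ⊆ Δ) {m : ℕ}
    (hm : m ≤ n) :
    EquiControlled c bound data (fun i : BoundedSolution l c => i.lower m) := by
  have h : ∀ m < n, EquiControlled c bound data (fun i : BoundedSolution l c => i.lower m) := by
    intro m hm
    refine .of_deriv (w := fun i => i.lower (m + 1)) (f := fun _ _ => 0)
      (fun i => i.quasiSystem.continuousOn_D hm) (fun i => continuousOn_const)
      (fun i t ht => ?_) (normBounded_lower hn hsub hm)
      (fun i => by simpa using i.data_nonneg hc) bound_nonneg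
    rw [sub_zero]
    exact i.quasiSystem.deriv_lower m hm t ht
  rcases hm.lt_or_eq with h1 | rfl
  · exact h m h1
  · have hB : ContinuousOn (fun t => (Complex.I / 2) • l.q 0 t) (Set.Icc 0 c) :=
      ((l.continuousOn_q 0 hn).mono hsub).const_smul (Complex.I / 2)
    have hb := normBounded_lower (l := l) (c := c) hn hsub (Nat.sub_le m 1)
    exact (((equiControlled_upper hc hn hsub (by omega)).add
      ((h (m - 1) (by omega)).clm_apply hB bound_nonneg hb)).clm_apply
        ((continuousOn_inverse_p_zero l).mono hsub) bound_nonneg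
        ((normBounded_upper (by omega)).add (hb.clm_apply hB))).congr
        fun i => i.quasiSystem.top_lower_eq hsub hn

theorem equiControlled_coeffTerm (hc : 0 < c) (hn : 1 ≤ n) (hsub : Set.Icc 0 c ⊆ Δ) {j : ℕ}
    (hj : j ≤ n) :
    EquiControlled c bound data (fun i : BoundedSolution l c =>
      coeffTerm l (ContinuousLinearMap.id ℂ (H →L[ℂ] H)) i.lower j) :=
  (coeffTerm_induction (P := fun v : BoundedSolution l c → ℝ → H =>
      EquiControlled c bound data v ∧ NormBounded c bound v) hsub
    ⟨.zero bound_nonneg, .zero⟩ (fun _ _ hv hw => ⟨hv.1.add hw.1, hv.2.add hw.2⟩)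
    (fun _ _ hv hw => ⟨hv.1.sub hw.1, hv.2.sub hw.2⟩)
    (fun _ _ hB hv => ⟨hv.1.clm_apply hB bound_nonneg hv.2, hv.2.clm_apply hB⟩)
    (fun _ hm => ⟨equiControlled_lower hc hn hsub hm, normBounded_lower hn hsub hm⟩) hj).1

/-- The ladder starts one level below `y`, at its primitive, which `data` bounds pointwise. Each
application of `Controlled.deriv` climbs one derivative. -/
theorem controlled_lower (hc : 0 < c) (hn : 1 ≤ n) (hsub : Set.Icc 0 c ⊆ Δ) {m : ℕ}
    (hm : m ≤ n) : Controlled c bound data (fun i : BoundedSolution l c => i.lower m) := by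
  induction m with
  | zero =>
    have h0 : Controlled c bound data
        (fun (i : BoundedSolution l c) t => ∫ s in (0 : ℝ)..t, i.lower 0 s) := by
      refine fun η hη => ⟨1, zero_le_one, fun i t ht => ?_⟩
      have h1 : ‖∫ s in (0 : ℝ)..t, i.lower 0 s‖ ≤ i.data := by
        refine (intervalIntegral.norm_integral_le_integral_norm ht.1).trans
          (le_trans ?_ (i.integral_lower_le hc))
        refine intervalIntegral.integral_mono_interval le_rfl ht.1 ht.2
          (ae_of_all _ fun _ => norm_nonneg _) ?_
        refine (ContinuousOn.norm ?_).intervalIntegrable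
        rw [Set.uIcc_of_le hc.le]
        exact i.quasiSystem.continuousOn_D hm
      have := mul_nonneg hη.le i.bound_nonneg
      linarith
    exact h0.deriv hc (equiControlled_lower hc hn hsub hm) fun i t ht =>
      hasDerivWithinAt_integral_Icc (i.quasiSystem.continuousOn_D hm) ht
  | succ m ih =>
    exact (ih (by omega)).deriv hc (equiControlled_lower hc hn hsub hm) fun i t ht =>
      i.quasiSystem.deriv_lower m hm t ht

theorem controlled_coeffTerm (hc : 0 < c) (hn : 1 ≤ n) (hsub : Set.Icc 0 c ⊆ Δ) {j : ℕ}
    (hj : j ≤ n) :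
    Controlled c bound data (fun i : BoundedSolution l c =>
      coeffTerm l (ContinuousLinearMap.id ℂ (H →L[ℂ] H)) i.lower j) :=
  coeffTerm_induction hsub (.zero bound_nonneg) (fun _ _ hv hw => hv.add hw)
    (fun _ _ hv hw => hv.sub hw) (fun _ _ hB hv => hv.clm_apply hB)
    (fun _ hm => controlled_lower hc hn hsub hm) hj

/-- The ladder continues: `Controlled.deriv` applied to `y^{[n+j]}` controls its derivative, and
subtracting this from the coefficient term isolates `y^{[n+j+1]}`. It ends before `l[y]`, whose
oscillation is not controlled. -/
theorem controlled_upper (hc : 0 < c) (hn : 1 ≤ n) (hsub : Set.Icc 0 c ⊆ Δ) {j : ℕ}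
    (hj : j < n) : Controlled c bound data (fun i : BoundedSolution l c => i.upper j) := by
  induction j with
  | zero =>
    exact (controlled_coeffTerm hc hn hsub (Nat.zero_le n)).congr
      fun i t ht => i.quasiSystem.upper_zero t ht
  | succ j ih =>
    have h1 := (ih (by omega)).deriv hc ((equiControlled_coeffTerm hc hn hsub hj.le).sub
      (equiControlled_upper hc hn hsub hj)) fun i t ht =>
        i.quasiSystem.deriv_upper j (by omega) t ht
    exact ((controlled_coeffTerm hc hn hsub hj.le).sub h1).congr fun i t ht => by
      rw [sub_sub_cancel]

end BoundedSolution

/-- On a compact interval the quasi-derivatives of order below `2n` are bounded uniformly by the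
`L₁`-norms of `y` and `l[y]`. -/
theorem exists_quasiSystem_bound (hc : 0 < c) (hn : 1 ≤ n) (hsub : Set.Icc 0 c ⊆ Δ)
    (l : Expression H Δ n) :
    ∃ C : ℝ, 0 ≤ C ∧ ∀ D U : ℕ → ℝ → H,
      QuasiSystem l (ContinuousLinearMap.id ℂ (H →L[ℂ] H)) (Set.Icc 0 c) D U →
      ∀ t ∈ Set.Icc 0 c,
        (∀ m < n, ‖D m t‖
          ≤ C * ((∫ t in (0 : ℝ)..c, ‖D 0 t‖) + ∫ t in (0 : ℝ)..c, ‖U n t‖)) ∧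
        ∀ j < n, ‖U j t‖
          ≤ C * ((∫ t in (0 : ℝ)..c, ‖D 0 t‖) + ∫ t in (0 : ℝ)..c, ‖U n t‖) := by
  have key : Controlled c BoundedSolution.bound BoundedSolution.data
      (fun (i : BoundedSolution l c) t =>
        ((fun m : Fin n => i.lower m t, fun j : Fin n => i.upper j t) : StateSpace H n)) :=
    .prodMk (BoundedSolution.data_nonneg hc)
      (.pi BoundedSolution.bound_nonneg (BoundedSolution.data_nonneg hc)
        fun m => BoundedSolution.controlled_lower hc hn hsub m.2.le)
      (.pi BoundedSolution.bound_nonneg (BoundedSolution.data_nonneg hc)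
        fun j => BoundedSolution.controlled_upper hc hn hsub j.2)
  -- With `bound` equal to the maximum of the state norm, attained at `t₁` below, half of it is
  -- absorbed on the left. This doubles the constant.
  obtain ⟨C, hC, hC'⟩ := key (1 / 2) (by norm_num)
  refine ⟨2 * C, by positivity, fun D U h => ?_⟩
  set s : ℝ → StateSpace H n := fun t => (fun m : Fin n => D m t, fun j : Fin n => U j t) with hs
  have hsc : ContinuousOn s (Set.Icc 0 c) :=
    (continuousOn_pi.mpr fun m => h.continuousOn_D m.2.le).prodMk
      (continuousOn_pi.mpr fun j => h.continuousOn_U j.2.le)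
  obtain ⟨t₁, ht₁, hmax⟩ := isCompact_Icc.exists_isMaxOn ⟨0, le_rfl, hc.le⟩ hsc.norm
  have hD : ∀ t, ∀ m < n, ‖D m t‖ ≤ ‖s t‖ := fun t m hm =>
    (norm_le_pi_norm (s t).1 ⟨m, hm⟩).trans (norm_fst_le (s t))
  have hU : ∀ t, ∀ j < n, ‖U j t‖ ≤ ‖s t‖ := fun t j hj =>
    (norm_le_pi_norm (s t).2 ⟨j, hj⟩).trans (norm_snd_le (s t))
  let i : BoundedSolution l c := ⟨(D, U, ‖s t₁‖), h, norm_nonneg _, fun t ht =>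
    ⟨fun m hm => (hD t m hm).trans (hmax ht), fun j hj => (hU t j hj).trans (hmax ht)⟩⟩
  have h1 : ‖s t₁‖ ≤ 1 / 2 * ‖s t₁‖ + C * i.data := hC' i t₁ ht₁
  have h2 : ∀ t ∈ Set.Icc 0 c, ‖s t‖ ≤ 2 * C * i.data := fun t ht => by
    have : ‖s t‖ ≤ ‖s t₁‖ := hmax ht
    linarith
  exact fun t ht => ⟨fun m hm => (hD t m hm).trans (h2 t ht),
    fun j hj => (hU t j hj).trans (h2 t ht)⟩

end SystemCoercivity

/-! ### The Lagrange identity -/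

section Lagrange

variable {H : Type u} [NormedAddCommGroup H] [InnerProductSpace ℂ H] [CompleteSpace H]
  {Δ S : Set ℝ} {n : ℕ} {l : Expression H Δ n} {D U D' U' : ℕ → ℝ → H}

/-- The Lagrange form of two first order systems. -/
def systemForm (n : ℕ) (D U D' U' : ℕ → ℝ → H) (t : ℝ) : ℂ :=
  ∑ k ∈ Finset.range n, (⟪U' (n - 1 - k) t, D k t⟫_ℂ - ⟪D' k t, U (n - 1 - k) t⟫_ℂ)

/-- The mixed terms of the Lagrange identity. -/
def crossTerm (l : Expression H Δ n) (D D' : ℕ → ℝ → H) (t : ℝ) (k : ℕ) : ℂ :=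
  if 0 < k then Complex.I / 2 * (⟪l.q (n - k) t (D' (k - 1) t), D k t⟫_ℂ
    + ⟪D' k t, l.q (n - k) t (D (k - 1) t)⟫_ℂ) else 0

/-- The `p`-terms cancel by selfadjointness. The `q`- and `q^*`-terms pair up across neighbouring
values of `k`, so that they telescope in the sum over `k`. -/
theorem inner_coeffTerm_sub {t : ℝ} (ht : t ∈ Δ) (D D' : ℕ → ℝ → H) {k : ℕ} (hk : k ≤ n) :
    ⟪coeffTerm l (ContinuousLinearMap.id ℂ (H →L[ℂ] H)) D' (n - k) t, D k t⟫_ℂ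
      - ⟪D' k t, coeffTerm l (ContinuousLinearMap.id ℂ (H →L[ℂ] H)) D (n - k) t⟫_ℂ
      = crossTerm l D D' t k - if k < n then crossTerm l D D' t (k + 1) else 0 := by
  have hp : ∀ x y, ⟪l.p (n - k) t x, y⟫_ℂ = ⟪x, l.p (n - k) t y⟫_ℂ :=
    (l.isSelfAdjoint_p (n - k) (Nat.sub_le n k) t ht).isSymmetric
  have e1 : n - (n - k) = k := by omega
  have hI : (starRingEnd ℂ) (Complex.I / 2) = -(Complex.I / 2) := by
    rw [map_div₀, Complex.conj_I, map_ofNat, neg_div]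
  unfold coeffTerm crossTerm
  rw [e1]
  simp only [ContinuousLinearMap.id_apply, Nat.succ_pos, if_true, Nat.add_sub_cancel]
  by_cases h0 : 0 < k
  · by_cases hn : k < n
    · have e2 : n - k - 1 = n - (k + 1) := by omega
      simp only [h0, hn, show 0 < n - k by omega, show n - k < n by omega, if_true, e2,
        inner_add_left, inner_sub_left, inner_add_right, inner_sub_right, inner_smul_left,
        inner_smul_right, hI, hp, ContinuousLinearMap.adjoint_inner_left,
        ContinuousLinearMap.adjoint_inner_right]
      ring
    · obtain rfl : k = n := by omega
      simp only [h0, Nat.sub_self, lt_irrefl, if_true, if_false, add_zero, sub_zero,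
        inner_sub_left, inner_sub_right, inner_smul_left, inner_smul_right, hI] at hp ⊢
      rw [hp]
      ring
  · obtain rfl : k = 0 := by omega
    by_cases hn : 0 < n
    · simp only [Nat.sub_zero, lt_irrefl, hn, if_true, if_false, zero_add, sub_zero] at hp ⊢
      simp only [inner_add_left, inner_add_right, inner_smul_left,
        inner_smul_right, hI, hp, ContinuousLinearMap.adjoint_inner_left,
        ContinuousLinearMap.adjoint_inner_right]
      ring
    · obtain rfl : n = 0 := by omega
      simp only [Nat.sub_zero, lt_irrefl, if_false, add_zero, sub_zero] at hp ⊢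
      rw [hp, sub_self]

/-- The Lagrange identity. -/
theorem hasDerivWithinAt_systemForm (hS : S ⊆ Δ)
    (h : QuasiSystem l (ContinuousLinearMap.id ℂ (H →L[ℂ] H)) S D U)
    (h' : QuasiSystem l (ContinuousLinearMap.id ℂ (H →L[ℂ] H)) S D' U') {t : ℝ} (ht : t ∈ S) :
    HasDerivWithinAt (systemForm n D U D' U') (⟪D' 0 t, U n t⟫_ℂ - ⟪U' n t, D 0 t⟫_ℂ) S t := by
  have h1 : HasDerivWithinAt (systemForm n D U D' U') (∑ k ∈ Finset.range n,
      ((⟪U' (n - 1 - k) t, D (k + 1) t⟫_ℂ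
        + ⟪coeffTerm l (ContinuousLinearMap.id ℂ (H →L[ℂ] H)) D' (n - 1 - k + 1) t
          - U' (n - 1 - k + 1) t, D k t⟫_ℂ)
      - (⟪D' k t, coeffTerm l (ContinuousLinearMap.id ℂ (H →L[ℂ] H)) D (n - 1 - k + 1) t
          - U (n - 1 - k + 1) t⟫_ℂ + ⟪D' (k + 1) t, U (n - 1 - k) t⟫_ℂ))) S t := by
    refine HasDerivWithinAt.fun_sum fun k hk => ?_
    have hk := Finset.mem_range.mp hk
    exact ((h'.deriv_upper (n - 1 - k) (by omega) t ht).inner ℂ (h.deriv_lower k hk t ht)).sub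
      ((h'.deriv_lower k hk t ht).inner ℂ (h.deriv_upper (n - 1 - k) (by omega) t ht))
  refine h1.congr_deriv ?_
  -- The differentiated form is a sum of differences of `T` and of `crossTerm`. After telescoping,
  -- `T 0` carries `l[y]`, and `T n` cancels against `crossTerm` at `n` because `U 0` is itself the
  -- coefficient term.
  let T : ℕ → ℂ := fun k => ⟪U' (n - k) t, D k t⟫_ℂ - ⟪D' k t, U (n - k) t⟫_ℂ
  have h2 : ∀ k ∈ Finset.range n, ((⟪U' (n - 1 - k) t, D (k + 1) t⟫_ℂ
        + ⟪coeffTerm l (ContinuousLinearMap.id ℂ (H →L[ℂ] H)) D' (n - 1 - k + 1) t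
          - U' (n - 1 - k + 1) t, D k t⟫_ℂ)
      - (⟪D' k t, coeffTerm l (ContinuousLinearMap.id ℂ (H →L[ℂ] H)) D (n - 1 - k + 1) t
          - U (n - 1 - k + 1) t⟫_ℂ + ⟪D' (k + 1) t, U (n - 1 - k) t⟫_ℂ))
      = (T (k + 1) - T k) - (crossTerm l D D' t (k + 1) - crossTerm l D D' t k) := by
    intro k hk
    have hk := Finset.mem_range.mp hk
    have h3 := inner_coeffTerm_sub (l := l) (hS ht) D D' hk.le
    rw [if_pos hk] at h3
    rw [show n - 1 - k + 1 = n - k by omega, inner_sub_left, inner_sub_right]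
    simp only [T, show n - (k + 1) = n - 1 - k by omega]
    linear_combination h3
  rw [Finset.sum_congr rfl h2, Finset.sum_sub_distrib, Finset.sum_range_sub,
    Finset.sum_range_sub]
  have h4 := inner_coeffTerm_sub (l := l) (hS ht) D D' le_rfl
  rw [if_neg (lt_irrefl n), Nat.sub_self, ← h.upper_zero t ht, ← h'.upper_zero t ht] at h4
  have h5 : crossTerm l D D' t 0 = 0 := by simp [crossTerm]
  simp only [T, Nat.sub_self, Nat.sub_zero]
  linear_combination h4 + h5

theorem integral_lagrange {c : ℝ} (hc : 0 < c) (hS : Set.Icc 0 c ⊆ Δ)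
    (h : QuasiSystem l (ContinuousLinearMap.id ℂ (H →L[ℂ] H)) (Set.Icc 0 c) D U)
    (h' : QuasiSystem l (ContinuousLinearMap.id ℂ (H →L[ℂ] H)) (Set.Icc 0 c) D' U') :
    ∫ t in (0 : ℝ)..c, (⟪D' 0 t, U n t⟫_ℂ - ⟪U' n t, D 0 t⟫_ℂ)
      = systemForm n D U D' U' c - systemForm n D U D' U' 0 := by
  have hd := fun t (ht : t ∈ Set.Icc 0 c) => hasDerivWithinAt_systemForm hS h h' ht
  refine intervalIntegral.integral_eq_sub_of_hasDerivAt_of_le hc.le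
    (fun t ht => (hd t ht).continuousWithinAt)
    (fun t ht => (hd t (Set.Ioo_subset_Icc_self ht)).hasDerivAt (Icc_mem_nhds ht.1 ht.2))
    (ContinuousOn.intervalIntegrable ?_)
  rw [Set.uIcc_of_le hc.le]
  exact ((h'.continuousOn_D (Nat.zero_le n)).inner h.continuousOn_upper).sub
    (h'.continuousOn_upper.inner (h.continuousOn_D (Nat.zero_le n)))

end Lagrange

/-! ### Compactly supported elements of the minimal domain -/

section TestFunctions

variable {H : Type u} [NormedAddCommGroup H] [InnerProductSpace ℂ H] [CompleteSpace H]
  {Δ : Set ℝ} {n : ℕ} {l : Expression H Δ n} {c : ℝ}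

theorem IsHalfInterval.subset_Ici (h : IsHalfInterval Δ) : Δ ⊆ Set.Ici 0 := by
  rcases h with rfl | ⟨b, hb, rfl | rfl⟩
  · exact subset_rfl
  · exact Set.Ico_subset_Ici_self
  · exact Set.Icc_subset_Ici_self

theorem IsHalfInterval.Icc_subset (h : IsHalfInterval Δ) (hc : c ∈ Δ) : Set.Icc 0 c ⊆ Δ :=
  h.ordConnected.out h.zero_mem hc

theorem Icc_mem_nhdsWithin_of_lt (h : IsHalfInterval Δ) {t : ℝ} (ht : t < c) :
    Set.Icc 0 c ∈ 𝓝[Δ] t := by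
  filter_upwards [self_mem_nhdsWithin, mem_nhdsWithin_of_mem_nhds (Iio_mem_nhds ht)]
    with s hs hs'
  exact ⟨h.subset_Ici hs, hs'.le⟩

section

variable {E : Type*} [NormedAddCommGroup E] [NormedSpace ℝ E] {F F' : ℝ → E}

theorem hasDerivWithinAt_comp_min_of_lt (hΔ : IsHalfInterval Δ)
    {t : ℝ} (htc : t < c) {f' : E} (hF : HasDerivWithinAt F f' (Set.Icc 0 c) t) :
    HasDerivWithinAt (fun s => F (min s c)) f' Δ t := by
  have h1 : HasDerivWithinAt F f' Δ t :=
    hF.mono_of_mem_nhdsWithin (Icc_mem_nhdsWithin_of_lt hΔ htc)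
  refine h1.congr_of_eventuallyEq ?_ (by rw [min_eq_left htc.le])
  filter_upwards [Icc_mem_nhdsWithin_of_lt hΔ htc] with s hs
  rw [min_eq_left hs.2]

theorem hasDerivWithinAt_comp_min_of_gt {t : ℝ} (htc : c < t) :
    HasDerivWithinAt (fun s => F (min s c)) 0 Δ t := by
  refine (hasDerivWithinAt_const t Δ (F c)).congr_of_eventuallyEq ?_ (by rw [min_eq_right htc.le])
  filter_upwards [mem_nhdsWithin_of_mem_nhds (Ioi_mem_nhds htc)] with s hs
  rw [min_eq_right (Set.mem_Ioi.mp hs).le]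

/-- A function on `[0, c]` whose derivative vanishes at `c` extends by a constant. -/
theorem hasDerivWithinAt_comp_min (hΔ : IsHalfInterval Δ)
    (hF : ∀ t ∈ Set.Icc 0 c, HasDerivWithinAt F (F' t) (Set.Icc 0 c) t) (hF' : F' c = 0)
    {t : ℝ} (ht : t ∈ Δ) : HasDerivWithinAt (fun s => F (min s c)) (F' (min t c)) Δ t := by
  have ht0 : 0 ≤ t := hΔ.subset_Ici ht
  rcases lt_trichotomy t c with h | rfl | h
  · rw [min_eq_left h.le]
    exact hasDerivWithinAt_comp_min_of_lt hΔ h (hF t ⟨ht0, h.le⟩)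
  · rw [min_self]
    have h1 : HasDerivWithinAt (fun s => F (min s t)) (F' t) (Set.Icc 0 t) t :=
      (hF t ⟨ht0, le_rfl⟩).congr (fun s hs => by rw [min_eq_left hs.2]) (by rw [min_self])
    have h2 : HasDerivWithinAt (fun s => F (min s t)) (F' t) (Set.Ici t) t := by
      rw [hF']
      exact (hasDerivWithinAt_const t _ (F t)).congr
        (fun s hs => by rw [min_eq_right (Set.mem_Ici.mp hs)]) (by rw [min_self])
    refine (h1.union h2).mono fun s hs => ?_
    rcases le_total s t with h | h
    · exact Or.inl ⟨hΔ.subset_Ici hs, h⟩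
    · exact Or.inr h
  · rw [min_eq_right h.le, hF']
    exact hasDerivWithinAt_comp_min_of_gt h

end

theorem IsHalfInterval.mapsTo_min (hΔ : IsHalfInterval Δ) (hc : 0 < c) :
    Set.MapsTo (fun t => min t c) Δ (Set.Icc 0 c) := fun _ ht =>
  ⟨le_min (hΔ.subset_Ici ht) hc.le, min_le_right _ _⟩

theorem restrict_restrict_Icc (hΔ : IsHalfInterval Δ) (hc : c ∈ Δ) :
    (volume.restrict Δ).restrict (Set.Icc 0 c) = volume.restrict (Set.Icc 0 c) :=
  Measure.restrict_restrict_of_subset (hΔ.Icc_subset hc)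

omit [InnerProductSpace ℂ H] [CompleteSpace H] in
theorem memLp_of_continuousOn_Icc (hΔ : IsHalfInterval Δ) (hc : c ∈ Δ) {F : ℝ → H}
    (hF : ContinuousOn F (Set.Icc 0 c)) :
    MemLp F 2 ((volume.restrict Δ).restrict (Set.Icc 0 c)) := by
  obtain ⟨C, hC⟩ := isCompact_Icc.exists_bound_of_continuousOn hF
  rw [restrict_restrict_Icc hΔ hc]
  exact MemLp.of_bound (hF.aestronglyMeasurable measurableSet_Icc) C
    ((ae_restrict_mem measurableSet_Icc).mono hC)

omit [InnerProductSpace ℂ H] [CompleteSpace H] in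
theorem memLp_indicator_of_continuousOn_Icc (hΔ : IsHalfInterval Δ) (hc : c ∈ Δ) {F : ℝ → H}
    (hF : ContinuousOn F (Set.Icc 0 c)) :
    MemLp ((Set.Icc 0 c).indicator F) 2 (volume.restrict Δ) :=
  (memLp_indicator_iff_restrict measurableSet_Icc).mpr (memLp_of_continuousOn_Icc hΔ hc hF)

/-- A solution of `l[y] = f` on `[0, c]` with vanishing quasi-derivatives at both ends extends by
zero to an element of the domain of the minimal operator. -/
theorem exists_mem_minimalGraph (hΔ : IsHalfInterval Δ) (hn : 1 ≤ n) (hc : c ∈ Δ) (hc0 : 0 < c)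
    {D U : ℕ → ℝ → H}
    (h : QuasiSystem l (ContinuousLinearMap.id ℂ (H →L[ℂ] H)) (Set.Icc 0 c) D U)
    (hD0 : ∀ m < n, D m 0 = 0) (hU0 : ∀ j < n, U j 0 = 0)
    (hDc : ∀ m < n, D m c = 0) (hUc : ∀ j < n, U j c = 0) :
    ∃ x ∈ minimalGraph hΔ hn l, x.1 =ᵐ[volume.restrict Δ] (Set.Icc 0 c).indicator (D 0) ∧
      x.2 =ᵐ[volume.restrict Δ] (Set.Icc 0 c).indicator (U n) := by
  have hsub := hΔ.Icc_subset hc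
  have huniq := hΔ.uniqueDiffOn
  have hcc : c ∈ Set.Icc 0 c := ⟨hc0.le, le_rfl⟩
  have hDc' : ∀ m ≤ n, D m c = 0 := by
    intro m hm
    rcases hm.lt_or_eq with h1 | rfl
    · exact hDc m h1
    · rw [h.top_lower_eq hsub hn c hcc, hUc 0 (by omega), hDc (m - 1) (by omega)]
      simp
  -- Constant continuation past `c` is continuation by zero for these orders, since `D m` for `m ≤
  -- n` and `U j` for `j < n` vanish at `c`. `U n` need not vanish there, so the last
  -- quasi-derivative `Ue k` may fail to be differentiable at the single point `c`.
  let De : ℕ → ℝ → H := fun m t => D m (min t c)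
  let Ue : ℕ → ℝ → H := fun m t => U m (min t c)
  let Q : ℕ → ℝ → H := coeffTerm l (ContinuousLinearMap.id ℂ (H →L[ℂ] H)) D
  have hQc : ∀ j, Q j c = 0 := by
    intro j
    have h1 : Q j c = coeffTerm l (ContinuousLinearMap.id ℂ (H →L[ℂ] H)) 0 j c :=
      coeffTerm_congr hn rfl hDc'
    rw [h1]
    simp [coeffTerm]
  have hmaps := hΔ.mapsTo_min hc0
  have hmin : Continuous fun t : ℝ => min t c := by fun_prop
  have hQe : ∀ j, ∀ t ∈ Δ,
      coeffTerm l (ContinuousLinearMap.id ℂ (H →L[ℂ] H)) De j t = Q j (min t c) := by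
    intro j t ht
    rcases le_total t c with h1 | h1
    · exact coeffTerm_congr hn (min_eq_left h1).symm fun m _ => rfl
    · rw [min_eq_right h1, hQc]
      have h2 : coeffTerm l (ContinuousLinearMap.id ℂ (H →L[ℂ] H)) De j t
          = coeffTerm l (ContinuousLinearMap.id ℂ (H →L[ℂ] H)) 0 j t :=
        coeffTerm_congr hn rfl fun m hm => by
          simp only [De, min_eq_right h1, hDc' m hm, Pi.zero_apply]
      rw [h2]
      simp [coeffTerm]
  have hlower : ∀ m < n, ∀ t ∈ Δ, HasDerivWithinAt (De m) (De (m + 1) t) Δ t := fun m hm t ht =>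
    hasDerivWithinAt_comp_min hΔ (h.deriv_lower m hm) (hDc' (m + 1) hm) ht
  have hupper : ∀ j, j + 1 < n → ∀ t ∈ Δ, HasDerivWithinAt (Ue j)
      (coeffTerm l (ContinuousLinearMap.id ℂ (H →L[ℂ] H)) De (j + 1) t - Ue (j + 1) t) Δ t := by
    intro j hj t ht
    rw [hQe _ t ht]
    exact hasDerivWithinAt_comp_min hΔ (F' := fun t => Q (j + 1) t - U (j + 1) t)
      (h.deriv_upper j (by omega)) (by rw [hQc, hUc _ hj, sub_zero]) ht
  have hzero : ∀ t ∈ Δ, Ue 0 t = coeffTerm l (ContinuousLinearMap.id ℂ (H →L[ℂ] H)) De 0 t :=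
    fun t ht => by rw [hQe 0 t ht]; exact h.upper_zero _ (hmaps ht)
  have hquasiD : ∀ k < n, ∀ t ∈ Δ, vecQuasiDeriv l (De 0) k t = De k t := fun k hk =>
    quasiDeriv_lower huniq hlower hk
  have hquasiU : ∀ j < n, ∀ t ∈ Δ, vecQuasiDeriv l (De 0) (n + j) t = Ue j t := by
    intro j hj t ht
    rw [vecQuasiDeriv, quasiDeriv_upper]
    exact upperQuasiDeriv_eq hn huniq hlower hzero (fun i hi => hupper i (by omega)) t ht
  have hcomp : ∀ {F : ℝ → H}, ContinuousOn F (Set.Icc 0 c) →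
      ContinuousOn (fun t => F (min t c)) Δ := fun hF => hF.comp hmin.continuousOn hmaps
  obtain ⟨k, rfl⟩ : ∃ k, n = k + 1 := ⟨n - 1, by omega⟩
  have htop : ∀ t ∈ Δ, vecQuasiDeriv l (De 0) (2 * (k + 1) - 1) t = Ue k t := by
    intro t ht
    rw [show 2 * (k + 1) - 1 = k + 1 + k by omega]
    exact hquasiU k (by omega) t ht
  have hderiv_lt : ∀ t ∈ Δ, t < c →
      HasDerivWithinAt (Ue k) (Q (k + 1) t - U (k + 1) t) Δ t := fun t ht htc =>
    hasDerivWithinAt_comp_min_of_lt hΔ htc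
      (h.deriv_upper k (by omega) t ⟨hΔ.subset_Ici ht, htc.le⟩)
  have hderiv_gt : ∀ t, c < t → HasDerivWithinAt (Ue k) 0 Δ t := fun t htc =>
    hasDerivWithinAt_comp_min_of_gt htc
  have hne : ∀ᵐ t ∂(volume.restrict Δ), t ≠ c := by
    have h1 : ∀ᵐ t : ℝ, t ≠ c := by
      rw [ae_iff]
      simp
    exact ae_restrict_of_ae h1
  have hmem : ∀ᵐ t ∂(volume.restrict Δ), t ∈ Δ := ae_restrict_mem hΔ.ordConnected.measurableSet
  have hdom : InDomain l (De 0) := by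
    refine ⟨fun i hi => ?_, fun t ht => ?_, ?_⟩
    · rcases lt_or_ge i (k + 1) with hik | hik
      · exact .of_hasDerivWithinAt huniq (hquasiD i hik) (hlower i hik)
          (hcomp (h.continuousOn_D hik))
      · obtain ⟨j, rfl⟩ := Nat.exists_eq_add_of_le hik
        refine .of_hasDerivWithinAt huniq (hquasiU j (by omega)) (hupper j (by omega)) ?_
        have h1 : ContinuousOn (fun t => Q (j + 1) t - U (j + 1) t) (Set.Icc 0 c) :=
          (continuousOn_coeffTerm hsub (fun m hm => h.continuousOn_D hm) (by omega)).sub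
            (h.continuousOn_U (by omega))
        exact (hcomp h1).congr fun t ht => by rw [hQe _ t ht]
    · have hcont : ContinuousOn (fun t => Q (k + 1) t - U (k + 1) t) (Set.Icc 0 c) :=
        (continuousOn_coeffTerm hsub (fun m hm => h.continuousOn_D hm) le_rfl).sub
          h.continuousOn_upper
      -- Despite the possible corner at `c`, the bounded derivative on `[0, c]` makes the continued
      -- function Lipschitz, hence absolutely continuous.
      obtain ⟨C, hC⟩ := isCompact_Icc.exists_bound_of_continuousOn hcont
      have h1 : LipschitzOnWith (Real.toNNReal C) (U k) (Set.Icc 0 c) :=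
        (convex_Icc 0 c).lipschitzOnWith_of_nnnorm_hasDerivWithin_le
          (h.deriv_upper k (by omega)) fun t ht => by
            rw [← NNReal.coe_le_coe, coe_nnnorm]
            exact (hC t ht).trans (Real.le_coe_toNNReal C)
      have h2 : LipschitzOnWith (Real.toNNReal C * 1) (Ue k) Δ :=
        h1.comp (LipschitzWith.id.min_const c).lipschitzOnWith hmaps
      refine LipschitzOnWith.absolutelyContinuousOnInterval (K := Real.toNNReal C * 1) ?_
      have hsub' : Set.uIcc 0 t ⊆ Δ := hΔ.ordConnected.uIcc_subset hΔ.zero_mem ht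
      intro s hs r hr
      rw [htop s (hsub' hs), htop r (hsub' hr)]
      exact h2 (hsub' hs) (hsub' hr)
    · filter_upwards [hne, hmem] with t htc ht
      rcases lt_or_gt_of_ne htc with h1 | h1
      · exact (hderiv_lt t ht h1).differentiableWithinAt.congr htop (htop t ht)
      · exact (hderiv_gt t h1).differentiableWithinAt.congr htop (htop t ht)
  have hy : De 0 =ᵐ[volume.restrict Δ] (Set.Icc 0 c).indicator (D 0) := by
    filter_upwards [hmem] with t ht
    rcases le_or_gt t c with h1 | h1
    · rw [Set.indicator_of_mem (show t ∈ Set.Icc 0 c from ⟨hΔ.subset_Ici ht, h1⟩)]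
      simp only [De, min_eq_left h1]
    · rw [Set.indicator_of_notMem fun h2 : t ∈ Set.Icc 0 c => h1.not_ge h2.2]
      simp only [De, min_eq_right h1.le, hDc' 0 (Nat.zero_le _)]
  have hly : vecQuasiDeriv l (De 0) (2 * (k + 1))
      =ᵐ[volume.restrict Δ] (Set.Icc 0 c).indicator (U (k + 1)) := by
    filter_upwards [hne, hmem] with t htc ht
    have e1 : upperQuasiDeriv l (ContinuousLinearMap.id ℂ (H →L[ℂ] H)) (De 0) (k + 1) t
        = Q (k + 1) (min t c) - derivWithin (Ue k) Δ t := by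
      have h1 : ∀ s ∈ Δ, upperQuasiDeriv l (ContinuousLinearMap.id ℂ (H →L[ℂ] H)) (De 0) k s
          = Ue k s := fun s hs => by
        have := hquasiU k (by omega) s hs
        rwa [vecQuasiDeriv, quasiDeriv_upper] at this
      simp only [upperQuasiDeriv]
      rw [derivWithin_congr h1 (h1 t ht), ← hQe _ t ht]
      congr 1
      exact coeffTerm_congr (D := fun m => iteratedDerivWithin m (De 0) Δ) hn rfl
        fun m hm => iteratedDerivWithin_eq_of_hasDerivWithinAt huniq hlower hm t ht
    rw [vecQuasiDeriv, show 2 * (k + 1) = k + 1 + (k + 1) by omega, quasiDeriv_upper, e1]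
    rcases lt_or_gt_of_ne htc with h1 | h1
    · rw [Set.indicator_of_mem (show t ∈ Set.Icc 0 c from ⟨hΔ.subset_Ici ht, h1.le⟩),
        (hderiv_lt t ht h1).derivWithin (huniq t ht), min_eq_left h1.le, sub_sub_cancel]
    · rw [Set.indicator_of_notMem fun h2 : t ∈ Set.Icc 0 c => h1.not_ge h2.2,
        (hderiv_gt t h1).derivWithin (huniq t ht), min_eq_right h1.le, hQc, sub_zero]
  have hy' := memLp_indicator_of_continuousOn_Icc hΔ hc (h.continuousOn_D (Nat.zero_le _))
  have hly' := memLp_indicator_of_continuousOn_Icc hΔ hc h.continuousOn_upper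
  refine ⟨(hy'.toLp _, hly'.toLp _), ⟨De 0, ⟨hdom, hy'.coeFn_toLp.trans hy.symm,
    hly'.coeFn_toLp.trans hly.symm⟩, fun i hi => ?_, fun w _ => ?_⟩, hy'.coeFn_toLp,
    hly'.coeFn_toLp⟩
  · rcases lt_or_ge i (k + 1) with hik | hik
    · rw [hquasiD i hik 0 hΔ.zero_mem]
      simp only [De, min_eq_left hc0.le, hD0 i hik]
    · obtain ⟨j, rfl⟩ := Nat.exists_eq_add_of_le hik
      rw [hquasiU j (by omega) 0 hΔ.zero_mem]
      simp only [Ue, min_eq_left hc0.le, hU0 j (by omega)]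
  -- From `c` on, all quasi-derivatives in the form vanish, so the condition at the right end holds
  -- against every function.
  · refine tendsto_const_nhds.congr' ?_
    rw [EventuallyEq, rightEnd, eventually_map]
    filter_upwards [eventually_ge_atTop (⟨c, hc⟩ : Δ)] with t ht
    have ht' : c ≤ (t : ℝ) := ht
    symm
    refine Finset.sum_eq_zero fun i hi => ?_
    have hi := Finset.mem_range.mp hi
    rw [hquasiD i hi t t.2, show 2 * (k + 1) - 1 - i = k + 1 + (k - i) by omega,
      hquasiU (k - i) (by omega) t t.2]
    simp only [De, Ue, min_eq_right ht', hDc i hi, hUc (k - i) (by omega), inner_zero_right,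
      sub_self]

end TestFunctions

/-! ### Orthogonality to solutions and the adjoint of the minimal operator -/

section Fundamental

variable {H : Type u} [NormedAddCommGroup H] [InnerProductSpace ℂ H] [CompleteSpace H]
  {Δ : Set ℝ} {n : ℕ} {l : Expression H Δ n} {c : ℝ} {z : ℂ}

theorem QuasiSystem.apply {S : Set ℝ} {K : Type*} [NormedAddCommGroup K] [NormedSpace ℂ K]
    {D U : ℕ → ℝ → K →L[ℂ] H} (h : QuasiSystem l (ContinuousLinearMap.compL ℂ K H H) S D U)
    (x : K) : QuasiSystem l (ContinuousLinearMap.id ℂ (H →L[ℂ] H)) S (fun m s => D m s x)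
      (fun j s => U j s x) :=
  h.map (Φ := ContinuousLinearMap.apply ℂ H x) fun _ _ => rfl

/-- The solution operators of the Cauchy problem at `0` for `l[y] = z y`. -/
structure FundamentalSystem (l : Expression H Δ n) (z : ℂ)
    (D U : ℕ → ℝ → StateSpace H n →L[ℂ] H) : Prop where
  quasiSystem : QuasiSystem l (ContinuousLinearMap.compL ℂ (StateSpace H n) H H) Δ D U
  top_eq : ∀ t ∈ Δ, U n t = z • D 0 t
  lower_zero : ∀ m < n, D m 0 = lowerProj H n m
  upper_zero : ∀ j < n, U j 0 = upperProj H n j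

theorem exists_fundamentalSystem (hΔ : IsHalfInterval Δ) (hn : 1 ≤ n) (l : Expression H Δ n)
    (z : ℂ) : ∃ D U, FundamentalSystem l z D U := by
  obtain ⟨D, U, h, h1, h2, h3⟩ := exists_quasiSystem hΔ hn l z (G := fun _ => 0)
    continuousOn_const hΔ.zero_mem (ContinuousLinearMap.id ℂ (StateSpace H n))
  exact ⟨D, U, h, fun t ht => by rw [h1 t ht, add_zero], fun m hm => h2 m hm,
    fun j hj => h3 j hj⟩

/-- The class in `L₂(0, c)` of a function that is continuous on `[0, c]`. -/
def localLp (hΔ : IsHalfInterval Δ) (hc : c ∈ Δ) {F : ℝ → H}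
    (hF : ContinuousOn F (Set.Icc 0 c)) :
    Lp H 2 ((volume.restrict Δ).restrict (Set.Icc 0 c)) :=
  (memLp_of_continuousOn_Icc hΔ hc hF).toLp F

omit [InnerProductSpace ℂ H] [CompleteSpace H] in
theorem coeFn_localLp (hΔ : IsHalfInterval Δ) (hc : c ∈ Δ) {F : ℝ → H}
    (hF : ContinuousOn F (Set.Icc 0 c)) :
    localLp hΔ hc hF =ᵐ[(volume.restrict Δ).restrict (Set.Icc 0 c)] F :=
  (memLp_of_continuousOn_Icc hΔ hc hF).coeFn_toLp

/-- Restriction of the elements of `L₂(Δ; H)` to `[0, c]`. -/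
def localRestrict (H : Type u) [NormedAddCommGroup H] [InnerProductSpace ℂ H] (Δ : Set ℝ)
    (c : ℝ) : L2 H Δ →L[ℂ] Lp H 2 ((volume.restrict Δ).restrict (Set.Icc 0 c)) :=
  LpToLpRestrictCLM ℝ H ℂ (volume.restrict Δ) 2 (Set.Icc 0 c)

omit [CompleteSpace H] in
theorem coeFn_localRestrict (y : L2 H Δ) :
    localRestrict H Δ c y =ᵐ[(volume.restrict Δ).restrict (Set.Icc 0 c)] y :=
  LpToLpRestrictCLM_coeFn ℂ (Set.Icc 0 c) y

-- Hölder's inequality on a set of finite measure; it turns the `L₁` data of the a priori estimate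
-- into `L₂`-norms.
omit [InnerProductSpace ℂ H] [CompleteSpace H] in
theorem integral_norm_le_localLp (hΔ : IsHalfInterval Δ) (hc : c ∈ Δ) (hc0 : 0 < c) :
    ∃ C : ℝ, 0 ≤ C ∧ ∀ (F : ℝ → H) (hF : ContinuousOn F (Set.Icc 0 c)),
      ∫ t in (0 : ℝ)..c, ‖F t‖ ≤ C * ‖localLp hΔ hc hF‖ := by
  set μ := (volume.restrict Δ).restrict (Set.Icc 0 c) with hμ
  have hμ' : μ = volume.restrict (Set.Icc 0 c) := restrict_restrict_Icc hΔ hc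
  have hfin : IsFiniteMeasure μ := by
    rw [hμ']
    infer_instance
  refine ⟨(μ Set.univ ^ (1 / (1 : ENNReal).toReal - 1 / (2 : ENNReal).toReal)).toReal,
    ENNReal.toReal_nonneg, fun F hF => ?_⟩
  have hm := memLp_of_continuousOn_Icc hΔ hc hF
  have h1 := eLpNorm_le_eLpNorm_mul_rpow_measure_univ (p := 1) (q := 2) (by norm_num) hm.1
  rw [intervalIntegral.integral_of_le hc0.le, ← integral_Icc_eq_integral_Ioc, ← hμ',
    integral_norm_eq_lintegral_enorm hm.1, ← eLpNorm_one_eq_lintegral_enorm, localLp,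
    Lp.norm_toLp, mul_comm, ← ENNReal.toReal_mul]
  refine ENNReal.toReal_mono (ENNReal.mul_ne_top hm.2.ne ?_) h1
  exact ENNReal.rpow_ne_top_of_nonneg (by norm_num) (measure_ne_top _ _)

omit [CompleteSpace H] in
theorem inner_localLp_eq_integral (hΔ : IsHalfInterval Δ) (hc : c ∈ Δ) (hc0 : 0 < c)
    {F G : ℝ → H} (hF : ContinuousOn F (Set.Icc 0 c)) (hG : ContinuousOn G (Set.Icc 0 c)) :
    ⟪localLp hΔ hc hF, localLp hΔ hc hG⟫_ℂ = ∫ t in (0 : ℝ)..c, ⟪F t, G t⟫_ℂ := by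
  rw [L2.inner_def, intervalIntegral.integral_of_le hc0.le, ← integral_Icc_eq_integral_Ioc,
    ← restrict_restrict_Icc hΔ hc]
  refine integral_congr_ae ?_
  filter_upwards [coeFn_localLp hΔ hc hF, coeFn_localLp hΔ hc hG] with t h1 h2
  rw [h1, h2]

omit [CompleteSpace H] in
theorem inner_eq_inner_localRestrict (hΔ : IsHalfInterval Δ) (hc : c ∈ Δ) {F : ℝ → H}
    (hF : ContinuousOn F (Set.Icc 0 c)) {x : L2 H Δ}
    (hx : x =ᵐ[volume.restrict Δ] (Set.Icc 0 c).indicator F) (y : L2 H Δ) :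
    ⟪x, y⟫_ℂ = ⟪localLp hΔ hc hF, localRestrict H Δ c y⟫_ℂ := by
  have h1 : ⟪x, y⟫_ℂ = ∫ t, (Set.Icc 0 c).indicator (fun t => ⟪F t, y t⟫_ℂ) t
      ∂(volume.restrict Δ) := by
    rw [L2.inner_def]
    refine integral_congr_ae ?_
    filter_upwards [hx] with t ht
    rw [ht]
    by_cases h : t ∈ Set.Icc 0 c
    · rw [Set.indicator_of_mem h, Set.indicator_of_mem h]
    · rw [Set.indicator_of_notMem h, Set.indicator_of_notMem h, inner_zero_left]
  rw [h1, integral_indicator measurableSet_Icc, L2.inner_def]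
  refine integral_congr_ae ?_
  filter_upwards [coeFn_localLp hΔ hc hF, coeFn_localRestrict (c := c) y] with t h2 h3
  rw [h2, h3]

/-- A continuous function on `[0, c]` orthogonal to the solutions of `l[w] = z w` is orthogonal
to `Ker (L₀^* - z)`. -/
theorem FundamentalSystem.inner_localRestrict_eq_zero (hΔ : IsHalfInterval Δ) (hn : 1 ≤ n)
    (hc : c ∈ Δ) (hc0 : 0 < c) {D U : ℕ → ℝ → StateSpace H n →L[ℂ] H}
    (hs : FundamentalSystem l z D U) {y : L2 H Δ}
    (hy : y ∈ defectSpace (minimalGraph hΔ hn l) z) {f : ℝ → H}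
    (hf : ContinuousOn f (Set.Icc 0 c))
    (horth : ∀ x, ∫ t in (0 : ℝ)..c, ⟪D 0 t x, f t⟫_ℂ = 0) :
    ⟪localLp hΔ hc hf, localRestrict H Δ c y⟫_ℂ = 0 := by
  have hsub := hΔ.Icc_subset hc
  have hmin : ContinuousOn (fun t => f (min t c)) Δ :=
    hf.comp (by fun_prop) (hΔ.mapsTo_min hc0)
  -- Solve `l[d] = z̄ d + f` with zero data at `c`, as an operator problem on `ℂ` evaluated at `1`.
  -- Beyond `c` the function `f` is continued only to be continuous on `Δ`.
  obtain ⟨P, R, hPR, hRn, hPc, hRc⟩ := exists_quasiSystem hΔ hn l (starRingEnd ℂ z) (K := ℂ)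
    (G := fun t => ContinuousLinearMap.smulRightL ℂ ℂ H 1 (f (min t c)))
    ((ContinuousLinearMap.continuous _).comp_continuousOn hmin) hc 0
  have hsys := (hPR.apply 1).mono hsub
  set d : ℕ → ℝ → H := fun m s => P m s 1
  set w : ℕ → ℝ → H := fun m s => R m s 1
  have hwn : ∀ t ∈ Set.Icc 0 c, w n t = starRingEnd ℂ z • d 0 t + f t := by
    intro t ht
    simp [w, d, hRn t (hsub ht), min_eq_left ht.2]
  have hdc : ∀ m < n, d m c = 0 := fun m hm => by simp [d, hPc m hm]
  have hwc : ∀ j < n, w j c = 0 := fun j hj => by simp [w, hRc j hj]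
  have hform : ∀ x, systemForm n d w (fun m s => D m s x) (fun m s => U m s x) 0 = 0 := by
    intro x
    have hx := (hs.quasiSystem.apply x).mono hsub
    have h1 := integral_lagrange hc0 hsub hsys hx
    have h2 : systemForm n d w (fun m s => D m s x) (fun m s => U m s x) c = 0 := by
      refine Finset.sum_eq_zero fun k hk => ?_
      have hk := Finset.mem_range.mp hk
      rw [hdc k hk, hwc (n - 1 - k) (by omega)]
      simp
    rw [h2, zero_sub] at h1
    rw [← neg_eq_zero, ← h1, ← horth x]
    refine intervalIntegral.integral_congr fun t ht => ?_
    rw [Set.uIcc_of_le hc0.le] at ht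
    simp only [hs.top_eq t (hsub ht), hwn t ht, inner_add_right, inner_smul_right,
      smul_apply, inner_smul_left]
    ring
  have hzero : ∀ k < n, d k 0 = 0 ∧ w (n - 1 - k) 0 = 0 := by
    -- The form at `0` is a nondegenerate pairing of states. With this initial state it becomes the
    -- sum of the squared norms of all data of `d` at `0`.
    let x : StateSpace H n := (fun k => -w (n - 1 - k) 0, fun j => d (n - 1 - j) 0)
    have h1 := hform x
    have h2 : ∀ k ∈ Finset.range n, (⟪U (n - 1 - k) 0 x, d k 0⟫_ℂ
        - ⟪D k 0 x, w (n - 1 - k) 0⟫_ℂ)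
        = ((‖d k 0‖ ^ 2 + ‖w (n - 1 - k) 0‖ ^ 2 : ℝ) : ℂ) := by
      intro k hk
      have hk := Finset.mem_range.mp hk
      rw [hs.lower_zero k hk, hs.upper_zero (n - 1 - k) (by omega), lowerProj_apply hk,
        upperProj_apply (show n - 1 - k < n by omega)]
      simp only [x, show n - 1 - (n - 1 - k) = k by omega, inner_neg_left, sub_neg_eq_add,
        inner_self_eq_norm_sq_to_K]
      push_cast
      rfl
    rw [systemForm, Finset.sum_congr rfl h2, ← Complex.ofReal_sum, Complex.ofReal_eq_zero,
      Finset.sum_eq_zero_iff_of_nonneg fun _ _ => by positivity] at h1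
    intro k hk
    have h3 := h1 k (Finset.mem_range.mpr hk)
    constructor
    · have : ‖d k 0‖ ^ 2 = 0 := by nlinarith [sq_nonneg ‖d k 0‖, sq_nonneg ‖w (n - 1 - k) 0‖]
      simpa using this
    · have : ‖w (n - 1 - k) 0‖ ^ 2 = 0 := by
        nlinarith [sq_nonneg ‖d k 0‖, sq_nonneg ‖w (n - 1 - k) 0‖]
      simpa using this
  obtain ⟨⟨x₁, x₂⟩, hx, hx1, hx2⟩ := exists_mem_minimalGraph hΔ hn hc hc0 hsys
    (fun m hm => (hzero m hm).1) (fun j hj => by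
      have := (hzero (n - 1 - j) (by omega)).2
      rwa [show n - 1 - (n - 1 - j) = j by omega] at this) hdc hwc
  -- The adjoint relation reads `⟪l[d], y⟫ = ⟪d, z y⟫`; the terms with `z` cancel and `⟪f, y⟫ = 0`
  -- remains.
  have hadj := (Submodule.mem_adjoint_iff _ _).mp hy x₁ x₂ hx
  have hd0 := hsys.continuousOn_D (Nat.zero_le n)
  have hwn' := hsys.continuousOn_upper
  rw [inner_eq_inner_localRestrict hΔ hc hwn' hx2, inner_smul_right,
    inner_eq_inner_localRestrict hΔ hc hd0 hx1] at hadj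
  have hsum : localLp hΔ hc hwn' = starRingEnd ℂ z • localLp hΔ hc hd0 + localLp hΔ hc hf := by
    refine Lp.ext ?_
    have hmem : ∀ᵐ t ∂((volume.restrict Δ).restrict (Set.Icc 0 c)), t ∈ Set.Icc 0 c :=
      ae_restrict_mem measurableSet_Icc
    filter_upwards [coeFn_localLp hΔ hc hwn', coeFn_localLp hΔ hc hd0, coeFn_localLp hΔ hc hf,
      Lp.coeFn_add (starRingEnd ℂ z • localLp hΔ hc hd0) (localLp hΔ hc hf),
      Lp.coeFn_smul (starRingEnd ℂ z) (localLp hΔ hc hd0), hmem] with t h1 h2 h3 h4 h5 h6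
    rw [h1, h4, Pi.add_apply, h5, Pi.smul_apply, h2, h3, hwn t h6]
  rw [hsum, inner_add_left, inner_smul_left, Complex.conj_conj] at hadj
  linear_combination hadj

end Fundamental

/-! ### Elements of the defect spaces are classical solutions -/

section Representation

variable {H : Type u} [NormedAddCommGroup H] [InnerProductSpace ℂ H] [CompleteSpace H]
  {Δ : Set ℝ} {n : ℕ} {l : Expression H Δ n} {c : ℝ} {z : ℂ}
  {D U : ℕ → ℝ → StateSpace H n →L[ℂ] H}

theorem FundamentalSystem.continuousOn_apply (hs : FundamentalSystem l z D U)
    (hΔ : IsHalfInterval Δ) (hc : c ∈ Δ) (x : StateSpace H n) :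
    ContinuousOn (fun t => D 0 t x) (Set.Icc 0 c) :=
  ((hs.quasiSystem.apply x).continuousOn_D (Nat.zero_le n)).mono (hΔ.Icc_subset hc)

/-- The operator that takes a state at `0` to the solution of `l[y] = z y` on `[0, c]` is bounded
and bounded below. -/
theorem FundamentalSystem.exists_solutionMap (hs : FundamentalSystem l z D U)
    (hΔ : IsHalfInterval Δ) (hn : 1 ≤ n) (hc : c ∈ Δ) (hc0 : 0 < c) :
    ∃ V : StateSpace H n →L[ℂ] Lp H 2 ((volume.restrict Δ).restrict (Set.Icc 0 c)),
      (∀ x, V x = localLp hΔ hc (hs.continuousOn_apply hΔ hc x)) ∧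
      ∃ C : NNReal, AntilipschitzWith C V := by
  have hsub := hΔ.Icc_subset hc
  set μ := (volume.restrict Δ).restrict (Set.Icc 0 c) with hμ
  have hμ' : μ = volume.restrict (Set.Icc 0 c) := restrict_restrict_Icc hΔ hc
  have hfin : IsFiniteMeasure μ := by
    rw [hμ']
    infer_instance
  have hmem : ∀ᵐ t ∂μ, t ∈ Set.Icc 0 c := ae_restrict_mem measurableSet_Icc
  obtain ⟨B, hB⟩ := isCompact_Icc.exists_bound_of_continuousOn
    ((hs.quasiSystem.continuousOn_D (Nat.zero_le n)).mono hsub)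
  have hB0 : 0 ≤ B := (norm_nonneg _).trans (hB 0 ⟨le_rfl, hc0.le⟩)
  let V₀ : StateSpace H n →ₗ[ℂ] Lp H 2 μ :=
    { toFun := fun x => localLp hΔ hc (hs.continuousOn_apply hΔ hc x)
      map_add' := fun x y => by
        refine Lp.ext ?_
        filter_upwards [coeFn_localLp hΔ hc (hs.continuousOn_apply hΔ hc (x + y)),
          coeFn_localLp hΔ hc (hs.continuousOn_apply hΔ hc x),
          coeFn_localLp hΔ hc (hs.continuousOn_apply hΔ hc y),
          Lp.coeFn_add (localLp hΔ hc (hs.continuousOn_apply hΔ hc x))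
            (localLp hΔ hc (hs.continuousOn_apply hΔ hc y))] with t h1 h2 h3 h4
        rw [h1, h4, Pi.add_apply, h2, h3, map_add]
      map_smul' := fun a x => by
        refine Lp.ext ?_
        filter_upwards [coeFn_localLp hΔ hc (hs.continuousOn_apply hΔ hc (a • x)),
          coeFn_localLp hΔ hc (hs.continuousOn_apply hΔ hc x),
          Lp.coeFn_smul a (localLp hΔ hc (hs.continuousOn_apply hΔ hc x))] with t h1 h2 h3
        rw [h1, RingHom.id_apply, h3, Pi.smul_apply, h2, map_smul] }
  have hV₀ : ∀ x, ‖V₀ x‖ ≤ (measureUnivNNReal μ : ℝ) ^ (2 : ENNReal).toReal⁻¹ * B * ‖x‖ := by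
    intro x
    rw [mul_assoc]
    refine Lp.norm_le_of_ae_bound (by positivity) ?_
    filter_upwards [coeFn_localLp hΔ hc (hs.continuousOn_apply hΔ hc x), hmem] with t h1 h2
    change ‖(localLp hΔ hc (hs.continuousOn_apply hΔ hc x) : ℝ → H) t‖ ≤ _
    rw [h1]
    exact (D 0 t).le_of_opNorm_le (hB t h2) x
  obtain ⟨C, hC, hbound⟩ := exists_quasiSystem_bound hc0 hn hsub l
  obtain ⟨C', hC', hint⟩ := integral_norm_le_localLp (H := H) hΔ hc hc0
  -- The lower bound is the a priori estimate at `t = 0`, where the quasi-derivatives are the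
  -- components of `x`. The factor `1 + ‖z‖` comes from `l[y] = z y`.
  refine ⟨V₀.mkContinuous _ hV₀, fun x => rfl, Real.toNNReal (C * ((1 + ‖z‖) * C')), ?_⟩
  refine ContinuousLinearMap.antilipschitz_of_bound _ fun x => ?_
  rw [Real.coe_toNNReal _ (by positivity)]
  have hsys := (hs.quasiSystem.apply x).mono hsub
  have h1 : ∫ t in (0 : ℝ)..c, ‖U n t x‖ = ‖z‖ * ∫ t in (0 : ℝ)..c, ‖D 0 t x‖ := by
    rw [← intervalIntegral.integral_const_mul]
    refine intervalIntegral.integral_congr fun t ht => ?_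
    rw [Set.uIcc_of_le hc0.le] at ht
    simp only [hs.top_eq t (hsub ht), smul_apply, norm_smul]
  have h2 := hint _ (hs.continuousOn_apply hΔ hc x)
  have h3 := hbound _ _ hsys 0 ⟨le_rfl, hc0.le⟩
  simp only [h1] at h3
  have h4 : C * ((∫ t in (0 : ℝ)..c, ‖D 0 t x‖) + ‖z‖ * ∫ t in (0 : ℝ)..c, ‖D 0 t x‖)
      ≤ C * ((1 + ‖z‖) * C') * ‖V₀ x‖ := by
    have h5 : (∫ t in (0 : ℝ)..c, ‖D 0 t x‖) + ‖z‖ * ∫ t in (0 : ℝ)..c, ‖D 0 t x‖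
        ≤ (1 + ‖z‖) * (C' * ‖V₀ x‖) := by
      rw [← one_add_mul]
      exact mul_le_mul_of_nonneg_left h2 (by positivity)
    calc _ ≤ C * ((1 + ‖z‖) * (C' * ‖V₀ x‖)) := mul_le_mul_of_nonneg_left h5 hC
      _ = _ := by ring
  refine le_trans ?_ h4
  have h6 := (norm_nonneg _).trans (h3.1 0 (by omega))
  rw [Prod.norm_def]
  refine max_le ((pi_norm_le_iff_of_nonneg h6).mpr fun m => ?_)
    ((pi_norm_le_iff_of_nonneg h6).mpr fun j => ?_)
  · have := h3.1 m m.2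
    rwa [hs.lower_zero m m.2, lowerProj_apply m.2] at this
  · have := h3.2 j j.2
    rwa [hs.upper_zero j j.2, upperProj_apply j.2] at this

/-- The elements of `Ker (L₀^* - z)` are solutions of `l[y] = z y` on `[0, c]`. -/
theorem FundamentalSystem.localRestrict_mem_range (hs : FundamentalSystem l z D U)
    (hΔ : IsHalfInterval Δ) (hn : 1 ≤ n) (hc : c ∈ Δ) (hc0 : 0 < c) {y : L2 H Δ}
    (hy : y ∈ defectSpace (minimalGraph hΔ hn l) z) :
    ∃ x, localRestrict H Δ c y = localLp hΔ hc (hs.continuousOn_apply hΔ hc x) := by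
  set μ := (volume.restrict Δ).restrict (Set.Icc 0 c) with hμ
  have hμ' : μ = volume.restrict (Set.Icc 0 c) := restrict_restrict_Icc hΔ hc
  have hfin : IsFiniteMeasure μ := by
    rw [hμ']
    infer_instance
  obtain ⟨V, hV, C, hC⟩ := hs.exists_solutionMap hΔ hn hc hc0
  have hclosed : IsClosed (V.range : Set (Lp H 2 μ)) := by
    rw [LinearMap.coe_range]
    exact hC.isClosed_range V.uniformContinuous
  have : CompleteSpace V.range := hclosed.completeSpace_coe
  set P := V.range.starProjection with hP
  have horth : ∀ x, x - P x ∈ V.rangeᗮ := fun x => V.range.sub_starProjection_mem_orthogonal x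
  have hall : ∀ x : Lp H 2 μ, ⟪x - P x, localRestrict H Δ c y⟫_ℂ = 0 := by
    have hcl : IsClosed {x : Lp H 2 μ | ⟪x - P x, localRestrict H Δ c y⟫_ℂ = 0} :=
      isClosed_eq (by fun_prop) continuous_const
    -- For continuous `g` the difference `g - P g` is again continuous, because `P g` is a solution.
    -- The orthogonality lemma applies to it, and density gives all of `L₂`.
    have hdense := Lp.boundedContinuousFunction_dense H μ (p := 2) (by norm_num)
    intro x
    refine hcl.closure_subset_iff.mpr ?_ (hdense x)
    intro g hg
    obtain ⟨g₀, hg₀⟩ := Lp.mem_boundedContinuousFunction_iff.mp hg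
    have hgae : g =ᵐ[μ] g₀ := by
      rw [← hg₀]
      exact ContinuousMap.coeFn_toAEEqFun _ _
    obtain ⟨x', hx'⟩ : P g ∈ V.range := V.range.starProjection_apply_mem g
    have hf : ContinuousOn (fun t => g₀ t - D 0 t x') (Set.Icc 0 c) :=
      g₀.continuous.continuousOn.sub (hs.continuousOn_apply hΔ hc x')
    have hgP : g - P g = localLp hΔ hc hf := by
      refine Lp.ext ?_
      have hPg : P g = localLp hΔ hc (hs.continuousOn_apply hΔ hc x') := by
        rw [← hx', ← hV x']
        rfl
      filter_upwards [Lp.coeFn_sub g (P g), hgae, coeFn_localLp hΔ hc hf,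
        coeFn_localLp hΔ hc (hs.continuousOn_apply hΔ hc x')] with t h1 h2 h3 h4
      rw [h1, h3, Pi.sub_apply, h2, hPg, h4]
    change ⟪g - P g, localRestrict H Δ c y⟫_ℂ = 0
    rw [hgP]
    refine hs.inner_localRestrict_eq_zero hΔ hn hc hc0 hy hf fun x => ?_
    rw [← inner_localLp_eq_integral hΔ hc hc0 (hs.continuousOn_apply hΔ hc x) hf, ← hgP, ← hV x]
    exact (V.range.mem_orthogonal _).mp (horth g) _ ⟨x, rfl⟩
  -- Taking for `x` the restriction of `y` itself shows that `y - P y` is orthogonal to both `y` and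
  -- `P y`, hence zero.
  have h1 := hall (localRestrict H Δ c y)
  have h2 : ⟪localRestrict H Δ c y - P (localRestrict H Δ c y), P (localRestrict H Δ c y)⟫_ℂ = 0 :=
    (V.range.mem_orthogonal' _).mp (horth _) _ (V.range.starProjection_apply_mem _)
  have h3 : localRestrict H Δ c y - P (localRestrict H Δ c y) = 0 := by
    rw [← inner_self_eq_zero (𝕜 := ℂ), inner_sub_right, h1, h2, sub_zero]
  obtain ⟨x, hx⟩ : P (localRestrict H Δ c y) ∈ V.range := V.range.starProjection_apply_mem _
  refine ⟨x, ?_⟩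
  rw [sub_eq_zero.mp h3, ← hx, ← hV x]
  rfl

/-- Countably many intervals `[0, s k]` with `s k ∈ Δ` exhaust `Δ`, even if its right end is
missing. Replacing `s k` by its maximum with `c₀` restricts attention to long intervals. -/
theorem IsHalfInterval.ae_restrict_of_forall_Icc (hΔ : IsHalfInterval Δ) {p : ℝ → Prop} {c₀ : ℝ}
    (hc₀ : c₀ ∈ Δ) (h : ∀ c ∈ Δ, c₀ ≤ c → ∀ᵐ t ∂(volume.restrict (Set.Icc 0 c)), p t) :
    ∀ᵐ t ∂(volume.restrict Δ), p t := by
  obtain ⟨s, hs, hs'⟩ : ∃ s : ℕ → ℝ, (∀ k, s k ∈ Δ) ∧ ∀ t ∈ Δ, ∃ k, t ≤ s k := by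
    rcases hΔ with rfl | ⟨b, hb, rfl | rfl⟩
    · exact ⟨fun k => k, fun k => Set.mem_Ici.mpr (Nat.cast_nonneg k), fun t _ => exists_nat_ge t⟩
    · refine ⟨fun k => b - b * (1 / (k + 1)), fun k => ⟨?_, ?_⟩, fun t ht => ?_⟩
      · have h1 : (1 : ℝ) / (k + 1) ≤ 1 := by
          rw [div_le_one (by positivity)]
          linarith [(Nat.cast_nonneg k : (0 : ℝ) ≤ k)]
        nlinarith
      · have h1 : (0 : ℝ) < 1 / (k + 1) := by positivity
        nlinarith
      · obtain ⟨k, hk⟩ := exists_nat_one_div_lt (div_pos (sub_pos.mpr ht.2) hb)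
        refine ⟨k, ?_⟩
        rw [lt_div_iff₀ hb] at hk
        linarith
    · exact ⟨fun _ => b, fun _ => ⟨hb.le, le_rfl⟩, fun t ht => ⟨0, ht.2⟩⟩
  have hsub : Δ ⊆ ⋃ k, Set.Icc 0 (max c₀ (s k)) := by
    intro t ht
    obtain ⟨k, hk⟩ := hs' t ht
    exact Set.mem_iUnion.mpr ⟨k, hΔ.subset_Ici ht, hk.trans (le_max_right _ _)⟩
  refine ae_restrict_of_ae_restrict_of_subset hsub ((ae_restrict_iUnion_iff _ _).mpr fun k => ?_)
  refine h _ ?_ (le_max_left _ _)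
  rcases max_choice c₀ (s k) with h | h <;> rw [h]
  exacts [hc₀, hs k]

theorem IsHalfInterval.exists_pos_mem (hΔ : IsHalfInterval Δ) : ∃ c ∈ Δ, 0 < c := by
  rcases hΔ with rfl | ⟨b, hb, rfl | rfl⟩
  · exact ⟨1, Set.mem_Ici.mpr zero_le_one, one_pos⟩
  · exact ⟨b / 2, ⟨by linarith, by linarith⟩, by linarith⟩
  · exact ⟨b, ⟨hb.le, le_rfl⟩, hb⟩

/-- The elements of `Ker (L₀^* - z)` are solutions of `l[y] = z y`, and the values at `0` of their
quasi-derivatives depend continuously on them. -/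
theorem FundamentalSystem.exists_initialValues (hs : FundamentalSystem l z D U)
    (hΔ : IsHalfInterval Δ) (hn : 1 ≤ n) :
    ∃ I : L2 H Δ →L[ℂ] StateSpace H n, ∀ y ∈ defectSpace (minimalGraph hΔ hn l) z,
      y =ᵐ[volume.restrict Δ] fun t => D 0 t (I y) := by
  obtain ⟨c₀, hc₀, hpos⟩ := hΔ.exists_pos_mem
  obtain ⟨V, hV, C, hC⟩ := hs.exists_solutionMap hΔ hn hc₀ hpos
  have hclosed : IsClosed (Set.range V) := hC.isClosed_range V.uniformContinuous
  have hclosed' : IsClosed (V.range : Set (Lp H 2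
      ((volume.restrict Δ).restrict (Set.Icc 0 c₀)))) := by
    rwa [LinearMap.coe_range]
  have : CompleteSpace V.range := hclosed'.completeSpace_coe
  -- A bounded left inverse of the solution map on one fixed interval `[0, c₀]`. It determines the
  -- initial state on every longer interval, because a solution there restricts to a solution on
  -- `[0, c₀]` with the same initial state.
  let S := (V.equivRange hC.injective hclosed).symm.toContinuousLinearMap.comp
    V.range.orthogonalProjectionOnto
  have hS : ∀ x, S (V x) = x := by
    intro x
    have h1 : V.range.orthogonalProjectionOnto (V x) = V.equivRange hC.injective hclosed x := by
      refine Subtype.ext ?_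
      rw [Submodule.coe_orthogonalProjectionOnto_apply]
      exact Submodule.starProjection_eq_self_iff.mpr ⟨x, rfl⟩
    simp only [S, ContinuousLinearMap.comp_apply, h1]
    exact (V.equivRange hC.injective hclosed).symm_apply_apply x
  refine ⟨S.comp (localRestrict H Δ c₀), fun y hy => ?_⟩
  refine hΔ.ae_restrict_of_forall_Icc hc₀ fun c hc hcc => ?_
  obtain ⟨x, hx⟩ := hs.localRestrict_mem_range hΔ hn hc (hpos.trans_le hcc) hy
  have h1 : y =ᵐ[volume.restrict (Set.Icc 0 c)] fun t => D 0 t x := by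
    have h2 := coeFn_localRestrict (c := c) y
    rw [hx] at h2
    rw [← restrict_restrict_Icc hΔ hc]
    exact h2.symm.trans (coeFn_localLp hΔ hc (hs.continuousOn_apply hΔ hc x))
  have h3 : localRestrict H Δ c₀ y = V x := by
    rw [hV x]
    refine Lp.ext ?_
    have h4 : y =ᵐ[(volume.restrict Δ).restrict (Set.Icc 0 c₀)] fun t => D 0 t x := by
      rw [restrict_restrict_Icc hΔ hc₀]
      exact ae_restrict_of_ae_restrict_of_subset (Set.Icc_subset_Icc_right hcc) h1
    exact (coeFn_localRestrict y).trans
      (h4.trans (coeFn_localLp hΔ hc₀ (hs.continuousOn_apply hΔ hc₀ x)).symm)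
  rw [ContinuousLinearMap.comp_apply, h3, hS]
  exact h1

end Representation

/-! ### The resolvent and the isomorphisms of the defect spaces -/

section Resolvent

variable {F : Type*} [NormedAddCommGroup F] [InnerProductSpace ℂ F]

/-- `R z`, `z ∈ ρ(A)`, are the resolvents of `A`. -/
def IsResolvent (A : F →ₗ.[ℂ] F) (R : ℂ → F →L[ℂ] F) : Prop :=
  ∀ z ∈ opResolventSet A, (∀ x, (R z x, x + z • R z x) ∈ A.graph) ∧
    ∀ y w, (y, w) ∈ A.graph → R z (w - z • y) = y

/-- The graph of the algebraic inverse of `A - z` is the preimage of the closed graph of `A` under a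
continuous map, so the closed graph theorem makes it bounded. -/
theorem exists_isResolvent [CompleteSpace F] {A : F →ₗ.[ℂ] F} (hA : A.IsClosed) :
    ∃ R, IsResolvent A R := by
  have key : ∀ z ∈ opResolventSet A, ∃ R : F →L[ℂ] F, (∀ x, (R x, x + z • R x) ∈ A.graph) ∧
      ∀ y w, (y, w) ∈ A.graph → R (w - z • y) = y := by
    intro z hz
    let e := LinearEquiv.ofBijective (A.toFun - z • A.domain.subtype) hz
    let R₀ : F →ₗ[ℂ] F := A.domain.subtype ∘ₗ e.symm.toLinearMap
    have h1 : ∀ x, (R₀ x, x + z • R₀ x) ∈ A.graph := by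
      intro x
      have h2 : A (e.symm x) - z • (e.symm x : F) = x := e.apply_symm_apply x
      rw [LinearPMap.mem_graph_iff]
      refine ⟨e.symm x, rfl, ?_⟩
      exact sub_eq_iff_eq_add.mp h2
    have h2 : ∀ y w, (y, w) ∈ A.graph → R₀ (w - z • y) = y := by
      intro y w hyw
      obtain ⟨y', hy', hw⟩ := (LinearPMap.mem_graph_iff A).mp hyw
      have h3 : e y' = w - z • y := by
        change A y' - z • (y' : F) = w - z • y
        rw [hw, hy']
      change ((e.symm (w - z • y) : A.domain) : F) = y
      rw [← h3, e.symm_apply_apply]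
      exact hy'
    have hclosed : IsClosed (R₀.graph : Set (F × F)) := by
      have h3 : (R₀.graph : Set (F × F))
          = (fun p : F × F => (p.2, p.1 + z • p.2)) ⁻¹' (A.graph : Set (F × F)) := by
        ext ⟨x, w⟩
        simp only [SetLike.mem_coe, LinearMap.mem_graph_iff, Set.mem_preimage]
        constructor
        · rintro rfl
          exact h1 x
        · intro h
          have := h2 _ _ h
          rw [add_sub_cancel_right] at this
          exact this.symm
      rw [h3]
      exact hA.preimage (by fun_prop)
    exact ⟨ContinuousLinearMap.ofIsClosedGraph hclosed, h1, h2⟩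
  choose! R hR using key
  exact ⟨R, hR⟩

namespace IsResolvent

variable {A : F →ₗ.[ℂ] F} {R : ℂ → F →L[ℂ] F}

theorem resolvent_identity (hR : IsResolvent A R) {z w : ℂ} (hz : z ∈ opResolventSet A)
    (hw : w ∈ opResolventSet A) (x : F) : R z x = R w x + (z - w) • R z (R w x) := by
  have h := (hR z hz).2 _ _ ((hR w hw).1 x)
  have e : x + w • R w x - z • R w x = x - (z - w) • R w x := by module
  rw [e, map_sub, map_smul] at h
  rw [← sub_eq_iff_eq_add]
  exact h

/-- By the resolvent identity `R z (1 - (z - w) R w) = R w`, so near `w` the resolvent is `R w`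
times the inverse of an operator affine in `z`. Only differentiability within the set is asserted,
so its openness is not needed. -/
theorem differentiableOn [CompleteSpace F] (hR : IsResolvent A R) :
    DifferentiableOn ℂ R (opResolventSet A) := by
  intro w hw
  have h1 : DifferentiableAt ℂ
      (fun z : ℂ => R w * Ring.inverse (1 - (z - w) • R w : F →L[ℂ] F)) w := by
    have h2 : DifferentiableAt ℂ (fun z : ℂ => (1 - (z - w) • R w : F →L[ℂ] F)) w := by fun_prop
    have h3 : DifferentiableAt ℂ Ring.inverse ((1 - (w - w) • R w : F →L[ℂ] F)) :=
      differentiableAt_inverse (by simp)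
    have h4 : DifferentiableAt ℂ
        (fun z : ℂ => Ring.inverse (1 - (z - w) • R w : F →L[ℂ] F)) w :=
      DifferentiableAt.comp (f := fun z : ℂ => (1 - (z - w) • R w : F →L[ℂ] F)) w h3 h2
    exact (differentiableAt_const _).mul h4
  have hunit : ∀ᶠ z in 𝓝[opResolventSet A] w, IsUnit (1 - (z - w) • R w : F →L[ℂ] F) := by
    have hc : Continuous fun z : ℂ => (1 - (z - w) • R w : F →L[ℂ] F) := by fun_prop
    have hmem : {T : F →L[ℂ] F | IsUnit T} ∈ 𝓝 (1 - (w - w) • R w : F →L[ℂ] F) :=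
      Units.isOpen.mem_nhds (by simp)
    exact mem_nhdsWithin_of_mem_nhds (hc.continuousAt hmem)
  refine h1.differentiableWithinAt.congr_of_eventuallyEq ?_ ?_
  · filter_upwards [self_mem_nhdsWithin, hunit] with z hz hu
    refine (Ring.eq_mul_inverse_iff_mul_eq _ _ _ hu).mpr ?_
    ext1 x
    have := hR.resolvent_identity hz hw x
    simp only [mul_apply_eq_comp, sub_apply, one_apply_eq_self, smul_apply, map_sub, map_smul]
    rw [this]
    abel
  · simp

/-- The operator `(A - w)(A - z)⁻¹ = 1 + (z - w)(A - z)⁻¹`. -/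
def transfer (R : ℂ → F →L[ℂ] F) (w z : ℂ) : F →L[ℂ] F := 1 + (z - w) • R z

theorem transfer_apply (w z : ℂ) (x : F) : transfer R w z x = x + (z - w) • R z x := by
  simp [transfer]

theorem differentiableOn_transfer [CompleteSpace F] (hR : IsResolvent A R) (w : ℂ) :
    DifferentiableOn ℂ (transfer R w) (opResolventSet A) := by
  have h1 : DifferentiableOn ℂ (fun z : ℂ => z - w) (opResolventSet A) := by fun_prop
  exact (h1.smul hR.differentiableOn).const_add 1

theorem transfer_transfer (hR : IsResolvent A R) {z w : ℂ} (hz : z ∈ opResolventSet A)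
    (hw : w ∈ opResolventSet A) (x : F) : transfer R z w (transfer R w z x) = x := by
  simp only [transfer_apply, map_add, map_smul]
  rw [hR.resolvent_identity hw hz x]
  module

/-- Add to `(x, w x)` the multiple by `z - w` of the element `(R z x, x + z R z x)` of the graph of
`A`. Both lie in `T^*`, and in the sum the second component is `z` times the first. -/
theorem transfer_mem (hR : IsResolvent A R) {T : Submodule ℂ (F × F)} (hA : A.graph ≤ T.adjoint)
    {z w : ℂ} (hz : z ∈ opResolventSet A) {x : F} (hx : x ∈ defectSpace T w) :
    transfer R w z x ∈ defectSpace T z := by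
  have h1 := hA ((hR z hz).1 x)
  have h2 := T.adjoint.add_mem hx (T.adjoint.smul_mem (z - w) h1)
  have e : (x, w • x) + (z - w) • (R z x, x + z • R z x)
      = (transfer R w z x, z • transfer R w z x) := by
    rw [transfer_apply]
    refine Prod.ext rfl ?_
    simp only [Prod.snd_add, Prod.smul_snd]
    module
  rw [e] at h2
  exact h2

end IsResolvent

/-- The defect space `Ker (T^* - z)` as a subspace. -/
def defectSubmodule (T : Submodule ℂ (F × F)) (z : ℂ) : Submodule ℂ F :=
  T.adjoint.comap (LinearMap.id.prod (z • LinearMap.id))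

theorem mem_defectSubmodule {T : Submodule ℂ (F × F)} {z : ℂ} {y : F} :
    y ∈ defectSubmodule T z ↔ y ∈ defectSpace T z := Iff.rfl

/-- Each pair in `T` imposes one closed condition. Closedness makes the defect space a Hilbert
space, the parameter space of the fundamental solution. -/
theorem isClosed_defectSubmodule (T : Submodule ℂ (F × F)) (z : ℂ) :
    IsClosed (defectSubmodule T z : Set F) := by
  have h : (defectSubmodule T z : Set F)
      = ⋂ p : T, {y | ⟪p.1.2, y⟫_ℂ - ⟪p.1.1, z • y⟫_ℂ = 0} := by
    ext y
    rw [Set.mem_iInter, SetLike.mem_coe, mem_defectSubmodule]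
    exact (Submodule.mem_adjoint_iff T (y, z • y)).trans
      ⟨fun h p => h _ _ p.2, fun h a b hab => h ⟨(a, b), hab⟩⟩
  rw [h]
  exact isClosed_iInter fun p => isClosed_eq (by fun_prop) continuous_const

/-- The map `h ↦ (x, z x)`, `x = X h`, as a function of a spectral parameter `z`; the pair is
embedded in a normed space by `j`. -/
def graphMap {G Y : Type*} [NormedAddCommGroup G] [NormedSpace ℂ G] [NormedAddCommGroup Y]
    [NormedSpace ℂ Y] (j : F × F →L[ℂ] Y) (X : ℂ → G →L[ℂ] F) (z : ℂ) : G →L[ℂ] Y :=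
  j.comp ((X z).prod (z • X z))

theorem differentiableOn_graphMap {G Y : Type*} [NormedAddCommGroup G] [NormedSpace ℂ G]
    [NormedAddCommGroup Y] [NormedSpace ℂ Y] (j : F × F →L[ℂ] Y)
    {X : ℂ → G →L[ℂ] F} {s : Set ℂ} (hX : DifferentiableOn ℂ X s) :
    DifferentiableOn ℂ (graphMap j X) s := by
  have h : graphMap j X = fun z => (j.comp (ContinuousLinearMap.inl ℂ F F)).comp (X z) +
      (j.comp (ContinuousLinearMap.inr ℂ F F)).comp (z • X z) := by
    funext z
    refine ContinuousLinearMap.ext fun x => ?_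
    change j (X z x, z • X z x) = j (X z x, 0) + j (0, z • X z x)
    rw [← map_add, Prod.mk_add_mk, add_zero, zero_add]
  have h1 : DifferentiableOn ℂ (fun z => z • X z) s := DifferentiableOn.smul differentiableOn_id hX
  rw [h]
  exact (DifferentiableOn.clm_comp (differentiableOn_const _) hX).add
    (DifferentiableOn.clm_comp (differentiableOn_const _) h1)

theorem differentiableOn_comp_subtypeL {G : Submodule ℂ F} {X : ℂ → F →L[ℂ] F} {s : Set ℂ}
    (hX : DifferentiableOn ℂ X s) :
    DifferentiableOn ℂ (fun z => (X z).comp G.subtypeL) s :=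
  hX.clm_comp (differentiableOn_const _)

end Resolvent

/-! ### Evaluation of quasi-derivatives as a bounded operator -/

section Evaluation

/-- A bounded linear map on a subspace preserves holomorphy of operator functions with values in
that subspace. -/
theorem differentiableOn_of_bounded_on_submodule {F G K : Type*} [NormedAddCommGroup F]
    [InnerProductSpace ℂ F] [CompleteSpace F] [NormedAddCommGroup G] [NormedSpace ℂ G]
    [CompleteSpace G] [NormedAddCommGroup K] [NormedSpace ℂ K] {M : Submodule ℂ F}
    {e : M →ₗ[ℂ] G} {C : ℝ} (he : ∀ x, ‖e x‖ ≤ C * ‖x‖) {s : Set ℂ} {Φ : ℂ → K →L[ℂ] F}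
    (hΦ : DifferentiableOn ℂ Φ s) (hM : ∀ z ∈ s, ∀ h, Φ z h ∈ M) {Ψ : ℂ → K →L[ℂ] G}
    (hΨ : ∀ z (hz : z ∈ s) (h : K), Ψ z h = e ⟨Φ z h, hM z hz h⟩) : DifferentiableOn ℂ Ψ s := by
  have hle : M ≤ M.topologicalClosure := M.le_topologicalClosure
  let ι : M →ₗ[ℂ] M.topologicalClosure := Submodule.inclusion hle
  have hdense : DenseRange ι := by
    intro x
    rw [Metric.mem_closure_iff]
    intro ε hε
    obtain ⟨y, hy, hxy⟩ := Metric.mem_closure_iff.mp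
      (show (x : F) ∈ closure (M : Set F) from x.2) ε hε
    exact ⟨ι ⟨y, hy⟩, ⟨_, rfl⟩, hxy⟩
  have : CompleteSpace M.topologicalClosure := M.isClosed_topologicalClosure.completeSpace_coe
  -- Extend `e` to the closure of `M`, then to all of `F` by the orthogonal projection. The
  -- resulting `L` does not depend on `z`, and `Ψ = L ∘ Φ`.
  let L : F →L[ℂ] G := (e.extendOfNorm ι).comp M.topologicalClosure.orthogonalProjectionOnto
  have hL : ∀ x : M, L x = e x := by
    intro x
    have h1 : M.topologicalClosure.orthogonalProjectionOnto (x : F) = ι x :=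
      Submodule.orthogonalProjectionOnto_mem_subspace_eq_self (K := M.topologicalClosure) (ι x)
    simp only [L, ContinuousLinearMap.comp_apply, h1]
    exact LinearMap.extendOfNorm_eq hdense ⟨C, he⟩ x
  have h1 : DifferentiableOn ℂ (fun z => L.comp (Φ z)) s :=
    (ContinuousLinearMap.compL ℂ K F G L).differentiable.comp_differentiableOn hΦ
  refine h1.congr fun z hz => ?_
  refine ContinuousLinearMap.ext fun h => ?_
  rw [hΨ z hz h, ContinuousLinearMap.comp_apply]
  exact (hL ⟨Φ z h, hM z hz h⟩).symm

variable {H : Type u} [NormedAddCommGroup H] [InnerProductSpace ℂ H] [CompleteSpace H]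
  {Δ : Set ℝ} {n : ℕ} {l : Expression H Δ n} {c : ℝ}

/-- The quasi-derivatives of orders `0, …, 2n - 1` of a first order system. -/
def quasiSeq {E : Type*} (n : ℕ) (D U : ℕ → ℝ → E) (k : ℕ) : ℝ → E :=
  if k < n then D k else U (k - n)

theorem QuasiSystem.quasiDeriv_eq {E : Type*} [NormedAddCommGroup E] [NormedSpace ℂ E]
    {act : (H →L[ℂ] H) →L[ℂ] E →L[ℂ] E} {D U : ℕ → ℝ → E} (h : QuasiSystem l act Δ D U)
    (hn : 1 ≤ n) (hΔ : UniqueDiffOn ℝ Δ) {k : ℕ} (hk : k ≤ 2 * n) :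
    ∀ t ∈ Δ, quasiDeriv l act (D 0) k t = quasiSeq n D U k t := by
  intro t ht
  rcases lt_or_ge k n with hkn | hkn
  · rw [quasiSeq, if_pos hkn]
    exact quasiDeriv_lower hΔ h.deriv_lower hkn t ht
  · obtain ⟨j, rfl⟩ := Nat.exists_eq_add_of_le hkn
    rw [quasiDeriv_upper, quasiSeq, if_neg (by omega), Nat.add_sub_cancel_left]
    exact upperQuasiDeriv_eq hn hΔ h.deriv_lower h.upper_zero
      (fun i hi => h.deriv_upper i (by omega)) t ht

/-- The pair `x` consists of `y` and `l[y]` on `[0, c]` for a solution of the first order system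
with continuous right-hand side. -/
def LocallyRepresents (l : Expression H Δ n) (c : ℝ) (x : WithLp 2 (L2 H Δ × L2 H Δ))
    (D U : ℕ → ℝ → H) : Prop :=
  QuasiSystem l (ContinuousLinearMap.id ℂ (H →L[ℂ] H)) (Set.Icc 0 c) D U ∧
    x.fst =ᵐ[(volume.restrict Δ).restrict (Set.Icc 0 c)] D 0 ∧
    x.snd =ᵐ[(volume.restrict Δ).restrict (Set.Icc 0 c)] U n

theorem LocallyRepresents.comb {x x' : WithLp 2 (L2 H Δ × L2 H Δ)} {D U D' U' : ℕ → ℝ → H}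
    (h : LocallyRepresents l c x D U) (h' : LocallyRepresents l c x' D' U') (a : ℂ) :
    LocallyRepresents l c (a • x + x') (fun m s => a • D m s + D' m s)
      (fun m s => a • U m s + U' m s) := by
  have key : ∀ {y y' : L2 H Δ} {f f' : ℝ → H},
      y =ᵐ[(volume.restrict Δ).restrict (Set.Icc 0 c)] f →
      y' =ᵐ[(volume.restrict Δ).restrict (Set.Icc 0 c)] f' →
      (a • y + y' : L2 H Δ) =ᵐ[(volume.restrict Δ).restrict (Set.Icc 0 c)]
        fun s => a • f s + f' s := by
    intro y y' f f' hy hy'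
    filter_upwards [ae_restrict_of_ae (Lp.coeFn_add (a • y) y'),
      ae_restrict_of_ae (Lp.coeFn_smul a y), hy, hy'] with t h1 h2 h3 h4
    rw [h1, Pi.add_apply, h2, Pi.smul_apply, h3, h4]
  exact ⟨h.1.comb h'.1 a, key h.2.1 h'.2.1, key h.2.2 h'.2.2⟩

theorem LocallyRepresents.zero :
    LocallyRepresents l c (0 : WithLp 2 (L2 H Δ × L2 H Δ)) 0 0 :=
  ⟨QuasiSystem.zero, ae_restrict_of_ae (Lp.coeFn_zero _ _ _),
    ae_restrict_of_ae (Lp.coeFn_zero _ _ _)⟩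

/-- The space of the locally represented pairs. -/
def localGraph (l : Expression H Δ n) (c : ℝ) : Submodule ℂ (WithLp 2 (L2 H Δ × L2 H Δ)) where
  carrier := {x | ∃ D U, LocallyRepresents l c x D U}
  zero_mem' := ⟨_, _, LocallyRepresents.zero⟩
  add_mem' := by
    rintro x x' ⟨D, U, h⟩ ⟨D', U', h'⟩
    exact ⟨_, _, by simpa only [one_smul] using h.comb h' 1⟩
  smul_mem' := by
    rintro a x ⟨D, U, h⟩
    exact ⟨_, _, by simpa only [add_zero] using h.comb LocallyRepresents.zero a⟩

/-- The a priori estimate, with its `L₁` data replaced by the Hilbert norm of the pair `(y, l[y])`.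
-/
theorem exists_quasiSeq_bound (hΔ : IsHalfInterval Δ) (hn : 1 ≤ n) (hc : c ∈ Δ) (hc0 : 0 < c)
    (l : Expression H Δ n) :
    ∃ C : ℝ, 0 ≤ C ∧ ∀ x D U, LocallyRepresents l c x D U → ∀ k < 2 * n, ∀ t ∈ Set.Icc 0 c,
      ‖quasiSeq n D U k t‖ ≤ C * ‖x‖ := by
  obtain ⟨C, hC, hbound⟩ := exists_quasiSystem_bound hc0 hn (hΔ.Icc_subset hc) l
  obtain ⟨C', hC', hint⟩ := integral_norm_le_localLp (H := H) hΔ hc hc0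
  have hnorm : ∀ (y : L2 H Δ) (f : ℝ → H), ContinuousOn f (Set.Icc 0 c) →
      y =ᵐ[(volume.restrict Δ).restrict (Set.Icc 0 c)] f →
      ∫ t in (0 : ℝ)..c, ‖f t‖ ≤ C' * (‖localRestrict H Δ c‖ * ‖y‖) := by
    intro y f hf hy
    refine (hint f hf).trans (mul_le_mul_of_nonneg_left ?_ hC')
    have h1 : localLp hΔ hc hf = localRestrict H Δ c y :=
      Lp.ext ((coeFn_localLp hΔ hc hf).trans (hy.symm.trans (coeFn_localRestrict y).symm))
    rw [h1]
    exact (localRestrict H Δ c).le_opNorm y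
  set B := ‖localRestrict H Δ c‖
  have hB : 0 ≤ B := (localRestrict H Δ c).opNorm_nonneg
  refine ⟨C * (2 * (C' * B)), by positivity, fun x D U h k hk t ht => ?_⟩
  have h1 := hnorm x.fst (D 0) (h.1.continuousOn_D (Nat.zero_le n)) h.2.1
  have h2 := hnorm x.snd (U n) h.1.continuousOn_upper h.2.2
  have h3 : ‖x.fst‖ ≤ ‖x‖ := WithLp.norm_fst_le (p := 2) (x := x)
  have h4 : ‖x.snd‖ ≤ ‖x‖ := WithLp.norm_snd_le (p := 2) (x := x)
  have h5 : C * ((∫ t in (0 : ℝ)..c, ‖D 0 t‖) + ∫ t in (0 : ℝ)..c, ‖U n t‖)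
      ≤ C * (2 * (C' * B)) * ‖x‖ := by
    rw [mul_assoc]
    refine mul_le_mul_of_nonneg_left ?_ hC
    have h6 := mul_le_mul_of_nonneg_left h3 (mul_nonneg hC' hB)
    have h7 := mul_le_mul_of_nonneg_left h4 (mul_nonneg hC' hB)
    linarith
  refine le_trans ?_ h5
  rw [quasiSeq]
  split_ifs with hkn
  · exact (hbound D U h.1 t ht).1 k hkn
  · exact (hbound D U h.1 t ht).2 (k - n) (by omega)

/-- The quasi-derivatives at a point are bounded linear functions of the locally represented
pairs. -/
theorem exists_evaluation (hΔ : IsHalfInterval Δ) (hn : 1 ≤ n) (hc : c ∈ Δ) (hc0 : 0 < c)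
    (l : Expression H Δ n) {k : ℕ} (hk : k < 2 * n) {t : ℝ} (ht : t ∈ Set.Icc 0 c) :
    ∃ (e : localGraph l c →ₗ[ℂ] H) (C : ℝ), (∀ x, ‖e x‖ ≤ C * ‖x‖) ∧
      ∀ (x : localGraph l c) D U, LocallyRepresents l c x D U → e x = quasiSeq n D U k t := by
  obtain ⟨C, hC, hbound⟩ := exists_quasiSeq_bound hΔ hn hc hc0 l
  have hcomb : ∀ (a : ℂ) (D U D' U' : ℕ → ℝ → H),
      quasiSeq n (fun m s => a • D m s + D' m s) (fun m s => a • U m s + U' m s) k t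
        = a • quasiSeq n D U k t + quasiSeq n D' U' k t := by
    intro a D U D' U'
    simp only [quasiSeq]
    split_ifs <;> rfl
  -- The difference of two systems for the same pair represents zero, so the bound forces it to
  -- vanish. The value is thus independent of the chosen system, and linearity follows.
  have huniq : ∀ x D U D' U', LocallyRepresents l c x D U → LocallyRepresents l c x D' U' →
      quasiSeq n D U k t = quasiSeq n D' U' k t := by
    intro x D U D' U' h h'
    have h1 := hbound _ _ _ (h.comb h' (-1)) k hk t ht
    rw [hcomb, neg_one_smul, neg_one_smul, neg_add_cancel, norm_zero, mul_zero,
      norm_le_zero_iff, neg_add_eq_zero] at h1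
    exact h1
  choose D U hDU using fun x : localGraph l c => x.2
  have hrep : ∀ (a : ℂ) (x x' : localGraph l c),
      quasiSeq n (D (a • x + x')) (U (a • x + x')) k t
        = a • quasiSeq n (D x) (U x) k t + quasiSeq n (D x') (U x') k t := by
    intro a x x'
    rw [← hcomb]
    exact huniq _ _ _ _ _ (hDU (a • x + x')) ((hDU x).comb (hDU x') a)
  have hzero : quasiSeq n (D 0) (U 0) k t = 0 := by
    rw [huniq _ _ _ _ _ (hDU 0) LocallyRepresents.zero]
    simp [quasiSeq]
  refine ⟨{ toFun := fun x => quasiSeq n (D x) (U x) k t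
            map_add' := fun x y => by simpa only [one_smul] using hrep 1 x y
            map_smul' := fun a x => by
              simpa only [add_zero, hzero, RingHom.id_apply] using hrep a x 0 }, C,
    fun x => hbound _ _ _ (hDU x) k hk t ht, fun x D' U' h => huniq _ _ _ _ _ (hDU x) h⟩

end Evaluation

end DiffOp

end

/-! ### Construction of the holomorphic fundamental solution -/

theorem theorem1 {H : Type u} [NormedAddCommGroup H] [InnerProductSpace ℂ H] [CompleteSpace H]
    [TopologicalSpace.SeparableSpace H] {Δ : Set ℝ} (hΔ : DiffOp.IsHalfInterval Δ)
    {n : ℕ} (hn : 1 ≤ n) (l : DiffOp.Expression H Δ n)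
    (A : DiffOp.L2 H Δ →ₗ.[ℂ] DiffOp.L2 H Δ)
    (hA : DiffOp.IsProperExtension (DiffOp.minimalGraph hΔ hn l) A)
    (hρ : (DiffOp.opResolventSet A).Nonempty) :
    ∃ (K : Type u) (_ : NormedAddCommGroup K) (_ : InnerProductSpace ℂ K) (_ : CompleteSpace K)
      (Z : ℂ → ℝ → K →L[ℂ] H),
      (∀ z ∈ DiffOp.opResolventSet A, DiffOp.IsFundamentalSolution hΔ hn l z (Z z)) ∧
      ∀ t ∈ Δ, ∀ k < 2 * n,
        DifferentiableOn ℂ (fun z => DiffOp.opQuasiDeriv l (Z z) k t)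
          (DiffOp.opResolventSet A) := by
  obtain ⟨w, hw⟩ := hρ
  obtain ⟨R, hR⟩ := DiffOp.exists_isResolvent hA.isClosed
  set T := DiffOp.minimalGraph hΔ hn l
  let K : Submodule ℂ (DiffOp.L2 H Δ) := DiffOp.defectSubmodule T w
  have hKc : CompleteSpace K := (DiffOp.isClosed_defectSubmodule T w).completeSpace_coe
  have huniq := hΔ.uniqueDiffOn
  choose D U hDU using DiffOp.exists_fundamentalSystem hΔ hn l
  choose I hI using fun z => (hDU z).exists_initialValues hΔ hn
  let X : ℂ → K →L[ℂ] DiffOp.L2 H Δ := fun z => (DiffOp.IsResolvent.transfer R w z).comp K.subtypeL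
  have hX : ∀ z ∈ DiffOp.opResolventSet A, ∀ h, X z h ∈ DiffOp.defectSpace T z := fun z hz h =>
    hR.transfer_mem hA.graph_le hz h.2
  -- Initial values of `X(z) h` propagated by the Cauchy solution operators. This gives
  -- norm-smoothness in `t` but says nothing about `z`, since `D z` and `I z` are chosen separately
  -- for each `z`.
  let P : ℂ → ℕ → ℝ → K →L[ℂ] H := fun z m t => (D z m t).comp ((I z).comp (X z))
  let Q : ℂ → ℕ → ℝ → K →L[ℂ] H := fun z m t => (U z m t).comp ((I z).comp (X z))
  have hPQ : ∀ z, DiffOp.QuasiSystem l (ContinuousLinearMap.compL ℂ K H H) Δ (P z) (Q z) :=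
    fun z => (hDU z).quasiSystem.map
      (Φ := (ContinuousLinearMap.compL ℂ K (DiffOp.StateSpace H n) H).flip ((I z).comp (X z)))
      fun _ _ => rfl
  have htop : ∀ z, ∀ t ∈ Δ, Q z n t = z • P z 0 t := by
    intro z t ht
    refine ContinuousLinearMap.ext fun h => ?_
    simp [P, Q, (hDU z).top_eq t ht]
  have hae : ∀ z ∈ DiffOp.opResolventSet A, ∀ h,
      X z h =ᵐ[volume.restrict Δ] fun t => P z 0 t h := fun z hz h => hI z _ (hX z hz h)
  refine ⟨K, inferInstance, inferInstance, hKc, fun z => P z 0, fun z hz => ⟨⟨fun k hk => ?_,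
    fun t ht => ?_⟩, fun h => (memLp_congr_ae (hae z hz h)).mp (Lp.memLp _), fun y hy => ?_⟩,
    fun t ht k hk => ?_⟩
  · exact (hPQ z).hasContDeriv hn huniq hk
  · rw [DiffOp.opQuasiDeriv, (hPQ z).quasiDeriv_eq hn huniq le_rfl t ht, DiffOp.quasiSeq,
      if_neg (by omega), show 2 * n - n = n by omega, htop z t ht, sub_self]
  -- The parameter of `y` is its image under the inverse transfer from `z` back to `w`.
  · have hmem : DiffOp.IsResolvent.transfer R z w y ∈ K := hR.transfer_mem hA.graph_le hw hy
    have hXy : X z ⟨_, hmem⟩ = y := hR.transfer_transfer hw hz y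
    refine ⟨⟨_, hmem⟩, ?_, fun h hh => ?_⟩
    · have := hae z hz ⟨_, hmem⟩
      rwa [hXy] at this
    · have h1 : X z h = y := Lp.ext ((hae z hz h).trans (Filter.EventuallyEq.symm hh))
      have h2 := hR.transfer_transfer hz hw (h : DiffOp.L2 H Δ)
      refine Subtype.ext ?_
      change (h : DiffOp.L2 H Δ) = DiffOp.IsResolvent.transfer R z w y
      rw [← h1]
      exact h2.symm
  · obtain ⟨c₀, hc₀, hpos⟩ := hΔ.exists_pos_mem
    -- The maximum with `c₀` provides an interval of positive length containing `t`, also for `t =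
    -- 0`.
    have hc : max t c₀ ∈ Δ := by
      rcases max_choice t c₀ with h | h <;> rw [h] <;> assumption
    have hc0 : 0 < max t c₀ := lt_max_of_lt_right hpos
    obtain ⟨e, C, he, he'⟩ := DiffOp.exists_evaluation hΔ hn hc hc0 l hk
      (t := t) ⟨hΔ.subset_Ici ht, le_max_left _ _⟩
    -- The pairs `(X(z) h, z X(z) h)` are placed in the Hilbert product, since the extension of the
    -- evaluation uses an orthogonal projection.
    let Φ : ℂ → K →L[ℂ] WithLp 2 (DiffOp.L2 H Δ × DiffOp.L2 H Δ) :=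
      DiffOp.graphMap (WithLp.prodContinuousLinearEquiv 2 ℂ (DiffOp.L2 H Δ)
        (DiffOp.L2 H Δ)).symm.toContinuousLinearMap X
    have hrep : ∀ z ∈ DiffOp.opResolventSet A, ∀ h, DiffOp.LocallyRepresents l (max t c₀) (Φ z h)
        (fun m s => P z m s h) (fun m s => Q z m s h) := by
      intro z hz h
      refine ⟨((hPQ z).apply h).mono (hΔ.Icc_subset hc), ae_restrict_of_ae (hae z hz h), ?_⟩
      refine ae_restrict_of_ae ?_
      change (z • X z h : DiffOp.L2 H Δ) =ᵐ[volume.restrict Δ] _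
      filter_upwards [Lp.coeFn_smul z (X z h), hae z hz h,
        ae_restrict_mem hΔ.ordConnected.measurableSet] with s h1 h2 h3
      rw [h1, Pi.smul_apply, h2, htop z s h3]
      rfl
    have hΦ : DifferentiableOn ℂ Φ (DiffOp.opResolventSet A) :=
      DiffOp.differentiableOn_graphMap _
        (DiffOp.differentiableOn_comp_subtypeL (hR.differentiableOn_transfer w))
    have hmem : ∀ z ∈ DiffOp.opResolventSet A, ∀ h,
        Φ z h ∈ DiffOp.localGraph l (max t c₀) := fun z hz h => ⟨_, _, hrep z hz h⟩
    refine DiffOp.differentiableOn_of_bounded_on_submodule he hΦ hmem fun z hz h => ?_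
    refine Eq.trans ?_ (he' ⟨Φ z h, hmem z hz h⟩ _ _ (hrep z hz h)).symm
    rw [DiffOp.opQuasiDeriv, (hPQ z).quasiDeriv_eq hn huniq hk.le t ht]
    simp only [DiffOp.quasiSeq]
    split_ifs <;> rfl
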